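/- Let $k$ be a $\sigma$-field, i.e. a field with a ring endomorphism $\sigma\colon k\to k$ (not necessarily surjective). A $k$-$\sigma$-algebra is a commutative $k$-algebra $R$ with a ring endomorphism $\sigma\colon R\to R$ extending that of $k$; morphisms are the $k$-algebra morphisms commuting with $\sigma$. It is finitely $\sigma$-generated if it is the smallest $k$-subalgebra stable under $\sigma$ containing some finite subset. A $\sigma$-algebraic group $G$ over $k$ is a functor from $k$-$\sigma$-algebras to groups whose underlying set-valued functor is represented by a finitely $\sigma$-generated $k$-$\sigma$-algebra $k\{G\}$; a morphism $\phi\colon G\to H$ is a morphism of such functors, with dual morphism $\phi^*\colon k\{H\}\to k\{G\}$, and $\ker(\phi)$ is the subfunctor $R\mapsto\ker(G(R)\to H(R))$ of $G$. A $\sigma$-closed subgroup $N$ of $G$ is a family of subgroups $N(R)\le G(R)$, for all $k$-$\sigma$-algebras $R$, that is of the form $N(R)=\{g\in G(R)\mid f(g)=0 \text{ for all } f\in F\}$ for some subset $F\subseteq k\{G\}$ independent of $R$; it is normal if every $N(R)$ is normal in $G(R)$. A quotient of $G$ mod $N$ is a morphism of $\sigma$-algebraic groups $\pi\colon G\to Q$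 with $N\subseteq\ker(\pi)$ such that for every morphism of $\sigma$-algebraic groups $\phi\colon G\to H$ with $N\subseteq\ker(\phi)$ there is a unique morphism of $\sigma$-algebraic groups $\phi'\colon Q\to H$ with $\phi'\circ\pi=\phi$. **Theorem.** Let $G$ be a $\sigma$-algebraic group over $k$ and $N$ a normal $\sigma$-closed subgroup of $G$. Then a quotient of $G$ mod $N$ exists (as a $\sigma$-algebraic group, so with a finitely $\sigma$-generated coordinate ring). Moreover, a morphism of $\sigma$-algebraic groups $\pi\colon G\to Q$ is a quotient of $G$ mod $N$ if and only if $\ker(\pi)=N$ and $\pi^*\colon k\{Q\}\to k\{G\}$ is injective. -/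

import Mathlib

open CategoryTheory

universe u

/-- A `k`-`σ`-algebra over a difference field `(k, σ)`: a commutative `k`-algebra with a ring
endomorphism `shift` (again not assumed injective) that extends `σ`. -/
structure DiffAlg (k : Type u) [Field k] (σ : k →+* k) where
  carrier : Type u
  [commRing : CommRing carrier]
  [algebra : Algebra k carrier]
  shift : carrier →+* carrier
  shift_algebraMap : ∀ a : k, shift (algebraMap k carrier a) = algebraMap k carrier (σ a)

namespace DiffAlg

variable {k : Type u} [Field k] {σ : k →+* k}

instance : CoeSort (DiffAlg k σ) (Type u) := ⟨DiffAlg.carrier⟩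

attribute [instance] DiffAlg.commRing DiffAlg.algebra

/-- Morphisms of `k`-`σ`-algebras: `k`-algebra morphisms commuting with the endomorphisms. -/
@[ext]
structure Hom (A B : DiffAlg k σ) where
  toAlgHom : A →ₐ[k] B
  map_shift : ∀ a : A, toAlgHom (A.shift a) = B.shift (toAlgHom a)

/-- The category of `k`-`σ`-algebras. -/
instance : Category (DiffAlg k σ) where
  Hom A B := Hom A B
  id A := ⟨AlgHom.id k A, fun _ => rfl⟩
  comp f g := ⟨g.toAlgHom.comp f.toAlgHom, fun a => by simp [f.map_shift, g.map_shift]⟩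

/-- The smallest `k`-`σ`-subalgebra `k{S}` of `A` containing `S`. -/
def adjoin (A : DiffAlg k σ) (S : Set A) : Subalgebra k A :=
  sInf {B : Subalgebra k A | S ⊆ B ∧ ∀ b ∈ B, A.shift b ∈ B}

/-- `A` is finitely `σ`-generated over `k`. -/
def FinitelyGenerated (A : DiffAlg k σ) : Prop :=
  ∃ S : Set A, S.Finite ∧ A.adjoin S = ⊤

end DiffAlg

/-- A `σ`-algebraic group over `(k, σ)`: a functor from `k`-`σ`-algebras to groups, together with a
finitely `σ`-generated `k`-`σ`-algebra, its coordinate ring, representing the underlying functor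
to sets. -/
structure DiffAlgGroup (k : Type u) [Field k] (σ : k →+* k) where
  functor : DiffAlg k σ ⥤ GrpCat.{u}
  coordRing : DiffAlg k σ
  finitelyGenerated : coordRing.FinitelyGenerated
  corep : (functor ⋙ forget GrpCat.{u}).CorepresentableBy coordRing

namespace DiffAlgGroup

variable {k : Type u} [Field k] {σ : k →+* k}

/-- The group `G(R)` of `R`-rational points. -/
abbrev points (G : DiffAlgGroup k σ) (R : DiffAlg k σ) : Type u := G.functor.obj R

/-- The morphism `k{G} ⟶ R` of `k`-`σ`-algebras corresponding to a point of `G(R)`. -/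
def pointHom (G : DiffAlgGroup k σ) {R : DiffAlg k σ} (g : G.points R) : G.coordRing ⟶ R :=
  G.corep.homEquiv.symm g

/-- The value `f(g) ∈ R` of `f ∈ k{G}` at a point `g ∈ G(R)`. -/
def eval (G : DiffAlgGroup k σ) (f : G.coordRing) {R : DiffAlg k σ} (g : G.points R) : R :=
  (G.pointHom g).toAlgHom f

/-- Morphisms of `σ`-algebraic groups: morphisms of functors that respect the group structure. -/
abbrev Hom (G H : DiffAlgGroup k σ) := G.functor ⟶ H.functor

/-- The dual morphism `φ^* : k{H} ⟶ k{G}`. It corresponds to the `k{G}`-point of `H` that is the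
image under `φ` of the universal point of `G`. -/
def Hom.dual {G H : DiffAlgGroup k σ} (φ : G.Hom H) : H.coordRing ⟶ G.coordRing :=
  H.pointHom ((φ.app G.coordRing).hom (G.corep.homEquiv (𝟙 G.coordRing)))

/-- The kernel of a morphism: the subfunctor `R ↦ ker (G(R) → H(R))`. -/
def Hom.ker {G H : DiffAlgGroup k σ} (φ : G.Hom H) (R : DiffAlg k σ) : Subgroup (G.points R) :=
  (φ.app R).hom.ker

/-- A `σ`-closed subgroup of `G`: subgroups `N(R) ≤ G(R)` for all `k`-`σ`-algebras `R` that are cut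
out, uniformly in `R`, by a set of equations in the coordinate ring `k{G}`. -/
structure ClosedSubgroup (G : DiffAlgGroup k σ) where
  subgroup : ∀ R : DiffAlg k σ, Subgroup (G.points R)
  isClosed : ∃ F : Set G.coordRing, ∀ (R : DiffAlg k σ) (g : G.points R),
    g ∈ subgroup R ↔ ∀ f ∈ F, G.eval f g = 0

/-- `N` is normal in `G`: every `N(R)` is a normal subgroup of `G(R)`. -/
def ClosedSubgroup.IsNormal {G : DiffAlgGroup k σ} (N : G.ClosedSubgroup) : Prop :=
  ∀ R : DiffAlg k σ, (N.subgroup R).Normal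

/-- `π : G → Q` is a quotient of `G` mod `N`: it is universal among the morphisms of `σ`-algebraic
groups from `G` whose kernel contains `N`. -/
def IsQuotient {G : DiffAlgGroup k σ} (N : G.ClosedSubgroup) {Q : DiffAlgGroup k σ}
    (π : G.Hom Q) : Prop :=
  (∀ R, N.subgroup R ≤ π.ker R) ∧
    ∀ (H : DiffAlgGroup k σ) (φ : G.Hom H), (∀ R, N.subgroup R ≤ φ.ker R) →
      ∃! φ' : Q.Hom H, π ≫ φ' = φ

end DiffAlgGroup

/-!
# Quotients of `σ`-algebraic groups

By Yoneda's lemma the coordinate ring `A = k{G}` is a commutative Hopf algebra over `k` with a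
compatible endomorphism `s` (`DiffAlgGroup.isHopfShift`), and a closed subgroup `N` corresponds to
an `s`-stable Hopf ideal `I` of `A`, its vanishing ideal. Since every pair of points of the
underlying affine group schemes is a specialization of a universal pair defined over a
`k`-`σ`-algebra (`ClosedSubgroup.exists_eq_map_pair`), `I` is normal as a Hopf ideal of `A`
without endomorphism. The coordinate ring of the quotient is the algebra `B` of functions on `G`
invariant under translation by `N`. The argument rests on four facts.

* *Purity.* A commutative Hopf algebra is pure over each of its Hopf subalgebras `B`
  (`AffineGroup.eq_zero_of_tmul_one_eq_zero`). Since `A` is a union of `B`-modules that are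
  finitely generated and carry a coaction, this follows from the fact that a finitely generated
  `B`-module `M` with a coaction is flat: the annihilator of each exterior power of `M` is
  invariant under translation, hence `0` or `B`, so `M` is locally free of constant rank. As a
  consequence, a function invariant under the kernel of the quotient map defined by `B` lies in
  `B` (`IsHopfSubalgebra.mem_of_invariant`), and `B` is determined by the ideal of that kernel.
* *Enough invariants.* A normal Hopf ideal `I` is generated by the invariants vanishing at the
  identity (`IsNormalIdeal.augIdeal_invariants`), so that `N` is the kernel of `G → Q`. The
  Plücker coordinates of `V ∩ I`, for a finite-dimensional subrepresentation `V` of `A`, transform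
  under `N` through a character. The span of their inverses is a finite-dimensional representation
  on which `N` acts by commuting operators. Commuting operators are simultaneously self-adjoint
  for a nonzero bilinear form, and the resulting function of two variables twists the Plücker
  coordinates into invariant functions. No finiteness of `A`, and no extension of `k`, is needed.
* *Finiteness of ideals.* If `A` is finitely `σ`-generated, then `I` is finitely generated as an
  `s`-stable ideal (`IsHopfShift.exists_finite_generators`). The ideals of symbols of order `i` of
  elements of `I` form a sequence of polynomial ideals that increases along `σ`. It stabilizes, by
  Hilbert's basis theorem over the direct limit of `k` along `σ` (`exists_map_eq_of_map_le`); the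
  endomorphism `σ` need not be surjective.
* *Finiteness of invariants.* Finitely many invariants generate `I` as an `s`-stable ideal. They
  lie in a finitely `σ`-generated stable Hopf subalgebra of `B` that defines the same ideal as
  `B`, so it is equal to `B` by purity (`IsHopfShift.exists_finite_generators_invariants`).

For a morphism `π : G → Q` with kernel `N` and injective dual, the image of the dual is a Hopf
subalgebra that generates `I`. If `N` lies in the kernel of `φ : G → H`, the functions in the
image of the dual of `φ` are invariant under `N`, so they lie in the image of the dual of `π`;
hence `φ` factors uniquely through `π` (`DiffAlgGroup.isQuotient_of_ker_eq`). The converse holds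
because quotients are unique up to isomorphism.
-/

/-! ### Tensor slices, points, Hopf subalgebras and subcomodules -/

open TensorProduct Coalgebra Bialgebra HopfAlgebra WithConv

namespace AffineGroup

section Slices

variable {k M N : Type*} [Field k] [AddCommGroup M] [Module k M] [AddCommGroup N] [Module k N]

/-- The slice `id ⊗ φ : M ⊗ N → M` of a tensor along a linear form `φ` on the second factor. -/
noncomputable def slice (φ : Module.Dual k N) : M ⊗[k] N →ₗ[k] M :=
  (TensorProduct.rid k M).toLinearMap ∘ₗ φ.lTensor M

@[simp] lemma slice_tmul (φ : Module.Dual k N) (m : M) (n : N) :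
    slice φ (m ⊗ₜ[k] n) = φ n • m := by simp [slice]

lemma slice_map {M' N' : Type*} [AddCommGroup M'] [Module k M'] [AddCommGroup N'] [Module k N']
    (φ : Module.Dual k N') (f : M →ₗ[k] M') (g : N →ₗ[k] N') (z : M ⊗[k] N) :
    slice φ (TensorProduct.map f g z) = f (slice (φ ∘ₗ g) z) := by
  induction z with
  | zero => simp
  | tmul x y => simp
  | add x y hx hy => simp [hx, hy]

/-- Membership in `U ⊗ N` is tested by slices. -/
lemma mem_range_rTensor_iff (U : Submodule k M) (z : M ⊗[k] N) :
    z ∈ LinearMap.range (U.subtype.rTensor N) ↔ ∀ φ : Module.Dual k N, slice φ z ∈ U := by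
  constructor
  · rintro ⟨w, rfl⟩ φ
    rw [LinearMap.rTensor, slice_map]
    exact Subtype.coe_prop _
  · intro h
    obtain ⟨c, hc⟩ := TensorProduct.eq_repr_basis_right (Module.Basis.ofVectorSpace k N) z
    have hci : ∀ i, c i ∈ U := by
      intro i
      have := h ((Module.Basis.ofVectorSpace k N).coord i)
      rw [← hc, Finsupp.sum, map_sum] at this
      simp only [slice_tmul, Module.Basis.coord_apply, Module.Basis.repr_self] at this
      rwa [Finset.sum_eq_single i (by intro j _ hj; simp [hj])
        (by intro hi; simp [Finsupp.notMem_support_iff.1 hi]), Finsupp.single_eq_same,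
        one_smul] at this
    rw [← hc]
    exact Submodule.sum_mem _ fun i _ =>
      ⟨(⟨c i, hci i⟩ : U) ⊗ₜ[k] Module.Basis.ofVectorSpace k N i, by simp⟩

/-- A linearly independent family has a dual family of linear forms. -/
lemma exists_dual_family {ι : Type*} [DecidableEq ι] {b : ι → M} (hb : LinearIndependent k b) :
    ∃ φ : ι → Module.Dual k M, ∀ i j, φ i (b j) = if i = j then 1 else 0 := by
  classical
  refine ⟨fun i => (Module.Basis.extend hb.linearIndepOn_id).coord
    ⟨b i, hb.linearIndepOn_id.subset_extend _ ⟨i, rfl⟩⟩, fun i j => ?_⟩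
  have : b j = Module.Basis.extend hb.linearIndepOn_id
      ⟨b j, hb.linearIndepOn_id.subset_extend _ ⟨j, rfl⟩⟩ := by simp
  conv_lhs => rw [this]
  rw [Module.Basis.coord_apply, Module.Basis.repr_self, Finsupp.single_apply]
  simp [hb.injective.eq_iff, eq_comm]

lemma eq_zero_of_sum_tmul_left {ι : Type*} [Fintype ι] {b : ι → M} (hb : LinearIndependent k b)
    {z : ι → N} (h : ∑ i, b i ⊗ₜ[k] z i = 0) (i : ι) : z i = 0 := by
  classical
  obtain ⟨φ, hφ⟩ := exists_dual_family hb
  have := congrArg ((TensorProduct.lid k N).toLinearMap ∘ₗ (φ i).rTensor N) h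
  simpa [hφ, ite_smul] using this

lemma eq_zero_of_sum_tmul_right {ι : Type*} [Fintype ι] {b : ι → N} (hb : LinearIndependent k b)
    {z : ι → M} (h : ∑ i, z i ⊗ₜ[k] b i = 0) (i : ι) : z i = 0 := by
  classical
  obtain ⟨φ, hφ⟩ := exists_dual_family hb
  have := congrArg (slice (φ i)) h
  simpa [hφ, ite_smul] using this

/-- Every tensor can be written as `∑ mᵢ ⊗ nᵢ` with linearly independent `nᵢ`. -/
lemma exists_sum_tmul_linearIndependent (z : M ⊗[k] N) :
    ∃ (n : ℕ) (x : Fin n → M) (y : Fin n → N), LinearIndependent k y ∧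
      z = ∑ i, x i ⊗ₜ[k] y i := by
  obtain ⟨c, hc⟩ := TensorProduct.eq_repr_basis_right (Module.Basis.ofVectorSpace k N) z
  let e := c.support.equivFin.symm
  refine ⟨_, fun i => c (e i), fun i => Module.Basis.ofVectorSpace k N (e i),
    (Module.Basis.linearIndependent _).comp _ (Subtype.val_injective.comp e.injective), ?_⟩
  rw [← hc, Finsupp.sum, ← Finset.sum_coe_sort]
  exact (e.sum_comp fun i : c.support => c i ⊗ₜ[k] Module.Basis.ofVectorSpace k N i).symm

end Slices

section Points

variable {k A : Type u} [Field k] [CommRing A] [HopfAlgebra k A]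

/-- The group of `R`-valued points of the affine group scheme with coordinate ring `A`, that is,
the set of `k`-algebra morphisms `A → R` with the convolution product. -/
def Pt (k A R : Type u) [Field k] [CommRing A] [HopfAlgebra k A] [CommRing R] [Algebra k R] :
    Type u := WithConv (A →ₐ[k] R)

variable {R S : Type u} [CommRing R] [Algebra k R] [CommRing S] [Algebra k S]

namespace Pt

/-- The algebra morphism underlying a point. -/
def hom (g : Pt k A R) : A →ₐ[k] R := WithConv.ofConv g

/-- The point given by an algebra morphism. -/
def mk (f : A →ₐ[k] R) : Pt k A R := WithConv.toConv f

instance : FunLike (Pt k A R) A R where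
  coe g := g.hom
  coe_injective _ _ H := WithConv.ofConv_injective (DFunLike.coe_injective H)

instance : AlgHomClass (Pt k A R) k A R where
  map_mul g := map_mul g.hom
  map_one g := map_one g.hom
  map_add g := map_add g.hom
  map_zero g := map_zero g.hom
  commutes g := g.hom.commutes

@[simp] lemma hom_apply (g : Pt k A R) (f : A) : g.hom f = g f := rfl
@[simp] lemma mk_apply (g : A →ₐ[k] R) (f : A) : mk g f = g f := rfl

noncomputable instance : Monoid (Pt k A R) := inferInstanceAs (Monoid (WithConv (A →ₐ[k] R)))

lemma ext' {g h : Pt k A R} (H : ∀ f, g f = h f) : g = h :=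
  DFunLike.ext _ _ H

lemma one_apply (f : A) : (1 : Pt k A R) f = algebraMap k R (counit f) := rfl

lemma mul_apply (g h : Pt k A R) (f : A) :
    (g * h) f = Algebra.TensorProduct.lift g.hom h.hom (fun _ _ => .all ..) (comul f) :=
  AlgHom.convMul_apply _ _ f

lemma mul_apply_sum (g h : Pt k A R) {f : A} {ι : Type*} {s : Finset ι} {x y : ι → A}
    (hf : comul f = ∑ i ∈ s, x i ⊗ₜ[k] y i) : (g * h) f = ∑ i ∈ s, g (x i) * h (y i) := by
  simp [mul_apply, hf]

noncomputable instance : Group (Pt k A R) where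
  inv g := mk (g.hom.comp (antipodeAlgHom k A))
  inv_mul_cancel g := by
    refine ext' fun f => ?_
    rw [mul_apply, one_apply, ← g.hom.commutes, ← mul_antipode_rTensor_comul_apply (R := k) f]
    generalize (comul f : A ⊗[k] A) = z
    induction z with
    | zero => simp
    | tmul x y => simp [hom, mk]
    | add x y hx hy => simp only [map_add, hx, hy]

lemma inv_apply (g : Pt k A R) (f : A) : g⁻¹ f = g (antipode k f) := rfl

/-- Functoriality of the points in the value ring. -/
noncomputable def map (φ : R →ₐ[k] S) : Pt k A R →* Pt k A S where
  toFun g := mk (φ.comp g.hom)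
  map_one' := ext' fun f => by simp [one_apply]
  map_mul' g h := WithConv.ext (AlgHom.comp_convMul_distrib φ g h)

@[simp] lemma map_apply (φ : R →ₐ[k] S) (g : Pt k A R) (f : A) : map φ g f = φ (g f) := rfl

variable (k A) in
/-- The universal point. -/
def univ : Pt k A A := mk (AlgHom.id k A)

variable (k A R) in
/-- The universal point over `A ⊗ R`. -/
noncomputable def inl : Pt k A (A ⊗[k] R) := mk Algebra.TensorProduct.includeLeft

variable (k A R) in
/-- The universal point over `R ⊗ A`. -/
noncomputable def inr : Pt k A (R ⊗[k] A) := mk Algebra.TensorProduct.includeRight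

@[simp] lemma inl_apply (f : A) : inl k A R f = f ⊗ₜ 1 := rfl
@[simp] lemma inr_apply (f : A) : inr k A R f = 1 ⊗ₜ f := rfl

lemma inl_mul_inr (f : A) : (inl k A A * inr k A A) f = comul f := by
  rw [mul_apply]
  have : (Algebra.TensorProduct.lift (inl k A A).hom
      (inr k A A).hom (fun _ _ => .all ..)) = AlgHom.id k _ := by
    ext <;> simp
  rw [this]; rfl

end Pt

lemma antipode_antipode (f : A) : antipode k (antipode k f) = f := by
  have : ((Pt.univ k A)⁻¹)⁻¹ f = Pt.univ k A f := by rw [inv_inv]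
  exact this

lemma comul_antipode (f : A) : comul (R := k) (antipode k f) =
    TensorProduct.map (antipode k) (antipode k) (TensorProduct.comm k A A (comul f)) := by
  have : (Pt.inl k A A * Pt.inr k A A)⁻¹ f = ((Pt.inr k A A)⁻¹ * (Pt.inl k A A)⁻¹) f := by
    rw [mul_inv_rev]
  rw [Pt.inv_apply, Pt.inl_mul_inr, Pt.mul_apply] at this
  rw [this]
  generalize (comul f : A ⊗[k] A) = z
  induction z with
  | zero => simp
  | tmul x y =>
    change ((1 : A) ⊗ₜ[k] antipode k x) * (antipode k y ⊗ₜ[k] (1 : A)) = _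
    simp
  | add x y hx hy => simp only [map_add, hx, hy]

end Points

section HopfSubalgebra

variable {k A : Type u} [Field k] [CommRing A] [HopfAlgebra k A]

/-- A subalgebra `B` of a commutative Hopf algebra that is a Hopf subalgebra:
`Δ(B) ⊆ B ⊗ B` and `S(B) ⊆ B`. -/
structure IsHopfSubalgebra (B : Subalgebra k A) : Prop where
  comul_mem : ∀ b ∈ B, comul b ∈ (Algebra.TensorProduct.map B.val B.val).range
  antipode_mem : ∀ b ∈ B, antipode k b ∈ B

lemma tmul_mem_range_map {B : Subalgebra k A} {x y : A} (hx : x ∈ B) (hy : y ∈ B) :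
    x ⊗ₜ[k] y ∈ (Algebra.TensorProduct.map B.val B.val).range :=
  ⟨(⟨x, hx⟩ : B) ⊗ₜ (⟨y, hy⟩ : B), rfl⟩

lemma range_map_mono {B C : Subalgebra k A} (h : B ≤ C) :
    (Algebra.TensorProduct.map B.val B.val).range ≤
      (Algebra.TensorProduct.map C.val C.val).range := by
  rintro _ ⟨z, rfl⟩
  induction z with
  | zero => rw [map_zero]; exact Subalgebra.zero_mem _
  | tmul x y => exact tmul_mem_range_map (h x.2) (h y.2)
  | add x y hx hy => rw [map_add]; exact Subalgebra.add_mem _ hx hy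

/-- It suffices to check the axioms of a Hopf subalgebra on algebra generators. -/
lemma isHopfSubalgebra_adjoin {s : Set A}
    (hc : ∀ x ∈ s, comul x ∈ (Algebra.TensorProduct.map (Algebra.adjoin k s).val
      (Algebra.adjoin k s).val).range)
    (ha : ∀ x ∈ s, antipode k x ∈ Algebra.adjoin k s) :
    IsHopfSubalgebra (Algebra.adjoin k s) where
  comul_mem := by
    have : Algebra.adjoin k s ≤ ((Algebra.TensorProduct.map (Algebra.adjoin k s).val
        (Algebra.adjoin k s).val).range).comap (comulAlgHom k A) :=
      Algebra.adjoin_le hc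
    exact this
  antipode_mem := by
    have : Algebra.adjoin k s ≤ (Algebra.adjoin k s).comap (antipodeAlgHom k A) :=
      Algebra.adjoin_le ha
    exact this

lemma IsHopfSubalgebra.iSup {ι : Sort*} {B : ι → Subalgebra k A}
    (h : ∀ i, IsHopfSubalgebra (B i)) : IsHopfSubalgebra (⨆ i, B i) where
  comul_mem := by
    have : ⨆ i, B i ≤ ((Algebra.TensorProduct.map (⨆ i, B i).val
        (⨆ i, B i).val).range).comap (comulAlgHom k A) :=
      iSup_le fun i b hb => range_map_mono (le_iSup B i) ((h i).comul_mem b hb)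
    exact this
  antipode_mem := by
    have : ⨆ i, B i ≤ (⨆ i, B i).comap (antipodeAlgHom k A) :=
      iSup_le fun i b hb => le_iSup B i ((h i).antipode_mem b hb)
    exact this

/-- `Δ b` for `b` in a Hopf subalgebra, written with linearly independent right factors. -/
lemma IsHopfSubalgebra.exists_comul_eq {B : Subalgebra k A} (hB : IsHopfSubalgebra B) {b : A}
    (hb : b ∈ B) : ∃ (n : ℕ) (x y : Fin n → B),
      LinearIndependent k (fun i => (y i : A)) ∧ comul b = ∑ i, (x i : A) ⊗ₜ[k] (y i : A) := by
  obtain ⟨z, hz⟩ := hB.comul_mem b hb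
  obtain ⟨n, x, y, hy, rfl⟩ := exists_sum_tmul_linearIndependent z
  refine ⟨n, x, y, hy.map' B.val.toLinearMap ?_, ?_⟩
  · exact LinearMap.ker_eq_bot.2 Subtype.val_injective
  · rw [← hz]; simp

lemma sum_counit_smul_of_comul_eq {ι : Type*} [Fintype ι] {b : A} {x y : ι → A}
    (h : comul b = ∑ i, x i ⊗ₜ[k] y i) : ∑ i, counit (R := k) (x i) • y i = b := by
  have := rTensor_counit_comul (R := k) b
  rw [h] at this
  simpa using congrArg (TensorProduct.lid k A) this

lemma sum_smul_counit_of_comul_eq {ι : Type*} [Fintype ι] {b : A} {x y : ι → A}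
    (h : comul b = ∑ i, x i ⊗ₜ[k] y i) : ∑ i, counit (R := k) (y i) • x i = b := by
  have := lTensor_counit_comul (R := k) b
  rw [h] at this
  simpa using congrArg (TensorProduct.rid k A) this

lemma sum_mul_antipode_of_comul_eq {ι : Type*} [Fintype ι] {b : A} {x y : ι → A}
    (h : comul b = ∑ i, x i ⊗ₜ[k] y i) :
    ∑ i, x i * antipode k (y i) = algebraMap k A (counit b) := by
  have := mul_antipode_lTensor_comul_apply (R := k) b
  rw [h] at this
  simpa using this

lemma sum_antipode_mul_of_comul_eq {ι : Type*} [Fintype ι] {b : A} {x y : ι → A}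
    (h : comul b = ∑ i, x i ⊗ₜ[k] y i) :
    ∑ i, antipode k (x i) * y i = algebraMap k A (counit b) := by
  have := mul_antipode_rTensor_comul_apply (R := k) b
  rw [h] at this
  simpa using this

end HopfSubalgebra

section Comodules

variable {k A : Type u} [Field k] [CommRing A] [HopfAlgebra k A]

/-- A subspace of a Hopf algebra stable under right translation: `Δ(V) ⊆ V ⊗ A`. -/
def IsSubcomodule (V : Submodule k A) : Prop :=
  ∀ v ∈ V, comul v ∈ LinearMap.range (V.subtype.rTensor A)

lemma IsSubcomodule.sup {V W : Submodule k A} (hV : IsSubcomodule V) (hW : IsSubcomodule W) :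
    IsSubcomodule (V ⊔ W) := by
  intro v hv
  obtain ⟨x, hx, y, hy, rfl⟩ := Submodule.mem_sup.1 hv
  rw [mem_range_rTensor_iff]
  intro φ
  rw [map_add, map_add]
  exact Submodule.add_mem _
    (Submodule.mem_sup_left ((mem_range_rTensor_iff _ _).1 (hV x hx) φ))
    (Submodule.mem_sup_right ((mem_range_rTensor_iff _ _).1 (hW y hy) φ))

/-- Right translation by a linear form: `f ↦ ∑ f₍₁₎ φ(f₍₂₎)`. -/
noncomputable def translate (φ : Module.Dual k A) : A →ₗ[k] A := slice φ ∘ₗ comul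

lemma translate_apply (φ : Module.Dual k A) (f : A) : translate φ f = slice φ (comul f) := rfl

/-- Translations by linear forms compose according to the convolution product of the linear forms;
hence the translates of `f` span a subcomodule. -/
lemma slice_comul_translate (φ ψ : Module.Dual k A) (f : A) :
    slice ψ (comul (translate φ f)) =
      slice (TensorProduct.lift ((LinearMap.mul k k).compl₁₂ ψ φ) ∘ₗ comul) (comul f) := by
  have h := coassoc_apply (R := k) f
  have h1 : ∀ z : A ⊗[k] A, slice ψ (comul (slice φ z)) =
      slice (TensorProduct.lift ((LinearMap.mul k k).compl₁₂ ψ φ))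
        (TensorProduct.assoc k A A A (comul.rTensor A z)) := by
    intro z
    induction z with
    | zero => simp
    | tmul x y =>
      simp only [slice_tmul, map_smul, LinearMap.rTensor_tmul]
      generalize (comul x : A ⊗[k] A) = w
      induction w with
      | zero => simp
      | tmul a b => simp [smul_smul, mul_comm]
      | add a b ha hb => simp only [map_add, smul_add, ha, hb, add_tmul]
    | add x y hx hy => simp only [map_add, hx, hy]
  have h2 : ∀ z : A ⊗[k] A, slice (TensorProduct.lift ((LinearMap.mul k k).compl₁₂ ψ φ))
      (comul.lTensor A z) =
      slice (TensorProduct.lift ((LinearMap.mul k k).compl₁₂ ψ φ) ∘ₗ comul) z := by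
    intro z
    induction z with
    | zero => simp
    | tmul x y => simp
    | add x y hx hy => simp only [map_add, hx, hy]
  rw [translate_apply, h1, h, h2]

lemma translate_counit (f : A) : translate (counit (R := k)) f = f := by
  rw [translate_apply, slice, LinearMap.comp_apply, lTensor_counit_comul]
  simp

/-- Every element of a Hopf algebra lies in a finite-dimensional subcomodule. -/
lemma exists_finiteDimensional_subcomodule (f : A) :
    ∃ V : Submodule k A, FiniteDimensional k V ∧ f ∈ V ∧ IsSubcomodule V := by
  let T : Module.Dual k A →ₗ[k] A :=
    { toFun := fun φ => translate φ f
      map_add' := fun φ ψ => by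
        simp only [translate_apply, slice, LinearMap.lTensor_add, LinearMap.comp_add,
          LinearMap.add_apply]
      map_smul' := fun c φ => by
        simp only [translate_apply, slice, LinearMap.lTensor_smul, LinearMap.comp_smul,
          LinearMap.smul_apply, RingHom.id_apply] }
  refine ⟨LinearMap.range T, ?_, ⟨counit, translate_counit f⟩, ?_⟩
  · obtain ⟨n, x, y, -, hz⟩ := exists_sum_tmul_linearIndependent (comul f : A ⊗[k] A)
    have := FiniteDimensional.span_of_finite k (Set.finite_range x)
    refine Submodule.finiteDimensional_of_le (S₂ := Submodule.span k (Set.range x)) ?_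
    rintro _ ⟨φ, rfl⟩
    change slice φ (comul f) ∈ _
    rw [hz, map_sum]
    refine Submodule.sum_mem _ fun i _ => ?_
    rw [slice_tmul]
    exact Submodule.smul_mem _ _ (Submodule.subset_span ⟨i, rfl⟩)
  · rintro _ ⟨φ, rfl⟩
    rw [mem_range_rTensor_iff]
    intro ψ
    exact ⟨_, (slice_comul_translate φ ψ f).symm⟩

/-- Finite families lie in finite-dimensional subcomodules. -/
lemma exists_finiteDimensional_subcomodule_of_finite {ι : Type*} [Finite ι] (f : ι → A) :
    ∃ V : Submodule k A, FiniteDimensional k V ∧ (∀ i, f i ∈ V) ∧ IsSubcomodule V := by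
  classical
  cases nonempty_fintype ι
  suffices ∀ s : Finset ι, ∃ V : Submodule k A, FiniteDimensional k V ∧ (∀ i ∈ s, f i ∈ V) ∧
      IsSubcomodule V by
    obtain ⟨V, h1, h2, h3⟩ := this Finset.univ
    exact ⟨V, h1, fun i => h2 i (Finset.mem_univ i), h3⟩
  intro s
  induction s using Finset.induction_on with
  | empty => exact ⟨⊥, inferInstance, by simp, by
      intro v hv; rw [(Submodule.mem_bot k).1 hv, map_zero]; exact Submodule.zero_mem _⟩
  | insert i s _ ih =>
    obtain ⟨V, h1, h2, h3⟩ := ih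
    obtain ⟨W, h4, h5, h6⟩ := exists_finiteDimensional_subcomodule (k := k) (f i)
    refine ⟨V ⊔ W, inferInstance, ?_, h3.sup h6⟩
    intro j hj
    rcases Finset.mem_insert.1 hj with rfl | hj
    · exact Submodule.mem_sup_right h5
    · exact Submodule.mem_sup_left (h2 j hj)

/-- The matrix of coefficients of a finite-dimensional subcomodule with respect to a basis; it is a
matrix representation of the group. -/
lemma IsSubcomodule.exists_coeff {V : Submodule k A} (hV : IsSubcomodule V) {ι : Type*}
    [Fintype ι] [DecidableEq ι] (b : Module.Basis ι k V) :
    ∃ t : ι → ι → A, (∀ j, comul (R := k) (b j : A) = ∑ i, (b i : A) ⊗ₜ[k] t i j) ∧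
      (∀ i j, comul (R := k) (t i j) = ∑ l, t i l ⊗ₜ[k] t l j) ∧
      (∀ i j, counit (R := k) (t i j) = if i = j then 1 else 0) := by
  have key : ∀ j, ∃ t : ι → A, comul (R := k) (b j : A) = ∑ i, (b i : A) ⊗ₜ[k] t i := by
    intro j
    obtain ⟨w, hw⟩ := hV _ (b j).2
    obtain ⟨c, rfl⟩ := TensorProduct.eq_repr_basis_left b w
    refine ⟨fun i => c i, ?_⟩
    rw [← hw, Finsupp.sum_fintype _ _ (by simp), map_sum]
    simp
  choose t ht using key
  have hbi : LinearIndependent k fun i => (b i : A) :=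
    b.linearIndependent.map' V.subtype (Submodule.ker_subtype V)
  refine ⟨fun i j => t j i, ht, fun i j => ?_, fun i j => ?_⟩
  · have h := coassoc_apply (R := k) (b j : A)
    rw [ht j] at h
    simp only [map_sum, LinearMap.rTensor_tmul, LinearMap.lTensor_tmul, ht, sum_tmul,
      TensorProduct.assoc_tmul] at h
    rw [Finset.sum_comm] at h
    rw [← sub_eq_zero, ← Finset.sum_sub_distrib] at h
    simp only [← tmul_sum, ← tmul_sub] at h
    exact (sub_eq_zero.1 (eq_zero_of_sum_tmul_left hbi h i)).symm
  · have h := sum_smul_counit_of_comul_eq (ht j)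
    have h2 := linearIndependent_iff'.1 hbi Finset.univ
      (fun l => counit (R := k) (t j l) - if l = j then 1 else 0) (by
        simp only [sub_smul, Finset.sum_sub_distrib, h]
        simp) i (Finset.mem_univ i)
    exact sub_eq_zero.1 h2

lemma isHopfSubalgebra_top : IsHopfSubalgebra (⊤ : Subalgebra k A) where
  comul_mem b _ := by
    generalize (comul b : A ⊗[k] A) = z
    induction z with
    | zero => exact Subalgebra.zero_mem _
    | add x y hx hy => exact Subalgebra.add_mem _ hx hy
    | tmul x y => exact tmul_mem_range_map Algebra.mem_top Algebra.mem_top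
  antipode_mem _ _ := Algebra.mem_top

lemma IsHopfSubalgebra.slice_comul_mem {B : Subalgebra k A} (hB : IsHopfSubalgebra B) {b : A}
    (hb : b ∈ B) (φ : Module.Dual k A) : slice φ (comul b) ∈ B := by
  obtain ⟨n, x, y, -, hxy⟩ := hB.exists_comul_eq hb
  rw [hxy, map_sum]
  exact Subalgebra.sum_mem _ fun i _ => by
    rw [slice_tmul]; exact Subalgebra.smul_mem _ (x i).2 _

lemma IsHopfSubalgebra.slice_comm_comul_mem {B : Subalgebra k A} (hB : IsHopfSubalgebra B) {b : A}
    (hb : b ∈ B) (φ : Module.Dual k A) :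
    slice φ (TensorProduct.comm k A A (comul b)) ∈ B := by
  obtain ⟨n, x, y, -, hxy⟩ := hB.exists_comul_eq hb
  rw [hxy, map_sum, map_sum]
  exact Subalgebra.sum_mem _ fun i _ => by
    rw [TensorProduct.comm_tmul, slice_tmul]; exact Subalgebra.smul_mem _ (y i).2 _

/-- Every element of a Hopf subalgebra `B` lies in a finitely generated Hopf subalgebra of `B`,
generated by the coefficients of a finite-dimensional subcomodule and their antipodes. -/
lemma IsHopfSubalgebra.exists_fg {B : Subalgebra k A} (hB : IsHopfSubalgebra B) {f : A}
    (hfB : f ∈ B) : ∃ C ≤ B, C.FG ∧ f ∈ C ∧ IsHopfSubalgebra C := by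
  classical
  obtain ⟨V', hV', hf', hc'⟩ := exists_finiteDimensional_subcomodule (k := k) f
  let V : Submodule k A := V' ⊓ B.toSubmodule
  have hf : f ∈ V := ⟨hf', hfB⟩
  have hc : IsSubcomodule V := fun v hv => (mem_range_rTensor_iff _ _).2 fun φ =>
    ⟨(mem_range_rTensor_iff _ _).1 (hc' v hv.1) φ, hB.slice_comul_mem hv.2 φ⟩
  have : FiniteDimensional k V := Submodule.finiteDimensional_inf_left _ _
  let b := Module.finBasis k V
  obtain ⟨t, h1, h2, h3⟩ := hc.exists_coeff b
  let s : Set A := Set.range (fun p : Fin _ × Fin _ => t p.1 p.2) ∪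
    Set.range (fun p : Fin _ × Fin _ => antipode k (t p.1 p.2))
  have ht : ∀ i j, t i j ∈ Algebra.adjoin k s := fun i j =>
    Algebra.subset_adjoin (Or.inl ⟨(i, j), rfl⟩)
  have hSt : ∀ i j, antipode k (t i j) ∈ Algebra.adjoin k s := fun i j =>
    Algebra.subset_adjoin (Or.inr ⟨(i, j), rfl⟩)
  have htB : ∀ i j, t i j ∈ B := by
    intro i j
    obtain ⟨φ, hφ⟩ := exists_dual_family
      (b.linearIndependent.map' V.subtype (Submodule.ker_subtype _))
    have h4 : ∀ l, φ i (b l : A) = if i = l then 1 else 0 := hφ i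
    have h5 := hB.slice_comm_comul_mem (b j).2.2 (φ i)
    rw [h1, map_sum, map_sum] at h5
    simpa [h4, ite_smul] using h5
  refine ⟨Algebra.adjoin k s, ?_, ?_, ?_, isHopfSubalgebra_adjoin ?_ ?_⟩
  · rw [Algebra.adjoin_le_iff]
    rintro _ (⟨⟨i, j⟩, rfl⟩ | ⟨⟨i, j⟩, rfl⟩)
    · exact htB i j
    · exact hB.antipode_mem _ (htB i j)
  · exact Subalgebra.fg_def.2 ⟨s, (Set.finite_range _).union (Set.finite_range _), rfl⟩
  · have hb : ∀ j, (b j : A) ∈ Algebra.adjoin k s := by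
      intro j
      rw [← sum_counit_smul_of_comul_eq (h1 j)]
      exact Subalgebra.sum_mem _ fun i _ => Subalgebra.smul_mem _ (ht i j) _
    have := congrArg (Subtype.val) (b.sum_repr ⟨f, hf⟩)
    rw [← show _ = f from this, Submodule.coe_sum]
    exact Subalgebra.sum_mem _ fun i _ => Subalgebra.smul_mem _ (hb i) _
  · rintro _ (⟨⟨i, j⟩, rfl⟩ | ⟨⟨i, j⟩, rfl⟩)
    · simp only [h2]
      exact Subalgebra.sum_mem _ fun l _ => tmul_mem_range_map (ht i l) (ht l j)
    · simp only [comul_antipode, h2, map_sum, TensorProduct.comm_tmul, TensorProduct.map_tmul]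
      exact Subalgebra.sum_mem _ fun l _ => tmul_mem_range_map (hSt l j) (hSt i l)
  · rintro _ (⟨⟨i, j⟩, rfl⟩ | ⟨⟨i, j⟩, rfl⟩)
    · exact hSt i j
    · simpa only [antipode_antipode] using ht i j

lemma IsHopfSubalgebra.exists_fg_of_finite {B : Subalgebra k A} (hB : IsHopfSubalgebra B)
    {s : Set A} (hs : s.Finite) (hsB : s ⊆ B) :
    ∃ C ≤ B, C.FG ∧ s ⊆ C ∧ IsHopfSubalgebra C := by
  choose C h0 h1 h2 h3 using fun f : B => hB.exists_fg f.2
  have := hs.to_subtype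
  refine ⟨⨆ i : s, C ⟨i, hsB i.2⟩, iSup_le fun i => h0 _, ?_,
    fun x hx => le_iSup (fun i : s => C ⟨i, hsB i.2⟩) ⟨x, hx⟩ (h2 _),
    IsHopfSubalgebra.iSup fun i => h3 _⟩
  choose t ht using h1
  refine Subalgebra.fg_def.2 ⟨⋃ i : s, (t ⟨i, hsB i.2⟩ : Set A),
    Set.finite_iUnion fun i => (t _).finite_toSet, ?_⟩
  rw [Algebra.adjoin_iUnion]
  exact iSup_congr fun i => ht _

end Comodules

end AffineGroup

/-! ### Exterior powers and flatness -/

namespace AffineGroup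

section Wedge

variable (B M : Type*) [CommRing B] [AddCommGroup M] [Module B M]

/-- The annihilator of the `j`-th exterior power of `M`, the latter being spanned by the products of
`j` elements of `M` in the exterior algebra. -/
def wedgeAnn (j : ℕ) : Ideal B where
  carrier := {b | ∀ x : Fin j → M, b • ExteriorAlgebra.ιMulti B j x = 0}
  add_mem' ha hb x := by rw [add_smul, ha x, hb x, add_zero]
  zero_mem' x := zero_smul _ _
  smul_mem' c b hb x := by rw [smul_assoc, hb x, smul_zero]

variable {B M}

/-- Elements of `wedgeAnn` kill all products `f x₁ ⋯ f xⱼ` for a square-zero map `f` to any ring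
over `B`; the structure map is passed explicitly. -/
lemma mul_prod_eq_zero_of_mem_wedgeAnn {j : ℕ} {b : B} (hb : b ∈ wedgeAnn B M j) {T : Type*}
    [Ring T] (c : B →+* T) (hc : ∀ b t, c b * t = t * c b) (f : M →+ T)
    (hf : ∀ b m, f (b • m) = c b * f m) (hsq : ∀ m, f m * f m = 0) (x : Fin j → M) :
    c b * (List.ofFn fun i => f (x i)).prod = 0 := by
  let _ : Algebra B T := c.toAlgebra' hc
  let f' : M →ₗ[B] T :=
    { f with
      map_smul' := fun b m => (hf b m).trans (Algebra.smul_def b (f m)).symm }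
  have := congrArg (ExteriorAlgebra.lift B ⟨f', hsq⟩) (hb x)
  rw [map_smul, ExteriorAlgebra.ιMulti_apply, map_list_prod, map_zero, Algebra.smul_def,
    List.map_ofFn] at this
  have h : (⇑(ExteriorAlgebra.lift B ⟨f', hsq⟩) ∘ fun i => ExteriorAlgebra.ι B (x i)) =
      fun i => f (x i) := by
    funext i
    exact ExteriorAlgebra.lift_ι_apply B f' hsq (x i)
  rw [h] at this
  exact this

lemma wedgeAnn_zero [Nontrivial B] : wedgeAnn B M 0 = ⊥ := by
  rw [eq_bot_iff]
  intro b hb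
  have h := hb (fun i => i.elim0)
  rw [ExteriorAlgebra.ιMulti_apply, List.ofFn_zero, List.prod_nil, Algebra.smul_def, mul_one] at h
  exact (ExteriorAlgebra.algebraMap_eq_zero_iff M b).1 h

/-- If `y` generates `M` up to multiplication by `b`, then products of `j` elements of `M` are
multiples of wedges of the `y`s, up to multiplication by `b ^ j`. -/
lemma pow_mem_wedgeAnn {r j : ℕ} {b a : B} {y : Fin r → M}
    (hy : ∀ m : M, b • m ∈ Submodule.span B (Set.range y))
    (ha : ∀ s : Fin j → Fin r, a • ExteriorAlgebra.ιMulti B j (y ∘ s) = 0) :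
    a * b ^ j ∈ wedgeAnn B M j := by
  intro x
  have h : ∀ i, ∃ c : Fin r → B, ∑ l, c l • y l = b • x i := fun i =>
    (Submodule.mem_span_range_iff_exists_fun B).1 (hy (x i))
  choose c hc using h
  have h1 : b ^ j • ExteriorAlgebra.ιMulti B j x =
      ExteriorAlgebra.ιMulti B j (fun i => b • x i) := by
    rw [AlternatingMap.map_smul_univ]; simp
  rw [mul_smul, h1]
  simp_rw [← hc]
  rw [← AlternatingMap.coe_multilinearMap, MultilinearMap.map_sum, Finset.smul_sum]
  refine Finset.sum_eq_zero fun s _ => ?_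
  rw [MultilinearMap.map_smul_univ, smul_comm]
  have := ha s
  rw [AlternatingMap.coe_multilinearMap]
  exact (congrArg _ this).trans (smul_zero _)

lemma exists_wedgeAnn_eq_top [Module.Finite B M] : ∃ j, wedgeAnn B M j = ⊤ := by
  obtain ⟨n, y, hy⟩ := Module.Finite.exists_fin (R := B) (M := M)
  refine ⟨n + 1, (Ideal.eq_top_iff_one _).2 ?_⟩
  have := pow_mem_wedgeAnn (b := (1 : B)) (a := 1) (y := y) (j := n + 1) (by simp [hy]) (by
    intro s
    obtain ⟨i, j, hij, h⟩ := Fintype.exists_ne_map_eq_of_card_lt s (by simp)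
    rw [one_smul]
    exact AlternatingMap.map_eq_zero_of_eq _ _ (by simp [h]) hij)
  simpa using this

/-- If the `(r + 1)`-st exterior power vanishes, all fibres of `M` at maximal ideals have
dimension at most `r`, because `r + 1` independent vectors have a nonzero wedge. -/
lemma finrank_quotient_le [Module.Finite B M] {r : ℕ} (hr : wedgeAnn B M (r + 1) = ⊤)
    (m : Ideal B) [m.IsMaximal] :
    letI := Ideal.Quotient.field m
    Module.finrank (B ⧸ m) (M ⧸ m • (⊤ : Submodule B M)) ≤ r := by
  let _ := Ideal.Quotient.field m
  set E := M ⧸ m • (⊤ : Submodule B M)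
  by_contra! hlt
  have h0 : ∀ y : Fin (r + 1) → E, ExteriorAlgebra.ιMulti (B ⧸ m) (r + 1) y = 0 := by
    intro y
    choose x hx using fun i => Submodule.Quotient.mk_surjective _ (y i)
    have := mul_prod_eq_zero_of_mem_wedgeAnn (b := 1) (hr ▸ Submodule.mem_top)
      (T := ExteriorAlgebra (B ⧸ m) E)
      ((algebraMap (B ⧸ m) _).comp (Ideal.Quotient.mk m)) (fun b t => Algebra.commutes _ _)
      ((ExteriorAlgebra.ι (B ⧸ m)).toAddMonoidHom.comp
        (Submodule.mkQ (m • (⊤ : Submodule B M))).toAddMonoidHom) ?_ ?_ x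
    · rw [map_one, one_mul] at this
      rw [ExteriorAlgebra.ιMulti_apply, ← this]
      simp [hx]
    · intro b z
      change ExteriorAlgebra.ι (B ⧸ m) (Submodule.Quotient.mk (b • z)) = _
      rw [show (Submodule.Quotient.mk (b • z) : E) =
        (Ideal.Quotient.mk m b) • (Submodule.Quotient.mk z : E) from rfl, map_smul,
        Algebra.smul_def]
      rfl
    · intro z
      exact ExteriorAlgebra.ι_sq_zero _
  obtain ⟨v, hv⟩ := exists_linearIndependent_of_le_finrank (R := B ⧸ m) (M := E) hlt
  have h1 := exteriorPower.ιMulti_family_linearIndependent_field (n := r + 1) hv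
  have h2 := h1.ne_zero ⟨Finset.univ, by simp [Set.powersetCard.mem_iff]⟩
  apply h2
  apply Subtype.ext
  exact h0 _

/-- A finite module whose `r`-th exterior power is faithful and whose `(r + 1)`-st exterior
power vanishes is locally free of rank `r`, hence flat. -/
theorem flat_of_wedgeAnn [Module.Finite B M] {r : ℕ} (h0 : wedgeAnn B M r = ⊥)
    (h1 : wedgeAnn B M (r + 1) = ⊤) : Module.Flat B M := by
  refine Module.flat_of_localized_maximal _ fun m hm => ?_
  let _ := Ideal.Quotient.field m
  set E := M ⧸ m • (⊤ : Submodule B M)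
  have hle := finrank_quotient_le h1 m
  -- `r` elements of `M` whose classes span the fibre of `M` at `m`
  obtain ⟨x, hx⟩ : ∃ x : Fin r → M, Submodule.span B (Set.range x) ⊔ m • ⊤ = ⊤ := by
    let e := Module.finBasis (B ⧸ m) E
    choose z hz using fun i => Submodule.Quotient.mk_surjective _ (e i)
    refine ⟨fun i => if h : i.1 < Module.finrank (B ⧸ m) E then z ⟨i, h⟩ else 0, ?_⟩
    rw [eq_top_iff]
    intro y _
    obtain ⟨c, hc⟩ : ∃ c : Fin (Module.finrank (B ⧸ m) E) → B,
        (Submodule.Quotient.mk y : E) = Submodule.Quotient.mk (∑ i, c i • z i) := by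
      choose c hc using fun i => Ideal.Quotient.mk_surjective (e.repr (Submodule.Quotient.mk y) i)
      refine ⟨c, ?_⟩
      conv_lhs => rw [← e.sum_repr (Submodule.Quotient.mk y)]
      rw [← Submodule.mkQ_apply (m • ⊤) (∑ i, c i • z i), map_sum]
      refine Finset.sum_congr rfl fun i _ => ?_
      rw [← hc, ← hz]
      rfl
    have h2 := (Submodule.Quotient.eq _).1 hc
    rw [← sub_add_cancel y (∑ i, c i • z i)]
    refine Submodule.add_mem _ (Submodule.mem_sup_right h2) (Submodule.mem_sup_left ?_)
    refine Submodule.sum_mem _ fun i _ => Submodule.smul_mem _ _ (Submodule.subset_span ?_)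
    exact ⟨⟨i, i.2.trans_le hle⟩, by simp⟩
  -- Nakayama's lemma: some `b` outside `m` multiplies `M` into the span of these elements
  obtain ⟨b, hb1, hb⟩ := Submodule.exists_sub_one_mem_and_smul_le_of_fg_of_le_sup
    (I := m) (N := Submodule.span B (Set.range x)) (N' := ⊤) (P := ⊤) Module.Finite.fg_top le_top
    (by rw [hx])
  have hbm : b ∉ m := fun h => hm.ne_top ((Ideal.eq_top_iff_one m).2 (by
    simpa using m.sub_mem h hb1))
  have hbx : ∀ y : M, b • y ∈ Submodule.span B (Set.range x) := fun y =>
    hb (Submodule.smul_mem_pointwise_smul _ _ _ Submodule.mem_top)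
  -- relations among the `x l` are killed by `b ^ r`: wedging a relation with the other `x l`
  -- shows that its coefficients annihilate the top exterior power of the span
  have hrel : ∀ c : Fin r → B, ∑ l, c l • x l = 0 → ∀ i, b ^ r * c i = 0 := by
    intro c hc i
    have : c i * b ^ r ∈ wedgeAnn B M r := by
      refine pow_mem_wedgeAnn hbx fun s => ?_
      by_cases hs : Function.Injective s
      · obtain ⟨i', rfl⟩ := (Finite.injective_iff_surjective.1 hs) i
        have h3 := (ExteriorAlgebra.ιMulti B r).map_update_sum Finset.univ i'
          (fun l => c l • x l) (x ∘ s)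
        rw [hc, AlternatingMap.map_update_zero, Finset.sum_eq_single (s i')] at h3
        · rw [AlternatingMap.map_update_smul] at h3
          rw [h3]
          congr 2
          simp
        · intro l _ hl
          obtain ⟨l', rfl⟩ := (Finite.injective_iff_surjective.1 hs) l
          have hne : l' ≠ i' := fun h => hl (by rw [h])
          rw [AlternatingMap.map_update_smul]
          refine (congrArg _ (AlternatingMap.map_eq_zero_of_eq _ _ ?_ hne)).trans (smul_zero _)
          simp [hne]
        · simp
      · obtain ⟨i', j', hij, hne⟩ := Function.not_injective_iff.1 hs
        rw [AlternatingMap.map_eq_zero_of_eq _ _ (by simp [hij]) hne, smul_zero]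
    rw [h0, Ideal.mem_bot] at this
    rw [mul_comm, this]
  -- after localization at `m`, where `b` is invertible, the `x l` form a basis
  let g : (Fin r → B) →ₗ[B] M := Fintype.linearCombination B x
  let g' := IsLocalizedModule.mapExtendScalars m.primeCompl
    (LocalizedModule.mkLinearMap m.primeCompl (Fin r → B))
    (LocalizedModule.mkLinearMap m.primeCompl M) (Localization m.primeCompl) g
  have hg' : ∀ v s, g' (LocalizedModule.mk v s) = LocalizedModule.mk (g v) s := by
    intro v s
    have := IsLocalizedModule.map_mk' m.primeCompl
      (LocalizedModule.mkLinearMap m.primeCompl (Fin r → B))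
      (LocalizedModule.mkLinearMap m.primeCompl M) g v s
    rwa [← IsLocalizedModule.mk_eq_mk', ← IsLocalizedModule.mk_eq_mk'] at this
  have hbij : Function.Bijective g' := by
    constructor
    · rw [injective_iff_map_eq_zero]
      intro v hv
      induction v using LocalizedModule.induction_on with
      | _ v s =>
      rw [hg', ← LocalizedModule.zero_mk 1, LocalizedModule.mk_eq] at hv
      obtain ⟨t, ht⟩ := hv
      rw [← LocalizedModule.zero_mk 1, LocalizedModule.mk_eq]
      refine ⟨⟨b ^ r, fun h => hbm (hm.isPrime.mem_of_pow_mem _ h)⟩ * t, ?_⟩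
      simp only [one_smul, smul_zero] at ht ⊢
      have ht' : ∑ l, ((t : B) * v l) • x l = 0 := by
        have h5 : (t : B) • ∑ l, v l • x l = 0 := ht
        simpa [Finset.smul_sum, mul_smul] using h5
      funext i
      have := hrel _ ht' i
      change (b ^ r * (t : B)) • v i = 0
      rw [smul_eq_mul, mul_assoc, this]
    · intro y
      induction y using LocalizedModule.induction_on with
      | _ y s =>
      obtain ⟨c, hc⟩ := (Submodule.mem_span_range_iff_exists_fun B).1 (hbx y)
      refine ⟨LocalizedModule.mk c (⟨b, hbm⟩ * s), ?_⟩
      rw [hg', LocalizedModule.mk_eq]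
      refine ⟨1, ?_⟩
      have : g c = b • y := hc
      rw [this, one_smul, one_smul, mul_comm, mul_smul]
      rfl
  have : Module.Flat (Localization m.primeCompl) (LocalizedModule m.primeCompl M) :=
    Module.Flat.of_linearEquiv (LinearEquiv.ofBijective g' hbij).symm
  exact Module.Flat.trans B (Localization m.primeCompl) _

end Wedge

end AffineGroup

/-! ### Purity of a Hopf algebra over its Hopf subalgebras -/

namespace AffineGroup

section Purity

variable {k A : Type u} [Field k] [CommRing A] [HopfAlgebra k A] {B : Subalgebra k A}

lemma map_val_injective (B : Subalgebra k A) :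
    Function.Injective (Algebra.TensorProduct.map B.val B.val) :=
  TensorProduct.map_injective_of_flat_flat B.val.toLinearMap B.val.toLinearMap
    Subtype.val_injective Subtype.val_injective

/-- The comultiplication of a Hopf subalgebra. -/
noncomputable def IsHopfSubalgebra.comulHom (hB : IsHopfSubalgebra B) : B →ₐ[k] B ⊗[k] B :=
  (AlgEquiv.ofInjective _ (map_val_injective B)).symm.toAlgHom.comp
    (((comulAlgHom k A).comp B.val).codRestrict _ fun b => hB.comul_mem b b.2)

lemma IsHopfSubalgebra.map_comulHom (hB : IsHopfSubalgebra B) (b : B) :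
    Algebra.TensorProduct.map B.val B.val (hB.comulHom b) = comul (R := k) (b : A) := by
  have := congrArg Subtype.val ((AlgEquiv.ofInjective _ (map_val_injective B)).apply_symm_apply
    ((((comulAlgHom k A).comp B.val).codRestrict _ fun b => hB.comul_mem b b.2) b))
  exact this

section Coaction

variable {M : Type u} [AddCommGroup M] [Module B M] [Module k M] [IsScalarTower k B M]

/-- A `k`-linear map `ρ : M → M ⊗ A` on a `B`-module that is semilinear over the comultiplication
`B → B ⊗ A`, and whose image generates `M ⊗ A` over `A`. Every coaction compatible with the
`B`-module structure has these properties. -/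
structure IsCoaction (hB : IsHopfSubalgebra B) (ρ : M →ₗ[k] M ⊗[k] A) : Prop where
  smul : ∀ (b : B) (m : M) (n : ℕ) (x y : Fin n → B), hB.comulHom b = ∑ i, x i ⊗ₜ y i →
    ρ (b • m) = ∑ i, TensorProduct.map (Algebra.lsmul k k M (x i)) (LinearMap.mulLeft k (y i : A))
      (ρ m)
  span : ∀ m : M, ∃ (n : ℕ) (y : Fin n → M) (a : Fin n → A),
    m ⊗ₜ[k] (1 : A) = ∑ i, (LinearMap.mulLeft k (a i)).lTensor M (ρ (y i))

variable {hB : IsHopfSubalgebra B} {ρ : M →ₗ[k] M ⊗[k] A}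

/-- The coefficients of `Δ b` kill all products `f v₁ ⋯ f vⱼ` whenever `b` annihilates the `j`-th
exterior power. -/
lemma IsCoaction.mul_prod_eq_zero (hρ : IsCoaction hB ρ) {j : ℕ} {b : B}
    (hb : b ∈ wedgeAnn B M j) {n : ℕ} {x y : Fin n → B}
    (hy : LinearIndependent k fun i => (y i : A)) (hxy : hB.comulHom b = ∑ i, x i ⊗ₜ y i)
    {Λ : Type u} [Ring Λ] [Algebra k Λ] [Algebra B Λ] [IsScalarTower k B Λ] (κ : M →ₗ[B] Λ)
    (hκ : ∀ m, κ m * κ m = 0) (v : Fin j → M) (i : Fin n) :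
    algebraMap B Λ (x i) * (List.ofFn fun i => κ (v i)).prod = 0 := by
  -- `B` acts on `Λ ⊗ A` through the comultiplication `c`, and `f` is linear for this action
  let ι' : M →ₗ[k] Λ := κ.restrictScalars k
  let c : B →ₐ[k] Λ ⊗[k] A :=
    (Algebra.TensorProduct.map (IsScalarTower.toAlgHom k B Λ) B.val).comp hB.comulHom
  let f : M →ₗ[k] Λ ⊗[k] A := ι'.rTensor A ∘ₗ ρ
  have hc : ∀ b t, c b * t = t * c b := by
    intro b t
    change Algebra.TensorProduct.map (IsScalarTower.toAlgHom k B Λ) B.val (hB.comulHom b) * t =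
      t * Algebra.TensorProduct.map (IsScalarTower.toAlgHom k B Λ) B.val (hB.comulHom b)
    generalize hB.comulHom b = z
    induction z with
    | zero => simp
    | add z w hz hw => simp only [map_add, add_mul, mul_add, hz, hw]
    | tmul z w =>
      induction t with
      | zero => simp
      | add t s ht hs => simp only [add_mul, mul_add, ht, hs]
      | tmul t s =>
        simp only [Algebra.TensorProduct.map_tmul, Algebra.TensorProduct.tmul_mul_tmul]
        rw [mul_comm s]
        congr 1
        exact Algebra.commutes _ _
  have hf : ∀ b m, f (b • m) = c b * f m := by
    intro b m
    obtain ⟨n, x, y, -, hz⟩ := exists_sum_tmul_linearIndependent (hB.comulHom b)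
    have h1 : c b = Algebra.TensorProduct.map (IsScalarTower.toAlgHom k B Λ) B.val
      (hB.comulHom b) := rfl
    change ι'.rTensor A (ρ (b • m)) = c b * ι'.rTensor A (ρ m)
    rw [hρ.smul b m n x y hz, h1, hz]
    simp only [map_sum, Finset.sum_mul]
    refine Finset.sum_congr rfl fun i _ => ?_
    generalize ρ m = w
    induction w with
    | zero => simp
    | add t s ht hs => simp only [map_add, mul_add, ht, hs]
    | tmul t s =>
      simp only [TensorProduct.map_tmul, LinearMap.rTensor_tmul, Algebra.TensorProduct.map_tmul,
        Algebra.TensorProduct.tmul_mul_tmul]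
      congr 1
      change κ (x i • t) = algebraMap B Λ (x i) * κ t
      rw [map_smul, Algebra.smul_def]
  have hpolar : ∀ z w : M ⊗[k] A, ι'.rTensor A z * ι'.rTensor A w +
      ι'.rTensor A w * ι'.rTensor A z = 0 := by
    intro z w
    induction z with
    | zero => simp
    | add z z' hz hz' =>
      rw [map_add, add_mul, mul_add, add_add_add_comm, hz, hz', add_zero]
    | tmul z z' =>
      induction w with
      | zero => simp
      | add w w' hw hw' =>
        rw [map_add, add_mul, mul_add, add_add_add_comm, hw, hw', add_zero]
      | tmul w w' =>
        simp only [LinearMap.rTensor_tmul, Algebra.TensorProduct.tmul_mul_tmul]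
        rw [mul_comm w' z', ← add_tmul]
        have : ι' z * ι' w + ι' w * ι' z = 0 := by
          have h := hκ (z + w)
          rw [map_add, add_mul, mul_add, mul_add, hκ, hκ, zero_add, add_zero] at h
          exact h
        rw [this, zero_tmul]
  have hsq' : ∀ z : M ⊗[k] A, ι'.rTensor A z * ι'.rTensor A z = 0 := by
    intro z
    induction z with
    | zero => simp
    | add z w hz hw =>
      rw [map_add, add_mul, mul_add, mul_add, hz, hw, zero_add, add_zero, hpolar]
    | tmul z w =>
      simp only [LinearMap.rTensor_tmul, Algebra.TensorProduct.tmul_mul_tmul]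
      have : ι' z * ι' z = 0 := hκ z
      rw [this, zero_tmul]
  have hkey := mul_prod_eq_zero_of_mem_wedgeAnn hb c.toRingHom hc f.toAddMonoidHom hf
    (fun m => hsq' _)
  -- replace the elements `f m` by the elements `m ⊗ 1`, one factor at a time
  have hexp : ∀ (j : ℕ) (w : Λ ⊗[k] A),
      (∀ v : Fin j → M, w * (List.ofFn fun i => f (v i)).prod = 0) →
      ∀ v : Fin j → M, w * (List.ofFn fun i => ι' (v i) ⊗ₜ[k] (1 : A)).prod = 0 := by
    intro j
    induction j with
    | zero => intro w h v; simpa using h v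
    | succ j ih =>
      intro w h v
      obtain ⟨n, y, a, hya⟩ := hρ.span (v 0)
      have h1 : ι' (v 0) ⊗ₜ[k] (1 : A) = ∑ i, ((1 : Λ) ⊗ₜ[k] a i) * f (y i) := by
        have := congrArg (ι'.rTensor A) hya
        rw [LinearMap.rTensor_tmul, map_sum] at this
        rw [this]
        refine Finset.sum_congr rfl fun i _ => ?_
        change _ = _ * ι'.rTensor A (ρ (y i))
        generalize ρ (y i) = w
        induction w with
        | zero => simp
        | add t s ht hs => simp only [map_add, mul_add, ht, hs]
        | tmul t s => simp
      have hcomm : ∀ (a : A) (t : Λ ⊗[k] A), t * ((1 : Λ) ⊗ₜ[k] a) = ((1 : Λ) ⊗ₜ[k] a) * t := by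
        intro a t
        induction t with
        | zero => simp
        | add t s ht hs => simp only [mul_add, add_mul, ht, hs]
        | tmul t s => simp [mul_comm]
      rw [List.ofFn_succ, List.prod_cons, ← mul_assoc, h1, Finset.mul_sum, Finset.sum_mul]
      refine Finset.sum_eq_zero fun i _ => ?_
      rw [← mul_assoc, hcomm, mul_assoc, mul_assoc, ← mul_assoc w,
        ih (w * f (y i)) (fun v' => ?_) (fun i => v i.succ), mul_zero]
      have := h (Fin.cons (y i) v')
      rw [List.ofFn_succ, List.prod_cons] at this
      simpa [mul_assoc] using this
  have h2 := hexp j (c b) hkey v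
  have h3 : ∀ (j : ℕ) (v : Fin j → M), (List.ofFn fun i => ι' (v i) ⊗ₜ[k] (1 : A)).prod =
      ((List.ofFn fun i => ι' (v i)).prod) ⊗ₜ[k] (1 : A) := by
    intro j
    induction j with
    | zero => intro v; simp [Algebra.TensorProduct.one_def]
    | succ j ih => intro v; simp [List.ofFn_succ, ih]
  have h4 : c b = ∑ i, algebraMap B Λ (x i) ⊗ₜ[k] (y i : A) := by
    change Algebra.TensorProduct.map (IsScalarTower.toAlgHom k B Λ) B.val (hB.comulHom b) = _
    rw [hxy, map_sum]
    rfl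
  rw [h3, h4, Finset.sum_mul] at h2
  simp only [Algebra.TensorProduct.tmul_mul_tmul, mul_one] at h2
  exact eq_zero_of_sum_tmul_right hy h2 i

/-- The coefficients of `Δ b` annihilate an exterior power whenever `b` does: `M ⊗ A` is, as a
module over `B ⊗ A`, isomorphic to its pullback along an automorphism of `B ⊗ A` that sends
`b ⊗ 1` to `Δ b`. -/
lemma IsCoaction.mem_wedgeAnn (hρ : IsCoaction hB ρ) {j : ℕ} {b : B} (hb : b ∈ wedgeAnn B M j)
    {n : ℕ} {x y : Fin n → B} (hy : LinearIndependent k fun i => (y i : A))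
    (hxy : hB.comulHom b = ∑ i, x i ⊗ₜ y i) (i : Fin n) : x i ∈ wedgeAnn B M j := by
  intro v
  rw [ExteriorAlgebra.ιMulti_apply, Algebra.smul_def]
  exact hρ.mul_prod_eq_zero hb hy hxy (ExteriorAlgebra.ι B) ExteriorAlgebra.ι_sq_zero v i

/-- An affine group acts transitively on itself: an ideal invariant under translation is `0`
or everything. -/
lemma IsCoaction.wedgeAnn_eq_bot_or_top (hρ : IsCoaction hB ρ) (j : ℕ) :
    wedgeAnn B M j = ⊥ ∨ wedgeAnn B M j = ⊤ := by
  have key : ∀ b ∈ wedgeAnn B M j, ∃ (n : ℕ) (x y : Fin n → B), (∀ i, x i ∈ wedgeAnn B M j) ∧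
      comul (R := k) (b : A) = ∑ i, (x i : A) ⊗ₜ[k] (y i : A) := by
    intro b hb
    obtain ⟨n, x, y, hy, hz⟩ := exists_sum_tmul_linearIndependent (hB.comulHom b)
    refine ⟨n, x, y, hρ.mem_wedgeAnn hb (hy.map' B.val.toLinearMap
      (LinearMap.ker_eq_bot.2 Subtype.val_injective)) hz, ?_⟩
    rw [← hB.map_comulHom, hz, map_sum]
    rfl
  by_cases h : ∀ b ∈ wedgeAnn B M j, counit (R := k) (b : A) = 0
  · left
    rw [eq_bot_iff]
    intro b hb
    obtain ⟨n, x, y, hx, hxy⟩ := key b hb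
    have := sum_counit_smul_of_comul_eq hxy
    simp only [h _ (hx _), zero_smul, Finset.sum_const_zero] at this
    exact Subtype.ext this.symm
  · right
    push Not at h
    obtain ⟨b, hb, hb0⟩ := h
    obtain ⟨n, x, y, hx, hxy⟩ := key b hb
    have h1 := sum_mul_antipode_of_comul_eq hxy
    have h2 : algebraMap k B (counit (b : A)) ∈ wedgeAnn B M j := by
      have : algebraMap k B (counit (b : A)) =
          ∑ i, x i * ⟨antipode k (y i : A), hB.antipode_mem _ (y i).2⟩ := by
        apply Subtype.ext
        rw [AddSubmonoidClass.coe_finsetSum]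
        exact h1.symm
      rw [this]
      exact Ideal.sum_mem _ fun i _ => Ideal.mul_mem_right _ _ (hx i)
    exact Ideal.eq_top_of_isUnit_mem _ h2 ((isUnit_iff_ne_zero.2 hb0).map (algebraMap k B))

/-- Every exterior power of `M` is faithful or zero, so `M` is locally free of constant rank. -/
theorem IsCoaction.flat (hρ : IsCoaction hB ρ) [Module.Finite B M] : Module.Flat B M := by
  classical
  have : Nontrivial A := Bialgebra.nontrivial (R := k)
  have hex := exists_wedgeAnn_eq_top (B := B) (M := M)
  obtain ⟨r, hr⟩ : ∃ r, Nat.find hex = r + 1 := by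
    refine Nat.exists_eq_succ_of_ne_zero fun h0 => ?_
    -- the zeroth exterior power `B` is faithful
    have := Nat.find_spec hex
    rw [h0, wedgeAnn_zero] at this
    exact bot_ne_top this
  refine flat_of_wedgeAnn (r := r) ?_ ?_
  · exact (hρ.wedgeAnn_eq_bot_or_top r).resolve_right
      (Nat.find_min hex (by omega))
  · rw [← hr]; exact Nat.find_spec hex

end Coaction

/-- The `B`-submodule of `A` given by the subalgebra `B`. -/
abbrev subalgebraSubmodule (B : Subalgebra k A) : Submodule B A :=
  LinearMap.range (Algebra.linearMap B A)

lemma mem_subalgebraSubmodule {a : A} : a ∈ subalgebraSubmodule B ↔ a ∈ B := by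
  constructor
  · rintro ⟨b, rfl⟩; exact b.2
  · intro h; exact ⟨⟨a, h⟩, rfl⟩

lemma comul_smul_eq (hB : IsHopfSubalgebra B) {b : B} {n : ℕ} {x y : Fin n → B}
    (hxy : hB.comulHom b = ∑ i, x i ⊗ₜ y i) (a : A) :
    comul (R := k) (b • a) = ∑ i, TensorProduct.map (Algebra.lsmul k k A (x i))
      (LinearMap.mulLeft k (y i : A)) (comul a) := by
  have h1 : comul (R := k) (b • a) = comul (b : A) * comul a := Bialgebra.comul_mul (b : A) a
  rw [h1, ← hB.map_comulHom, hxy, map_sum, Finset.sum_mul]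
  refine Finset.sum_congr rfl fun i _ => ?_
  generalize (comul a : A ⊗[k] A) = w
  induction w with
  | zero => simp
  | add t s ht hs => simp only [map_add, mul_add, ht, hs]
  | tmul t s => simp [Algebra.TensorProduct.map_tmul, Subalgebra.smul_def]

/-- The module generated by a subcomodule over a Hopf subalgebra is a subcomodule. -/
lemma IsSubcomodule.span (hB : IsHopfSubalgebra B) {V : Submodule k A} (hV : IsSubcomodule V) :
    IsSubcomodule ((Submodule.span B (V : Set A)).restrictScalars k) := by
  intro a ha
  change a ∈ Submodule.span B (V : Set A) at ha
  induction ha using Submodule.span_induction with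
  | mem v hv =>
    rw [mem_range_rTensor_iff]
    intro φ
    exact Submodule.subset_span ((mem_range_rTensor_iff _ _).1 (hV v hv) φ)
  | zero => rw [map_zero]; exact Submodule.zero_mem _
  | add v w _ _ hv hw => rw [map_add]; exact Submodule.add_mem _ hv hw
  | smul b v _ hv =>
    obtain ⟨n, x, y, -, hz⟩ := exists_sum_tmul_linearIndependent (hB.comulHom b)
    rw [mem_range_rTensor_iff] at hv ⊢
    intro φ
    rw [comul_smul_eq hB hz, map_sum]
    refine Submodule.sum_mem _ fun i _ => ?_
    rw [slice_map]
    exact Submodule.smul_mem (Submodule.span B (V : Set A)) (x i) (hv _)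

/-- A finitely generated submodule `U ⊆ A` over a Hopf subalgebra that is also a subcomodule has
flat image under every `B`-linear map `π : A → X` through which the comultiplication
`A → A ⊗ A → X ⊗ A` factors. -/
lemma flat_of_isSubcomodule (hB : IsHopfSubalgebra B) {X M : Type u} [AddCommGroup X] [Module B X]
    [Module k X] [IsScalarTower k B X] [AddCommGroup M] [Module B M] [Module k M]
    [IsScalarTower k B M] {U : Submodule B A} (hUfg : U.FG)
    (hUc : IsSubcomodule (U.restrictScalars k)) (π : A →ₗ[B] X) (j : M →ₗ[B] X)
    (hj : Function.Injective j) (hjU : LinearMap.range j = U.map π) (ρX : X →ₗ[k] X ⊗[k] A)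
    (hρX : ∀ a, ρX (π a) = (π.restrictScalars k).rTensor A (comul a)) : Module.Flat B M := by
  have hjA : Function.Injective ((j.restrictScalars k).rTensor A) :=
    Module.Flat.rTensor_preserves_injective_linearMap _ hj
  have hMU : ∀ m, ∃ a ∈ U, π a = j m := fun m => by
    have : j m ∈ U.map π := hjU ▸ LinearMap.mem_range_self j m
    exact this
  have hlift : ∀ a : U, ∃ m, j m = π a := fun a => by
    have : π a ∈ LinearMap.range j := hjU ▸ Submodule.mem_map_of_mem a.2
    exact this
  choose s hs using hlift
  have hUM : ∀ a ∈ U, ∃ (n : ℕ) (x : Fin n → U) (y : Fin n → A),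
      comul a = ∑ i, (x i : A) ⊗ₜ[k] y i := by
    intro a ha
    obtain ⟨w, hw⟩ := hUc a ha
    obtain ⟨n, x, y, -, rfl⟩ := exists_sum_tmul_linearIndependent w
    exact ⟨n, x, y, by rw [← hw, map_sum]; rfl⟩
  have hrange : ∀ m : M, ρX (j m) ∈ LinearMap.range ((j.restrictScalars k).rTensor A) := by
    intro m
    obtain ⟨a, ha, ham⟩ := hMU m
    obtain ⟨n, x, y, h⟩ := hUM a ha
    refine ⟨∑ i, s (x i) ⊗ₜ[k] y i, ?_⟩
    rw [← ham, hρX, h, map_sum, map_sum]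
    refine Finset.sum_congr rfl fun i _ => ?_
    rw [LinearMap.rTensor_tmul, LinearMap.rTensor_tmul, LinearMap.restrictScalars_apply,
      LinearMap.restrictScalars_apply, hs]
  let ρ : M →ₗ[k] M ⊗[k] A := (LinearEquiv.ofInjective _ hjA).symm.toLinearMap ∘ₗ
    (ρX ∘ₗ j.restrictScalars k).codRestrict _ hrange
  have hρ : ∀ m, (j.restrictScalars k).rTensor A (ρ m) = ρX (j m) := by
    intro m
    exact congrArg Subtype.val ((LinearEquiv.ofInjective _ hjA).apply_symm_apply
      ((ρX ∘ₗ j.restrictScalars k).codRestrict _ hrange m))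
  clear_value ρ
  -- both `j` and `π` are compatible with the action of `B ⊗ A`
  have hact : ∀ {Y : Type u} [AddCommGroup Y] [Module B Y] [Module k Y] [IsScalarTower k B Y]
      (f : Y →ₗ[B] X) (x : B) (y : A) (w : Y ⊗[k] A),
      (f.restrictScalars k).rTensor A (TensorProduct.map (Algebra.lsmul k k Y x)
        (LinearMap.mulLeft k y) w) =
      TensorProduct.map (Algebra.lsmul k k X x) (LinearMap.mulLeft k y)
        ((f.restrictScalars k).rTensor A w) := by
    intro Y _ _ _ _ f x y w
    induction w with
    | zero => simp
    | add t s ht hs => simp only [map_add, ht, hs]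
    | tmul t s => simp
  have hactl : ∀ {Y : Type u} [AddCommGroup Y] [Module B Y] [Module k Y] [IsScalarTower k B Y]
      (f : Y →ₗ[B] X) (y : A) (w : Y ⊗[k] A),
      (f.restrictScalars k).rTensor A ((LinearMap.mulLeft k y).lTensor Y w) =
        (LinearMap.mulLeft k y).lTensor X ((f.restrictScalars k).rTensor A w) := by
    intro Y _ _ _ _ f y w
    induction w with
    | zero => simp
    | add t s ht hs => simp only [map_add, ht, hs]
    | tmul t s => simp
  have hco : IsCoaction hB ρ := by
    constructor
    · intro b m n x y hxy
      obtain ⟨a, ha, ham⟩ := hMU m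
      apply hjA
      rw [hρ, map_smul, ← ham, ← map_smul, hρX, comul_smul_eq hB hxy, map_sum, map_sum]
      refine Finset.sum_congr rfl fun i _ => ?_
      rw [hact, hact, hρ, ← ham, hρX]
    · intro m
      obtain ⟨a, ha, ham⟩ := hMU m
      obtain ⟨n, x, y, h⟩ := hUM a ha
      refine ⟨n, fun i => s (x i), fun i => antipode k (y i), ?_⟩
      apply hjA
      rw [map_sum]
      simp only [hactl, hρ, hs, hρX]
      simp only [← hactl]
      rw [← map_sum]
      have h4 : ∑ i, (LinearMap.mulLeft k (antipode k (y i))).lTensor A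
          (comul (R := k) (x i : A)) = a ⊗ₜ[k] (1 : A) := by
        have h5 : (Pt.inl k A A * Pt.inr k A A * (Pt.inr k A A)⁻¹) a = Pt.inl k A A a := by
          rw [mul_inv_cancel_right]
        rw [Pt.mul_apply_sum _ _ h] at h5
        rw [← Pt.inl_apply a, ← h5]
        refine Finset.sum_congr rfl fun i _ => ?_
        rw [Pt.inl_mul_inr, Pt.inv_apply, Pt.inr_apply]
        generalize (comul (x i : A) : A ⊗[k] A) = w
        induction w with
        | zero => simp
        | add t s ht hs => simp only [map_add, add_mul, ht, hs]
        | tmul t s => simp [mul_comm]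
      rw [h4, LinearMap.rTensor_tmul, LinearMap.rTensor_tmul, LinearMap.restrictScalars_apply,
        LinearMap.restrictScalars_apply, ham]
  have : Module.Finite B M := by
    have h1 : Module.Finite B (LinearMap.range j) :=
      Module.Finite.iff_fg.2 (hjU ▸ hUfg.map π)
    exact Module.Finite.equiv (LinearEquiv.ofInjective j hj).symm
  exact hco.flat

/-- The image in `A / B` of the `B`-module generated by a finite-dimensional subcomodule is
flat. -/
lemma flat_map_mkQ (hB : IsHopfSubalgebra B) {V : Submodule k A} [FiniteDimensional k V]
    (hV : IsSubcomodule V) :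
    Module.Flat B ((Submodule.span B (V : Set A)).map (subalgebraSubmodule B).mkQ) := by
  have hfg : (Submodule.span B (V : Set A)).FG := by
    obtain ⟨s, hs⟩ := (Submodule.fg_iff_finiteDimensional V).2 inferInstance
    refine ⟨s, ?_⟩
    rw [← hs, Submodule.span_span_of_tower]
  let ρX : A ⧸ subalgebraSubmodule B →ₗ[k] (A ⧸ subalgebraSubmodule B) ⊗[k] A :=
    (Submodule.liftQ ((subalgebraSubmodule B).restrictScalars k)
      (((subalgebraSubmodule B).mkQ.restrictScalars k).rTensor A ∘ₗ comul) (by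
      rintro a ⟨b, rfl⟩
      obtain ⟨n, x, y, -, h⟩ := hB.exists_comul_eq b.2
      change ((subalgebraSubmodule B).mkQ.restrictScalars k).rTensor A (comul (b : A)) = 0
      rw [h, map_sum]
      refine Finset.sum_eq_zero fun i _ => ?_
      have : (subalgebraSubmodule B).mkQ.restrictScalars k (x i : A) = 0 :=
        (Submodule.Quotient.mk_eq_zero _).2 ⟨x i, rfl⟩
      rw [LinearMap.rTensor_tmul, this, zero_tmul])) ∘ₗ
    (Submodule.Quotient.restrictScalarsEquiv k (subalgebraSubmodule B)).symm.toLinearMap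
  exact flat_of_isSubcomodule hB hfg (hV.span hB) (subalgebraSubmodule B).mkQ
    (Submodule.subtype _) Subtype.val_injective (Submodule.range_subtype _) ρX fun a => rfl

/-- `A / B` is the directed union of the flat modules of `flat_map_mkQ`; the equational criterion
involves only finitely many elements at a time. -/
theorem flat_quotient (hB : IsHopfSubalgebra B) : Module.Flat B (A ⧸ subalgebraSubmodule B) := by
  refine Module.Flat.of_forall_isTrivialRelation fun {l f x} hfx => ?_
  choose a ha using fun i => Submodule.mkQ_surjective _ (x i)
  obtain ⟨V, hVf, haV, hV⟩ := exists_finiteDimensional_subcomodule_of_finite (k := k) a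
  have := flat_map_mkQ hB hV
  let x' : Fin l → (Submodule.span B (V : Set A)).map (subalgebraSubmodule B).mkQ :=
    fun i => ⟨x i, a i, Submodule.subset_span (haV i), ha i⟩
  have h : ∑ i, f i • x' i = 0 := by
    apply Subtype.ext
    rw [AddSubmonoidClass.coe_finsetSum]
    exact hfx
  obtain ⟨n, c, y, h1, h2⟩ := Module.Flat.isTrivialRelation_of_sum_smul_eq_zero h
  refine ⟨n, c, fun j => y j, fun i => ?_, h2⟩
  have := congrArg Subtype.val (h1 i)
  rw [AddSubmonoidClass.coe_finsetSum] at this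
  exact this

/-- A commutative Hopf algebra over a field is pure over every Hopf subalgebra. -/
theorem eq_zero_of_tmul_one_eq_zero (hB : IsHopfSubalgebra B) {X : Type*} [AddCommGroup X]
    [Module B X] {x : X} (hx : x ⊗ₜ[B] (1 : A) = 0) : x = 0 := by
  have := flat_quotient hB
  have h1 := LinearMap.lTensor_injective_of_exact_of_flat (subalgebraSubmodule B).mkQ
    (Submodule.mkQ_surjective _) (Algebra.linearMap B A) Subtype.val_injective
    (by rw [LinearMap.exact_iff, Submodule.ker_mkQ]) X
  have h2 : x ⊗ₜ[B] (1 : B) = 0 := h1 (by simpa using hx)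
  simpa using congrArg (TensorProduct.rid B X) h2

end Purity

end AffineGroup

/-! ### Hopf ideals and their invariants -/

namespace AffineGroup

section Invariants

variable {k A : Type u} [Field k] [CommRing A] [HopfAlgebra k A]

/-- The ideal `B⁺A` generated by the augmentation ideal of a subalgebra `B`; it cuts out the
kernel of the restriction of points from `A` to `B`. -/
def augIdeal (B : Subalgebra k A) : Ideal A :=
  Ideal.span {b | b ∈ B ∧ counit (R := k) b = 0}

lemma sub_algebraMap_mem_augIdeal {B : Subalgebra k A} {b : A} (hb : b ∈ B) :
    b - algebraMap k A (counit b) ∈ augIdeal B :=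
  Ideal.subset_span ⟨B.sub_mem hb (B.algebraMap_mem _), by simp⟩

variable {R : Type u} [CommRing R] [Algebra k R]

lemma forall_augIdeal_iff {B : Subalgebra k A} {x : Pt k A R} :
    (∀ f ∈ augIdeal B, x f = 0) ↔ ∀ b ∈ B, x b = algebraMap k R (counit b) := by
  constructor
  · intro h b hb
    have := h _ (sub_algebraMap_mem_augIdeal hb)
    rw [map_sub, AlgHomClass.commutes] at this
    exact sub_eq_zero.1 this
  · intro h f hf
    have : augIdeal B ≤ RingHom.ker x.hom := by
      refine Ideal.span_le.2 fun b hb => ?_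
      change x b = 0
      rw [h b hb.1, hb.2, map_zero]
    exact this hf

/-- If two points agree on a Hopf subalgebra `B`, then `g⁻¹ h` is trivial on `B`. -/
lemma IsHopfSubalgebra.inv_mul_apply {B : Subalgebra k A} (hB : IsHopfSubalgebra B)
    {g h : Pt k A R} (hgh : ∀ b ∈ B, g b = h b) {b : A} (hb : b ∈ B) :
    (g⁻¹ * h) b = algebraMap k R (counit b) := by
  obtain ⟨n, x, y, -, hxy⟩ := hB.exists_comul_eq hb
  rw [Pt.mul_apply_sum _ _ hxy, ← AlgHomClass.commutes h, ← sum_antipode_mul_of_comul_eq hxy,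
    map_sum]
  refine Finset.sum_congr rfl fun i _ => ?_
  rw [Pt.inv_apply, hgh _ (hB.antipode_mem _ (x i).2), map_mul]

/-- A function invariant under the kernel of the quotient map defined by a Hopf subalgebra `B`
lies in `B`: by invariance `f ⊗ 1 = 1 ⊗ f` in `A ⊗[B] A`, so `f ⊗ 1` dies in `(A / B) ⊗[B] A`, and
`A` is pure over `B`. -/
theorem IsHopfSubalgebra.mem_of_invariant {B : Subalgebra k A} (hB : IsHopfSubalgebra B) {f : A}
    (hf : ∀ (R : Type u) [CommRing R] [Algebra k R] (g x : Pt k A R),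
      (∀ b ∈ B, x b = algebraMap k R (counit b)) → (g * x) f = g f) : f ∈ B := by
  -- the two points of `A ⊗[B] A` differ by a point of the kernel
  let g : Pt k A (A ⊗[B] A) := Pt.mk Algebra.TensorProduct.includeLeft
  let h : Pt k A (A ⊗[B] A) :=
    Pt.mk ((Algebra.TensorProduct.includeRight : A →ₐ[B] A ⊗[B] A).restrictScalars k)
  have hgh : ∀ b ∈ B, g b = h b := fun b hb => by
    have := Algebra.TensorProduct.tmul_one_eq_one_tmul (A := A) (B := A) (⟨b, hb⟩ : B)
    exact this
  have h1 := hf _ g (g⁻¹ * h) fun b hb => hB.inv_mul_apply hgh hb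
  rw [mul_inv_cancel_left] at h1
  have h2 : (1 : A) ⊗ₜ[B] f = f ⊗ₜ[B] (1 : A) := h1
  have h3 := congrArg ((subalgebraSubmodule B).mkQ.rTensor A) h2
  rw [LinearMap.rTensor_tmul, LinearMap.rTensor_tmul,
    show (subalgebraSubmodule B).mkQ (1 : A) = 0 from
      (Submodule.Quotient.mk_eq_zero _).2 ⟨1, rfl⟩, zero_tmul] at h3
  have h4 := eq_zero_of_tmul_one_eq_zero hB h3.symm
  exact mem_subalgebraSubmodule.1 ((Submodule.Quotient.mk_eq_zero _).1 h4)

/-- The closed subgroup defined by a Hopf ideal `I`: the points that vanish on `I`. -/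
def closedSubgroup (I : Ideal A) [I.IsHopfIdeal k] (R : Type u) [CommRing R] [Algebra k R] :
    Subgroup (Pt k A R) where
  carrier := {g | ∀ f ∈ I, g f = 0}
  one_mem' f hf := by
    rw [Pt.one_apply, Submodule.IsCoideal.counit_eq_zero (I := I.restrictScalars k) hf, map_zero]
  mul_mem' {g h} hg hh f hf := by
    have h1 := Submodule.IsCoideal.map_mkQ_comul_eq_zero (I := I.restrictScalars k) hf
    let g' : A ⧸ I.restrictScalars k →ₗ[k] R :=
      (I.restrictScalars k).liftQ g.hom.toLinearMap hg
    let h' : A ⧸ I.restrictScalars k →ₗ[k] R :=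
      (I.restrictScalars k).liftQ h.hom.toLinearMap hh
    have h2 := congrArg (LinearMap.mul' k R ∘ₗ TensorProduct.map g' h') h1
    rw [map_zero] at h2
    rw [Pt.mul_apply, ← h2]
    generalize (comul f : A ⊗[k] A) = z
    induction z with
    | zero => simp
    | add z w hz hw => simp only [map_add, hz, hw]
    | tmul z w => exact (Algebra.TensorProduct.lift_tmul ..).trans rfl
  inv_mem' {g} hg f hf := hg _ (Ideal.IsHopfIdeal.antipode_mem (R := k) hf)

lemma map_mem_closedSubgroup {I : Ideal A} [I.IsHopfIdeal k] {g : Pt k A R}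
    (hg : g ∈ closedSubgroup I R) {S : Type u} [CommRing S] [Algebra k S] (φ : R →ₐ[k] S) :
    Pt.map φ g ∈ closedSubgroup I S := fun f hf => by
  rw [Pt.map_apply, hg f hf, map_zero]

/-- The Hopf ideal `I` is normal if it defines normal subgroups of points. -/
def IsNormalIdeal (k : Type u) {A : Type u} [Field k] [CommRing A] [HopfAlgebra k A]
    (I : Ideal A) [I.IsHopfIdeal k] : Prop :=
  ∀ (R : Type u) [CommRing R] [Algebra k R], (closedSubgroup (k := k) I R).Normal

variable (k) in
/-- The subalgebra of functions invariant under right translation by the closed subgroup defined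
by `I`. -/
def invariants (I : Ideal A) [I.IsHopfIdeal k] : Subalgebra k A where
  carrier := {f | ∀ (R : Type u) [CommRing R] [Algebra k R] (g n : Pt k A R),
    n ∈ closedSubgroup I R → (g * n) f = g f}
  mul_mem' {a b} ha hb R _ _ g n hn := by rw [map_mul, map_mul, ha R g n hn, hb R g n hn]
  add_mem' {a b} ha hb R _ _ g n hn := by rw [map_add, map_add, ha R g n hn, hb R g n hn]
  algebraMap_mem' c R _ _ g n hn := by rw [AlgHomClass.commutes, AlgHomClass.commutes]

variable {I : Ideal A} [I.IsHopfIdeal k]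

/-- For a normal subgroup, invariance under right translation implies invariance under left
translation. -/
lemma IsNormalIdeal.mul_left_apply (hI : IsNormalIdeal k I) {f : A} (hf : f ∈ invariants k I)
    {g n : Pt k A R} (hn : n ∈ closedSubgroup I R) : (n * g) f = g f := by
  have := hf R g (g⁻¹ * n * g) (by simpa using (hI R).conj_mem n hn g⁻¹)
  rwa [← mul_assoc, mul_inv_cancel_left] at this

/-- `B ⊗ B` is the intersection of `B ⊗ A` and `A ⊗ B`. -/
lemma mem_range_map_of_slice {B : Subalgebra k A} {z : A ⊗[k] A}
    (h1 : ∀ φ : Module.Dual k A, slice φ z ∈ B)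
    (h2 : ∀ φ : Module.Dual k A, slice φ (TensorProduct.comm k A A z) ∈ B) :
    z ∈ (Algebra.TensorProduct.map B.val B.val).range := by
  classical
  obtain ⟨w, hw⟩ := (mem_range_rTensor_iff B.toSubmodule z).2 h1
  obtain ⟨n, a, b, hb, hab⟩ :=
    exists_sum_tmul_linearIndependent (TensorProduct.comm k _ _ w)
  have hw' : w = ∑ i, b i ⊗ₜ[k] a i := by
    have := congrArg (TensorProduct.comm k _ _).symm hab
    simpa using this
  have hz : z = ∑ i, (b i : A) ⊗ₜ[k] a i := by
    rw [← hw, hw', map_sum]; rfl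
  obtain ⟨φ, hφ⟩ := exists_dual_family (hb.map' B.toSubmodule.subtype (Submodule.ker_subtype _))
  have ha : ∀ i, a i ∈ B := by
    intro i
    have h3 := h2 (φ i)
    rw [hz, map_sum, map_sum] at h3
    have h4 : ∀ j, φ i (b j : A) = if i = j then 1 else 0 := hφ i
    simpa [h4, ite_smul] using h3
  rw [hz]
  exact Subalgebra.sum_mem _ fun i _ => tmul_mem_range_map (b i).2 (ha i)

theorem isHopfSubalgebra_invariants (hI : IsNormalIdeal k I) :
    IsHopfSubalgebra (invariants k I) where
  comul_mem f hf := by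
    refine mem_range_map_of_slice (fun φ => ?_) (fun φ => ?_)
    · intro R _ _ g n hn
      have key : ∀ g : Pt k A R,
          slice φ ((Pt.map (Algebra.TensorProduct.includeLeft : R →ₐ[k] R ⊗[k] A) g *
            Pt.inr k A R) f) =
            g (slice φ (comul f)) := by
        intro g
        rw [Pt.mul_apply]
        generalize (comul f : A ⊗[k] A) = z
        induction z with
        | zero => simp
        | add z w hz hw => simp only [map_add, hz, hw]
        | tmul z w => simp
      rw [← key, ← key, map_mul, mul_assoc]
      congr 1
      let ι : R →ₐ[k] R ⊗[k] A := Algebra.TensorProduct.includeLeft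
      -- normality moves `n` past the universal point
      have := hf _ (Pt.map ι g * Pt.inr k A R) ((Pt.inr k A R)⁻¹ * Pt.map ι n * Pt.inr k A R)
        (by simpa using (hI _).conj_mem _ (map_mem_closedSubgroup hn _) (Pt.inr k A R)⁻¹)
      rw [← this]
      congr 1
      simp only [mul_assoc, mul_inv_cancel_left]
      rfl
    · intro R _ _ g n hn
      have key : ∀ g : Pt k A R,
          slice φ (TensorProduct.comm k A R
            ((Pt.inl k A R * Pt.map (Algebra.TensorProduct.includeRight : R →ₐ[k] A ⊗[k] R) g) f)) =
            g (slice φ (TensorProduct.comm k A A (comul f))) := by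
        intro g
        rw [Pt.mul_apply]
        generalize (comul f : A ⊗[k] A) = z
        induction z with
        | zero => simp
        | add z w hz hw => simp only [map_add, hz, hw]
        | tmul z w => simp
      rw [← key, ← key, map_mul, ← mul_assoc, hf _ _ _ (map_mem_closedSubgroup hn
        (Algebra.TensorProduct.includeRight : R →ₐ[k] A ⊗[k] R))]
  antipode_mem f hf R _ _ g n hn := by
    rw [← Pt.inv_apply, ← Pt.inv_apply, mul_inv_rev]
    exact hI.mul_left_apply hf (Subgroup.inv_mem _ hn)

/-- A function `u` on `P × G` that is invariant under `I` in the second variable takes the same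
value at `1` and at all points that are trivial on the invariants. -/
lemma lift_eq_of_invariant {P : Type u} [CommRing P] [Algebra k P] {u : P ⊗[k] A}
    (hu : ∀ (R : Type u) [CommRing R] [Algebra k R] (π : P →ₐ[k] R) (g n : Pt k A R),
      n ∈ closedSubgroup I R → Algebra.TensorProduct.lift π (g * n).hom (fun _ _ => .all ..) u =
        Algebra.TensorProduct.lift π g.hom (fun _ _ => .all ..) u)
    (π : P →ₐ[k] R) {x : Pt k A R}
    (hx : ∀ b ∈ invariants k I, x b = algebraMap k R (counit b)) :
    Algebra.TensorProduct.lift π x.hom (fun _ _ => .all ..) u =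
      Algebra.TensorProduct.lift π (1 : Pt k A R).hom (fun _ _ => .all ..) u := by
  obtain ⟨m, a, p, hp, hap⟩ := exists_sum_tmul_linearIndependent (TensorProduct.comm k _ _ u)
  have hu' : u = ∑ i, p i ⊗ₜ[k] a i := by
    have := congrArg (TensorProduct.comm k _ _).symm hap
    simpa using this
  have ha : ∀ i, a i ∈ invariants k I := by
    intro i S _ _ g n hn
    have h1 := hu (P ⊗[k] S) Algebra.TensorProduct.includeLeft
      (Pt.map Algebra.TensorProduct.includeRight g) (Pt.map Algebra.TensorProduct.includeRight n)
      (map_mem_closedSubgroup hn _)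
    rw [← map_mul, hu', map_sum, map_sum, ← sub_eq_zero, ← Finset.sum_sub_distrib] at h1
    simp only [Algebra.TensorProduct.lift_tmul, Pt.hom_apply, Pt.map_apply,
      Algebra.TensorProduct.includeLeft_apply, Algebra.TensorProduct.includeRight_apply,
      Algebra.TensorProduct.tmul_mul_tmul, mul_one, one_mul, ← tmul_sub] at h1
    exact sub_eq_zero.1 (eq_zero_of_sum_tmul_left hp h1 i)
  rw [hu', map_sum, map_sum]
  refine Finset.sum_congr rfl fun i _ => ?_
  rw [Algebra.TensorProduct.lift_tmul, Algebra.TensorProduct.lift_tmul, Pt.hom_apply,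
    Pt.hom_apply, hx _ (ha i), Pt.one_apply]

end Invariants

end AffineGroup

/-! ### Simultaneous symmetrization of commuting matrices -/

open scoped Matrix

namespace AffineGroup

/-- A nonzero finite module over a commutative algebra `E` carries a nonzero bilinear form for
which all elements of `E` are self-adjoint: the module has a simple quotient, which is of the form
`E / m`, and the form is a linear form on `E / m` composed with the multiplication. -/
theorem exists_bilin_smul_eq {k E M : Type*} [Field k] [CommRing E] [Algebra k E]
    [AddCommGroup M] [Module k M] [Module E M] [IsScalarTower k E M] [Module.Finite E M]
    [Nontrivial M] :
    ∃ F : M →ₗ[k] M →ₗ[k] k, F ≠ 0 ∧ ∀ (e : E) (x y : M), F (e • x) y = F x (e • y) := by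
  obtain h | ⟨N, hN, -⟩ := eq_top_or_exists_le_coatom (⊥ : Submodule E M)
  · exact absurd h bot_ne_top
  obtain ⟨m, hm, ⟨e⟩⟩ := isSimpleModule_iff_quot_maximal.1 (isSimpleModule_iff_isCoatom.2 hN)
  let π : M →ₗ[E] E ⧸ m := e.toLinearMap ∘ₗ N.mkQ
  have hπ : Function.Surjective π := e.surjective.comp N.mkQ_surjective
  have hm1 : (1 : E ⧸ m) ≠ 0 := by
    have := Ideal.Quotient.nontrivial_iff.2 hm.ne_top
    exact one_ne_zero
  obtain ⟨s, hs⟩ : ∃ s : Module.Dual k (E ⧸ m), s 1 ≠ 0 := by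
    by_contra! h
    exact hm1 ((Module.forall_dual_apply_eq_zero_iff k _).1 h)
  let πk : M →ₗ[k] E ⧸ m := π.restrictScalars k
  refine ⟨((LinearMap.mul k (E ⧸ m)).compl₁₂ πk πk).compr₂ s, fun h => ?_, fun e x y => ?_⟩
  · obtain ⟨v, hv⟩ := hπ 1
    have : s (π v * π v) = 0 := LinearMap.congr_fun₂ h v v
    rw [hv, mul_one] at this
    exact hs this
  · change s (π (e • x) * π y) = s (π x * π (e • y))
    rw [map_smul, map_smul, smul_mul_assoc, mul_smul_comm]

open scoped IsMulCommutative in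
/-- Pairwise commuting matrices are simultaneously self-adjoint for some nonzero bilinear form. -/
theorem exists_matrix_mul_eq_mul_transpose {k η : Type*} [Field k] [Fintype η] [DecidableEq η]
    [Nonempty η] (S : Set (Matrix η η k)) (hS : ∀ c ∈ S, ∀ d ∈ S, c * d = d * c) :
    ∃ q : Matrix η η k, q ≠ 0 ∧ ∀ c ∈ S, c * q = q * cᵀ := by
  -- the transposed matrices act on `η → k` through the commutative algebra they generate
  let T : Set (Module.End k (η → k)) := (fun c => Matrix.toLin' cᵀ) '' S
  have hT : ∀ a ∈ T, ∀ b ∈ T, a * b = b * a := by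
    rintro _ ⟨c, hc, rfl⟩ _ ⟨d, hd, rfl⟩
    simp only [Module.End.mul_eq_comp]
    rw [← Matrix.toLin'_mul, ← Matrix.toLin'_mul, ← Matrix.transpose_mul, ← Matrix.transpose_mul,
      hS c hc d hd]
  have := Algebra.isMulCommutative_adjoin k hT
  have : IsScalarTower k (Algebra.adjoin k T) (η → k) := ⟨fun _ _ _ => rfl⟩
  have : Module.Finite (Algebra.adjoin k T) (η → k) :=
    Module.Finite.of_restrictScalars_finite k _ _
  obtain ⟨F, hF0, hF⟩ := exists_bilin_smul_eq (k := k) (E := Algebra.adjoin k T) (M := η → k)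
  refine ⟨LinearMap.toMatrix₂' k F, fun h => hF0 ((LinearMap.toMatrix₂' k).map_eq_zero_iff.1 h),
    fun c hc => ?_⟩
  have h1 : F ∘ₗ Matrix.toLin' cᵀ = F.compl₂ (Matrix.toLin' cᵀ) :=
    LinearMap.ext₂ fun x y => hF ⟨_, Algebra.subset_adjoin ⟨c, hc, rfl⟩⟩ x y
  have h2 := congrArg (LinearMap.toMatrix₂' k) h1
  rw [LinearMap.toMatrix₂'_comp, LinearMap.toMatrix₂'_compl₂] at h2
  simpa using h2

end AffineGroup

/-! ### Functions of two variables that are symmetric under a normal subgroup -/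

namespace AffineGroup

section Normal

variable {k A : Type u} [Field k] [CommRing A] [HopfAlgebra k A]
variable {R : Type u} [CommRing R] [Algebra k R]

/-- The value of a function of two group elements at a pair of points. -/
noncomputable def Pt.pair (g h : Pt k A R) : A ⊗[k] A →ₐ[k] R :=
  Algebra.TensorProduct.lift g.hom h.hom (fun _ _ => .all ..)

@[simp] lemma Pt.pair_tmul (g h : Pt k A R) (a b : A) : Pt.pair g h (a ⊗ₜ b) = g a * h b := by
  simp [Pt.pair]

lemma Pt.pair_map {S : Type u} [CommRing S] [Algebra k S] (φ : R →ₐ[k] S) (g h : Pt k A R)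
    (w : A ⊗[k] A) : Pt.pair (Pt.map φ g) (Pt.map φ h) w = φ (Pt.pair g h w) := by
  induction w with
  | zero => simp
  | add z w hz hw => simp only [map_add, hz, hw]
  | tmul z w => simp

lemma Pt.pair_inl_inr (w : A ⊗[k] A) : Pt.pair (Pt.inl k A A) (Pt.inr k A A) w = w := by
  induction w with
  | zero => simp
  | add z w hz hw => simp only [map_add, hz, hw]
  | tmul z w => simp

/-- The canonical point of the quotient by an ideal. -/
def Pt.quot (J : Ideal A) : Pt k A (A ⧸ J) := Pt.mk (Ideal.Quotient.mkₐ k J)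

lemma Pt.quot_apply (J : Ideal A) (f : A) :
    (Pt.quot J : Pt k A (A ⧸ J)) f = Ideal.Quotient.mk J f := rfl

lemma Pt.exists_map_quot {J : Ideal A} {x : Pt k A R} (hx : ∀ f ∈ J, x f = 0) :
    ∃ φ : (A ⧸ J) →ₐ[k] R, x = Pt.map φ (Pt.quot J) :=
  ⟨Ideal.Quotient.liftₐ J x.hom hx, rfl⟩

lemma Pt.quot_eq_zero {J : Ideal A} {f : A} (hf : f ∈ J) :
    (Pt.quot J : Pt k A (A ⧸ J)) f = 0 := Ideal.Quotient.eq_zero_iff_mem.2 hf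

variable {I : Ideal A} [I.IsHopfIdeal k]

/-- Functions `p r` that span a representation of the group and transform under right translation
by the normal subgroup through a character yield a nonzero function `w` of two variables that is
symmetric with respect to this subgroup. The inverses of the `p r` span a representation on which
the subgroup acts by pairwise commuting matrices, so that
`exists_matrix_mul_eq_mul_transpose` applies. -/
theorem exists_symmetric_tensor (hI : IsNormalIdeal k I) {ρ : Type*} [Fintype ρ] {p : ρ → A}
    {r₀ : ρ} {a : ρ → ρ → A} (ha : ∀ r, comul (R := k) (p r) = ∑ r', a r r' ⊗ₜ[k] p r')
    (hp : ∀ (R : Type u) [CommRing R] [Algebra k R] (g n : Pt k A R),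
      n ∈ closedSubgroup I R → ∀ r, (g * n) (p r) = g (p r) * n (p r₀))
    (h1 : counit (R := k) (p r₀) = 1) :
    ∃ w : A ⊗[k] A, w ≠ 0 ∧ ∀ (R : Type u) [CommRing R] [Algebra k R] (g y n : Pt k A R),
      n ∈ closedSubgroup I R → Pt.pair (g * n) y w = Pt.pair g (y * n) w ∧
        Pt.pair (g * n) y w = (g * n⁻¹ * g⁻¹) (p r₀) * Pt.pair g y w := by
  classical
  -- the span of the inverses of the `p r`; on it right translation by `n` is multiplication by a
  -- value of the character `p r₀`
  let H : Submodule k A := Submodule.span k (Set.range fun r => antipode k (p r))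
  have hHs : IsSubcomodule H := by
    refine fun v hv => Submodule.span_induction (p := fun v _ =>
      comul v ∈ LinearMap.range (H.subtype.rTensor A)) ?_ ?_ ?_ ?_ hv
    · rintro _ ⟨r, rfl⟩
      simp only [comul_antipode, ha, map_sum, TensorProduct.comm_tmul, TensorProduct.map_tmul]
      exact Submodule.sum_mem _ fun r' _ =>
        ⟨(⟨_, Submodule.subset_span ⟨r', rfl⟩⟩ : H) ⊗ₜ _, rfl⟩
    · rw [map_zero]; exact Submodule.zero_mem _
    · intro x y _ _ hx hy
      rw [map_add]; exact Submodule.add_mem _ hx hy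
    · intro c x _ hx
      rw [map_smul]; exact Submodule.smul_mem _ _ hx
  have : FiniteDimensional k H := FiniteDimensional.span_of_finite k (Set.finite_range _)
  have hH : ∀ (R : Type u) [CommRing R] [Algebra k R] (g n : Pt k A R), n ∈ closedSubgroup I R →
      ∀ h ∈ H, (g * n) h = g h * (g * n⁻¹ * g⁻¹) (p r₀) := by
    intro R _ _ g n hn h hh
    refine Submodule.span_induction (p := fun h _ =>
      (g * n) h = g h * (g * n⁻¹ * g⁻¹) (p r₀)) ?_ ?_ ?_ ?_ hh
    · rintro _ ⟨r, rfl⟩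
      simp only [← Pt.inv_apply]
      rw [← hp R g⁻¹ _ ((hI R).conj_mem _ (Subgroup.inv_mem _ hn) g)]
      congr 1
      group
    · simp
    · intro x y _ _ hx hy
      rw [map_add, map_add, hx, hy, add_mul]
    · intro c x _ hx
      rw [map_smul, map_smul, hx, smul_mul_assoc]
  have hmul : ∀ (R : Type u) [CommRing R] [Algebra k R] (g n m : Pt k A R),
      n ∈ closedSubgroup I R → m ∈ closedSubgroup I R → ∀ h ∈ H,
      (g * n * m) h = g h * ((g * n⁻¹ * g⁻¹) (p r₀) * (g * m⁻¹ * g⁻¹) (p r₀)) := by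
    intro R _ _ g n m hn hm h hh
    have hn' := (hI R).conj_mem _ (Subgroup.inv_mem _ hn) g
    have hm' := (hI R).conj_mem _ (Subgroup.inv_mem _ hm) g
    rw [mul_assoc, hH R g _ (Subgroup.mul_mem _ hn hm) h hh,
      show g * (n * m)⁻¹ * g⁻¹ = (g * m⁻¹ * g⁻¹) * (g * n⁻¹ * g⁻¹) by group, hp R _ _ hn']
    ring
  -- values of a character commute, hence so do right translations by points of the subgroup
  have hcomm : ∀ (R : Type u) [CommRing R] [Algebra k R] (g n m : Pt k A R),
      n ∈ closedSubgroup I R → m ∈ closedSubgroup I R → ∀ h ∈ H,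
      (g * n * m) h = (g * m * n) h := by
    intro R _ _ g n m hn hm h hh
    rw [hmul R g n m hn hm h hh, hmul R g m n hm hn h hh]
    congr 1
    exact mul_comm _ _
  let b := Module.finBasis k H
  -- the matrix of the action on `H`; its coefficient matrices modulo `I` commute pairwise
  obtain ⟨c, hc, -, -⟩ := hHs.exists_coeff b
  have hbi : LinearIndependent k fun j => (b j : A) :=
    b.linearIndependent.map' H.subtype (Submodule.ker_subtype _)
  have hne : Nonempty (Fin (Module.finrank k H)) := by
    by_contra h
    rw [not_nonempty_iff] at h
    have h0 : (⟨antipode k (p r₀), Submodule.subset_span ⟨r₀, rfl⟩⟩ : H) = 0 :=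
      b.ext_elem fun i => h.elim i
    have h2 : antipode k (p r₀) = 0 := congrArg Subtype.val h0
    have h3 : p r₀ = 0 := by rw [← antipode_antipode (k := k) (p r₀), h2, map_zero]
    rw [h3, map_zero] at h1
    exact zero_ne_one h1
  have hcc : ∀ (R : Type u) [CommRing R] [Algebra k R] (n m : Pt k A R), n ∈ closedSubgroup I R →
      m ∈ closedSubgroup I R → ∀ i l, ∑ j, n (c i j) * m (c j l) = ∑ j, m (c i j) * n (c j l) := by
    intro R _ _ n m hn hm i l
    let ι : R →ₐ[k] A ⊗[k] R := Algebra.TensorProduct.includeRight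
    have expand : ∀ n m : Pt k A R, (Pt.inl k A R * Pt.map ι n * Pt.map ι m) (b l : A) =
        ∑ i, (b i : A) ⊗ₜ[k] ∑ j, n (c i j) * m (c j l) := by
      intro n m
      rw [Pt.mul_apply_sum _ _ (hc l)]
      simp only [Pt.mul_apply_sum _ _ (hc _), Finset.sum_mul, Pt.inl_apply, Pt.map_apply,
        tmul_sum]
      rw [Finset.sum_comm]
      simp [ι]
    have h2 := expand n m
    rw [hcomm _ _ _ _ (map_mem_closedSubgroup hn ι) (map_mem_closedSubgroup hm ι) _ (b l).2,
      expand, ← sub_eq_zero,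
      ← Finset.sum_sub_distrib] at h2
    simp only [← tmul_sub] at h2
    exact (sub_eq_zero.1 (eq_zero_of_sum_tmul_left hbi h2 i)).symm
  obtain ⟨q, hq0, hq⟩ := exists_matrix_mul_eq_mul_transpose
    (Set.range fun φ : Module.Dual k (A ⧸ I) => Matrix.of fun i j =>
      φ (Ideal.Quotient.mk I (c i j))) (by
    rintro _ ⟨φ, rfl⟩ _ ⟨ψ, rfl⟩
    ext i l
    have h2 := hcc ((A ⧸ I) ⊗[k] (A ⧸ I)) (Pt.map Algebra.TensorProduct.includeLeft (Pt.quot I))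
      (Pt.map Algebra.TensorProduct.includeRight (Pt.quot I))
      (map_mem_closedSubgroup (fun f hf => Pt.quot_eq_zero hf) _)
      (map_mem_closedSubgroup (fun f hf => Pt.quot_eq_zero hf) _) i l
    have h3 := congrArg (LinearMap.mul' k k ∘ₗ TensorProduct.map φ ψ) h2
    simpa [Matrix.mul_apply, Pt.quot_apply, mul_comm] using h3)
  have hq' : ∀ i j, ∑ l, q l j • Ideal.Quotient.mk I (c i l) =
      ∑ l, q i l • Ideal.Quotient.mk I (c j l) := by
    intro i j
    refine sub_eq_zero.1 ((Module.forall_dual_apply_eq_zero_iff k _).1 fun φ => ?_)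
    have h2 := congrFun (congrFun (hq _ ⟨φ, rfl⟩) i) j
    simp only [Matrix.mul_apply, Matrix.transpose_apply, Matrix.of_apply] at h2
    simp only [map_sub, map_sum, map_smul, smul_eq_mul, ← h2, mul_comm, sub_self]
  have hqn : ∀ (R : Type u) [CommRing R] [Algebra k R] (n : Pt k A R), n ∈ closedSubgroup I R →
      ∀ i j, ∑ l, q l j • n (c i l) = ∑ l, q i l • n (c j l) := by
    intro R _ _ n hn i j
    obtain ⟨φ, rfl⟩ := Pt.exists_map_quot hn
    have := congrArg φ (hq' i j)
    simp only [map_sum, map_smul] at this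
    exact this
  -- the tensor `w` with coefficient matrix `q`
  refine ⟨∑ i, ∑ j, q i j • ((b i : A) ⊗ₜ[k] (b j : A)), fun h => hq0 ?_, ?_⟩
  · simp only [← tmul_smul, ← tmul_sum] at h
    ext i j
    exact linearIndependent_iff'.1 hbi Finset.univ (fun j => q i j)
      (eq_zero_of_sum_tmul_left hbi h i) j (Finset.mem_univ _)
  · intro R _ _ g y n hn
    constructor
    · simp only [map_sum, map_smul, Pt.pair_tmul, Pt.mul_apply_sum _ _ (hc _)]
      trans ∑ l, ∑ j, g (b l : A) * y (b j : A) * ∑ i, q i j • n (c l i)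
      · simp only [Finset.mul_sum, Finset.sum_mul, Finset.smul_sum]
        rw [Finset.sum_comm]
        refine (Finset.sum_congr rfl fun j _ => Finset.sum_comm).trans ?_
        rw [Finset.sum_comm]
        refine Finset.sum_congr rfl fun l _ => Finset.sum_congr rfl fun j _ =>
          Finset.sum_congr rfl fun i _ => ?_
        rw [mul_smul_comm]
        congr 1
        ring
      · simp only [hqn R n hn]
        simp only [Finset.mul_sum, Finset.smul_sum]
        refine Finset.sum_congr rfl fun i _ => ?_
        rw [Finset.sum_comm]
        refine Finset.sum_congr rfl fun j _ => Finset.sum_congr rfl fun l _ => ?_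
        rw [mul_smul_comm]
        congr 1
        ring
    · simp only [map_sum, map_smul, Pt.pair_tmul, Finset.mul_sum,
        hH R g n hn _ (Subtype.coe_prop _), mul_smul_comm]
      refine Finset.sum_congr rfl fun i _ => Finset.sum_congr rfl fun j _ => ?_
      congr 1
      ring

end Normal

end AffineGroup

/-! ### A normal Hopf ideal is generated by its invariants -/

namespace AffineGroup

/-- A basis of `V` that starts with a basis of `W`. -/
lemma exists_adapted_basis {k V : Type*} [Field k] [AddCommGroup V] [Module k V]
    [FiniteDimensional k V] (W : Submodule k V) :
    ∃ (m n : ℕ) (b : Module.Basis (Fin m ⊕ Fin n) k V), (∀ j, b (.inl j) ∈ W) ∧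
      W ≤ Submodule.span k (Set.range fun j => b (.inl j)) ∧
      LinearIndependent k fun i => W.mkQ (b (.inr i)) := by
  obtain ⟨C, hC⟩ := W.exists_isCompl
  let b₁ := Module.finBasis k W
  let b₂ := Module.finBasis k C
  let b : Module.Basis _ k V := (b₁.prod b₂).map (Submodule.prodEquivOfIsCompl W C hC)
  have hb1 : ∀ j, b (.inl j) = b₁ j := fun j => by simp [b]
  have hb2 : ∀ j, b (.inr j) = b₂ j := fun j => by simp [b]
  refine ⟨_, _, b, fun j => by rw [hb1]; exact (b₁ j).2, fun f hf => ?_, ?_⟩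
  · have h := congrArg W.subtype (b₁.sum_repr ⟨f, hf⟩)
    rw [map_sum] at h
    rw [show f = _ from h.symm]
    refine Submodule.sum_mem _ fun j _ => ?_
    rw [map_smul]
    refine Submodule.smul_mem _ _ (Submodule.subset_span ⟨j, hb1 j⟩)
  · simp only [hb2]
    refine b₂.linearIndependent.map' (W.mkQ ∘ₗ C.subtype) ?_
    rw [LinearMap.ker_eq_bot']
    intro x hx
    exact Subtype.ext (hC.disjoint.le_bot ⟨(Submodule.Quotient.mk_eq_zero _).1 hx, x.2⟩)

section Normal

variable {k A : Type u} [Field k] [CommRing A] [HopfAlgebra k A]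
variable {R : Type u} [CommRing R] [Algebra k R]
variable {I : Ideal A} [I.IsHopfIdeal k]

lemma counit_eq_zero_of_mem {f : A} (hf : f ∈ I) : counit (R := k) f = 0 :=
  Submodule.IsCoideal.counit_eq_zero (I := I.restrictScalars k) hf

/-- A basis of a finite-dimensional subcomodule adapted to its intersection with a Hopf ideal. -/
lemma exists_adapted_coeff {V : Submodule k A} [FiniteDimensional k V] (hV : IsSubcomodule V) :
    ∃ (m n : ℕ) (b : Fin m ⊕ Fin n → A) (t : Fin m ⊕ Fin n → Fin m ⊕ Fin n → A),
      (∀ f ∈ V, f ∈ I → f ∈ Submodule.span k (Set.range fun j => b (.inl j))) ∧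
      (∀ j, b (.inl j) ∈ I) ∧ (∀ i j, t (.inr i) (.inl j) ∈ I) ∧
      (∀ j, comul (R := k) (b j) = ∑ i, b i ⊗ₜ[k] t i j) ∧
      (∀ i j, comul (R := k) (t i j) = ∑ l, t i l ⊗ₜ[k] t l j) ∧
      (∀ i j, counit (R := k) (t i j) = if i = j then 1 else 0) := by
  let W : Submodule k V := (I.restrictScalars k).comap V.subtype
  obtain ⟨m, n, b, hbI, hspan, hli⟩ := exists_adapted_basis W
  obtain ⟨t, h1, h2, h3⟩ := hV.exists_coeff b
  refine ⟨m, n, fun j => b j, t, fun f hfV hfI => ?_, hbI, fun i j => ?_, h1, h2, h3⟩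
  · have h := Submodule.mem_map_of_mem (f := V.subtype) (hspan (show ⟨f, hfV⟩ ∈ W from hfI))
    rw [Submodule.map_span, ← Set.range_comp] at h
    exact h
  · have hz := Submodule.IsCoideal.map_mkQ_comul_eq_zero (I := I.restrictScalars k) (hbI j)
    have h1' := h1 (.inl j)
    change comul (R := k) (V.subtype (b (.inl j))) = _ at h1'
    rw [h1', map_sum, Fintype.sum_sum_type, Finset.sum_eq_zero, zero_add] at hz
    · simp only [TensorProduct.map_tmul] at hz
      have hli' : LinearIndependent k fun i => (I.restrictScalars k).mkQ (b (.inr i) : A) :=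
        hli.map' (W.mapQ (I.restrictScalars k) V.subtype le_rfl)
          (by rw [Submodule.ker_mapQ]; exact W.mkQ_map_self)
      exact (Submodule.Quotient.mk_eq_zero _).1 (eq_zero_of_sum_tmul_left hli' hz i)
    · intro i _
      rw [TensorProduct.map_tmul, show (I.restrictScalars k).mkQ (b (.inl i) : A) = 0 from
        (Submodule.Quotient.mk_eq_zero _).2 (hbI i), zero_tmul]

lemma Pt.map_det {m : ℕ} (g : Pt k A R) (M : Matrix (Fin m) (Fin m) A) :
    g M.det = (Matrix.of fun i j => g (M i j)).det :=
  AlgHom.map_det g.hom M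

/-- A normal closed subgroup is the kernel of the quotient map defined by its invariants. For a
subrepresentation `V` of the regular representation, the subgroup stabilizes `V ∩ I`, and the
Plücker coordinates `p r` of this stabilized subspace transform under the subgroup through a
character. The symmetric function `w` of `exists_symmetric_tensor` twists them to functions
`u r` that are invariant under the subgroup, and the vanishing of the relevant matrix coefficients
at a point trivial on all invariants is read off from the values of the `u r`. -/
theorem IsNormalIdeal.le_augIdeal_invariants (hI : IsNormalIdeal k I) :
    I ≤ augIdeal (invariants k I) := by
  classical
  intro f₀ hf₀
  obtain ⟨V, hVf, hfV, hV⟩ := exists_finiteDimensional_subcomodule (k := k) f₀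
  obtain ⟨d, e, b, t, hspan, hbI, htI, hb, ht, hε⟩ := exists_adapted_coeff (I := I) hV
  -- Plücker coordinates: minors of the columns of `t` that belong to the subspace `V ∩ I`
  let p : (Fin d → Fin d ⊕ Fin e) → A := fun r => (Matrix.of fun i j => t (r i) (.inl j)).det
  have hpt : ∀ (R : Type u) [CommRing R] [Algebra k R] (g : Pt k A R) r,
      g (p r) = (Matrix.of fun i j => g (t (r i) (.inl j))).det :=
    fun R _ _ g r => g.map_det _
  -- `p` spans a representation: the determinant is multilinear in the rows
  have ha : ∀ r, comul (R := k) (p r) = ∑ r', (∏ i, t (r i) (r' i)) ⊗ₜ[k] p r' := by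
    intro r
    rw [← Pt.inl_mul_inr, hpt]
    have h1 : (Matrix.of fun i j => (Pt.inl k A A * Pt.inr k A A) (t (r i) (.inl j))) =
        fun i => ∑ l, Pt.inl k A A (t (r i) l) • fun j => Pt.inr k A A (t l (.inl j)) := by
      ext i j
      rw [Matrix.of_apply, Pt.mul_apply_sum _ _ (ht _ _), Finset.sum_apply]
      rfl
    rw [h1]
    refine (Matrix.detRowAlternating.toMultilinearMap.map_sum _).trans ?_
    refine Finset.sum_congr rfl fun r' _ => ?_
    refine (Matrix.detRowAlternating.toMultilinearMap.map_smul_univ _ _).trans ?_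
    have h2 : Pt.inr k A A (p r') =
      Matrix.detRowAlternating fun i j => Pt.inr k A A (t (r' i) (.inl j)) := hpt _ _ _
    have h3 : (∏ i, Pt.inl k A A (t (r i) (r' i))) = Pt.inl k A A (∏ i, t (r i) (r' i)) :=
      (map_prod _ _ _).symm
    rw [h3]
    refine (congrArg (_ • ·) h2.symm).trans ?_
    rw [Pt.inl_apply, Pt.inr_apply, smul_eq_mul, Algebra.TensorProduct.tmul_mul_tmul, mul_one,
      one_mul]
  -- points of the subgroup stabilize `V ∩ I`, on which they have determinant `p .inl`
  have hp : ∀ (R : Type u) [CommRing R] [Algebra k R] (g n : Pt k A R),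
      n ∈ closedSubgroup I R → ∀ r, (g * n) (p r) = g (p r) * n (p .inl) := by
    intro R _ _ g n hn r
    rw [hpt, hpt, hpt, ← Matrix.det_mul]
    congr 1
    ext i j
    rw [Matrix.of_apply, Pt.mul_apply_sum _ _ (ht _ _), Fintype.sum_sum_type, Matrix.mul_apply]
    simp [hn _ (htI _ _)]
  have hp1 : ∀ (R : Type u) [CommRing R] [Algebra k R], (1 : Pt k A R) (p .inl) = 1 := by
    intro R _ _
    rw [hpt, ← Matrix.det_one (n := Fin d)]
    congr 1
    ext i j
    rw [Matrix.of_apply, Pt.one_apply, hε, Matrix.one_apply]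
    by_cases h : i = j <;> simp [h]
  -- the coordinates obtained by exchanging one basis vector vanish at the identity
  have hp0 : ∀ (R : Type u) [CommRing R] [Algebra k R] l i,
      (1 : Pt k A R) (p (Function.update .inl l (.inr i))) = 0 := by
    intro R _ _ l i
    rw [hpt]
    refine Matrix.det_eq_zero_of_row_eq_zero l fun j => ?_
    simp [Pt.one_apply, hε]
  obtain ⟨w, hw0, hw⟩ := exists_symmetric_tensor (r₀ := Sum.inl) hI ha hp (hp1 k)
  -- the twisted coordinate, as a function of three points; it is invariant in the third one
  let U : ∀ (R : Type u) [CommRing R] [Algebra k R] (r) (g y x : Pt k A R), R :=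
    fun R _ _ r g y x => x (p r) * Pt.pair g (y * g⁻¹ * x * g) w
  have hUn : ∀ (R : Type u) [CommRing R] [Algebra k R] (r) (g y x n : Pt k A R),
      n ∈ closedSubgroup I R → U R r g y (x * n) = U R r g y x := by
    intro R _ _ r g y x n hn
    have hn' : g⁻¹ * n * g ∈ closedSubgroup I R := by simpa using (hI R).conj_mem n hn g⁻¹
    change (x * n) (p r) * Pt.pair g (y * g⁻¹ * (x * n) * g) w = _
    rw [show y * g⁻¹ * (x * n) * g = (y * g⁻¹ * x * g) * (g⁻¹ * n * g) by group,
      ← (hw R g _ _ hn').1, (hw R g _ _ hn').2, hp R x n hn,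
      show g * (g⁻¹ * n * g)⁻¹ * g⁻¹ = n⁻¹ by group]
    have h1 : n (p .inl) * n⁻¹ (p .inl) = 1 := by
      rw [← hp R n _ (Subgroup.inv_mem _ hn), mul_inv_cancel, hp1]
    linear_combination (x (p r) * Pt.pair g (y * g⁻¹ * x * g) w) * h1
  have hUmap : ∀ (R S : Type u) [CommRing R] [Algebra k R] [CommRing S] [Algebra k S]
      (φ : R →ₐ[k] S) (r) (g y x : Pt k A R),
      φ (U R r g y x) = U S r (Pt.map φ g) (Pt.map φ y) (Pt.map φ x) := by
    intro R S _ _ _ _ φ r g y x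
    change φ (_ * _) = _ * _
    rw [map_mul, ← Pt.pair_map, map_mul, map_mul, map_mul, map_inv, Pt.map_apply]
  -- `u r` is `U` at the universal triple of points
  let ι : A ⊗[k] A →ₐ[k] (A ⊗[k] A) ⊗[k] A := Algebra.TensorProduct.includeLeft
  let u : (Fin d → Fin d ⊕ Fin e) → (A ⊗[k] A) ⊗[k] A := fun r =>
    U _ r (Pt.map ι (Pt.inl k A A)) (Pt.map ι (Pt.inr k A A)) (Pt.inr k A (A ⊗[k] A))
  have hu : ∀ (R : Type u) [CommRing R] [Algebra k R] (π : A ⊗[k] A →ₐ[k] R) (x : Pt k A R) r,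
      Algebra.TensorProduct.lift π x.hom (fun _ _ => .all ..) (u r) =
        U R r (Pt.map π (Pt.inl k A A)) (Pt.map π (Pt.inr k A A)) x := by
    intro R _ _ π x r
    rw [hUmap]
    congr 1 <;> exact Pt.ext' fun f => by simp [ι]
  -- `g`, `y` are universal points and `x` is the universal point trivial on the invariants
  let J := augIdeal (invariants k I)
  let π : A ⊗[k] A →ₐ[k] (A ⊗[k] A) ⊗[k] (A ⧸ J) := Algebra.TensorProduct.includeLeft
  let x : Pt k A ((A ⊗[k] A) ⊗[k] (A ⧸ J)) :=
    Pt.map Algebra.TensorProduct.includeRight (Pt.quot J)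
  let g := Pt.map π (Pt.inl k A A)
  let y := Pt.map π (Pt.inr k A A)
  have hx : ∀ f ∈ J, x f = 0 := fun f hf => by
    rw [Pt.map_apply, Pt.quot_eq_zero hf, map_zero]
  -- `u r` has the same value at `x` as at the identity
  have key : ∀ r, x (p r) * Pt.pair g (y * g⁻¹ * x * g) w = (1 : Pt k A _) (p r) * w ⊗ₜ[k] 1 := by
    intro r
    have h1 := lift_eq_of_invariant (I := I) (u := u r) (fun R _ _ π x n hn => by
      rw [hu, hu, hUn R _ _ _ _ _ hn]) π (forall_augIdeal_iff.1 hx)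
    rw [hu, hu] at h1
    refine h1.trans ?_
    change _ * _ = _
    rw [mul_one, inv_mul_cancel_right, Pt.pair_map, Pt.pair_inl_inr]
    rfl
  -- by Cramer's rule `p .inl` times the entry `t (.inr i) (.inl j)` is a combination of exchanged
  -- coordinates, which vanish at `x`, while a multiple of `p .inl` is `w ⊗ 1`
  have htJ : ∀ i j, t (.inr i) (.inl j) ∈ J := by
    intro i j
    let M : Matrix (Fin d) (Fin d) ((A ⊗[k] A) ⊗[k] (A ⧸ J)) :=
      Matrix.of fun i j => x (t (.inl i) (.inl j))
    let v : Fin d → (A ⊗[k] A) ⊗[k] (A ⧸ J) := fun j => x (t (.inr i) (.inl j))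
    have h1 := congrFun (Matrix.mulVec_cramer Mᵀ v) j
    have h2 : ∀ l, Matrix.cramer Mᵀ v l = x (p (Function.update .inl l (.inr i))) := by
      intro l
      rw [Matrix.cramer_transpose_apply, hpt]
      congr 1
      ext i' j'
      by_cases h : i' = l
      · subst h; simp [v]
      · simp [M, h]
    have h3 : x (p .inl) = Mᵀ.det := by rw [hpt, Matrix.det_transpose]
    simp only [Matrix.mulVec, dotProduct, h2, Pi.smul_apply, smul_eq_mul, ← h3] at h1
    have h4 : v j * w ⊗ₜ[k] 1 = 0 := by
      have h5 := key .inl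
      rw [hp1, one_mul] at h5
      rw [← h5, ← mul_assoc, mul_comm (v j), ← h1, Finset.sum_mul]
      refine Finset.sum_eq_zero fun l _ => ?_
      rw [mul_assoc, key, hp0, zero_mul, mul_zero]
    have h6 : w ⊗ₜ[k] Ideal.Quotient.mk J (t (.inr i) (.inl j)) = 0 := by
      rw [← h4]
      change _ = (1 ⊗ₜ _) * _
      simp [Pt.quot_apply]
    have h7 : LinearIndependent k fun _ : Unit => w := LinearIndependent.of_subsingleton () hw0
    refine Ideal.Quotient.eq_zero_iff_mem.1 (eq_zero_of_sum_tmul_left h7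
      (z := fun _ => Ideal.Quotient.mk J (t (.inr i) (.inl j))) ?_ ())
    simpa using h6
  have hbJ : ∀ j, b (.inl j) ∈ J := by
    intro j
    rw [← sum_counit_smul_of_comul_eq (hb (.inl j)), Fintype.sum_sum_type]
    refine J.add_mem (J.sum_mem fun i _ => ?_) (J.sum_mem fun i _ => ?_)
    · rw [counit_eq_zero_of_mem (hbI i), zero_smul]
      exact J.zero_mem
    · rw [Algebra.smul_def]
      exact J.mul_mem_left _ (htJ i j)
  exact Submodule.span_le (p := J.restrictScalars k).2 (by rintro _ ⟨j, rfl⟩; exact hbJ j)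
    (hspan f₀ hfV hf₀)

lemma augIdeal_invariants_le : augIdeal (invariants k I) ≤ I := by
  refine Ideal.span_le.2 fun f hf => ?_
  have h := hf.1 (A ⧸ I) 1 (Pt.quot I) (fun f hf => Pt.quot_eq_zero hf)
  rw [one_mul, Pt.one_apply, hf.2, map_zero] at h
  exact Ideal.Quotient.eq_zero_iff_mem.1 h

/-- A normal Hopf ideal is generated by the invariants that vanish at the identity: the subgroup is
the kernel of the morphism dual to the inclusion of the invariants. -/
theorem IsNormalIdeal.augIdeal_invariants (hI : IsNormalIdeal k I) :
    augIdeal (invariants k I) = I :=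
  le_antisymm augIdeal_invariants_le hI.le_augIdeal_invariants

end Normal

end AffineGroup

/-! ### Ascending polynomial ideals along a field endomorphism -/

section Polynomials

/-- Extension and contraction of ideals along a field extension of the coefficients of a polynomial
ring are inverse to each other. -/
lemma MvPolynomial.comap_map_ideal {ι k K : Type*} [Field k] [Field K] (τ : k →+* K)
    (J : Ideal (MvPolynomial ι k)) :
    (J.map (MvPolynomial.map τ)).comap (MvPolynomial.map τ) = J := by
  let _ : Algebra k K := τ.toAlgebra
  let _ : Algebra (MvPolynomial ι k) (MvPolynomial ι K) := MvPolynomial.algebraMvPolynomial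
  have : Module.Free (MvPolynomial ι k) (MvPolynomial ι K) :=
    Module.Free.of_equiv
      (Algebra.IsPushout.equiv k (MvPolynomial ι k) K (MvPolynomial ι K)).toLinearEquiv
  exact Ideal.comap_map_eq_self_of_faithfullyFlat (B := MvPolynomial ι K) J

/-- A field endomorphism `σ` of `k` becomes bijective in the direct limit along `σ`. -/
lemma exists_directLimit {k : Type u} [Field k] (σ : k →+* k) :
    ∃ (K : Type u) (_ : Field K) (τ : ℕ → k →+* K), ∀ i, (τ (i + 1)).comp σ = τ i := by
  let f : ∀ i j : ℕ, i ≤ j → k →+* k := fun i j _ => σ ^ (j - i)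
  have : DirectedSystem (fun _ : ℕ => k) (f · · ·) :=
    { map_self := fun i x => by simp [f]
      map_map := fun {l j i} hij hjl x => by
        change (σ ^ (l - j) * σ ^ (j - i)) x = (σ ^ (l - i)) x
        rw [← pow_add]
        congr 2
        omega }
  refine ⟨_, Field.DirectLimit.field (fun _ : ℕ => k) f,
    fun i => Ring.DirectLimit.of _ (f · · ·) i, fun i => RingHom.ext fun x => ?_⟩
  have h := Ring.DirectLimit.of_f (f := (f · · ·)) (G := fun _ : ℕ => k) (Nat.le_succ i) x
  rw [← h]
  have h1 : f i i.succ (Nat.le_succ i) = σ := by simp [f]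
  rw [h1]
  rfl

/-- A sequence of polynomial ideals that increases along an endomorphism `σ` of the coefficient
field is eventually obtained by applying `σ`: over the direct limit of the coefficient fields the
sequence becomes an increasing sequence of ideals of one noetherian ring. -/
theorem exists_map_eq_of_map_le {k : Type u} [Field k] (σ : k →+* k) {ι : Type*} [Finite ι]
    (P : ℕ → Ideal (MvPolynomial ι k)) (hP : ∀ i, (P i).map (MvPolynomial.map σ) ≤ P (i + 1)) :
    ∃ m, ∀ i ≥ m, P (i + 1) = (P i).map (MvPolynomial.map σ) := by
  obtain ⟨K, _, τ, hτ⟩ := exists_directLimit σ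
  have hmap : ∀ i, ((P i).map (MvPolynomial.map σ)).map (MvPolynomial.map (τ (i + 1))) =
      (P i).map (MvPolynomial.map (τ i)) := by
    intro i
    rw [Ideal.map_map, ← hτ i]
    congr 1
    exact RingHom.ext fun p => MvPolynomial.map_map _ _ p
  let Q : ℕ →o Ideal (MvPolynomial ι K) :=
    { toFun := fun i => (P i).map (MvPolynomial.map (τ i))
      monotone' := monotone_nat_of_le_succ fun i => by
        rw [← hmap]
        exact Ideal.map_mono (hP i) }
  obtain ⟨m, hm⟩ := monotone_stabilizes_iff_noetherian.2
    (inferInstance : IsNoetherianRing (MvPolynomial ι K)) Q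
  refine ⟨m, fun i hi => ?_⟩
  have h : Q (i + 1) = Q i := (hm _ (by omega)).symm.trans (hm _ hi)
  rw [← MvPolynomial.comap_map_ideal (τ (i + 1)) (P (i + 1)),
    ← MvPolynomial.comap_map_ideal (τ (i + 1)) ((P i).map _), hmap]
  exact congrArg _ h

end Polynomials

/-! ### Hopf algebras with a compatible endomorphism -/

namespace AffineGroup

section Shift

variable {k A : Type u} [Field k] [CommRing A] [HopfAlgebra k A]

/-- A ring endomorphism `s` of a Hopf algebra, semilinear over `σ`, that is compatible with the
Hopf algebra structure. Compatibility with the comultiplication is stated through presentations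
of `Δ f`, because `s ⊗ s` is not linear over `k`. -/
structure IsHopfShift (σ : k →+* k) (s : A →+* A) : Prop where
  map_algebraMap : ∀ c : k, s (algebraMap k A c) = algebraMap k A (σ c)
  comul_eq : ∀ {ι : Type} [Fintype ι] {f : A} {x y : ι → A},
    comul (R := k) f = ∑ i, x i ⊗ₜ[k] y i → comul (R := k) (s f) = ∑ i, s (x i) ⊗ₜ[k] s (y i)
  counit_eq : ∀ f : A, counit (R := k) (s f) = σ (counit (R := k) f)
  antipode_eq : ∀ f : A, antipode k (s f) = s (antipode k f)

variable {σ : k →+* k} {s : A →+* A}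

/-- The preimage of a subalgebra under a semilinear endomorphism. -/
def IsHopfShift.comap (hs : IsHopfShift σ s) (B : Subalgebra k A) : Subalgebra k A where
  __ := B.toSubring.comap s
  algebraMap_mem' c := by
    change s _ ∈ B
    rw [hs.map_algebraMap]
    exact B.algebraMap_mem _

lemma IsHopfShift.map_mem_augIdeal (hs : IsHopfShift σ s) {B C : Subalgebra k A}
    (h : ∀ b ∈ B, s b ∈ C) {f : A} (hf : f ∈ augIdeal B) : s f ∈ augIdeal C := by
  have : augIdeal B ≤ (augIdeal C).comap s := Ideal.span_le.2 fun b hb =>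
    Ideal.subset_span ⟨h b hb.1, by rw [hs.counit_eq, hb.2, map_zero]⟩
  exact this hf

lemma IsHopfShift.aeval_map (hs : IsHopfShift σ s) {ι : Type*} (b : ι → A)
    (p : MvPolynomial ι k) :
    MvPolynomial.aeval (fun i => s (b i)) (MvPolynomial.map σ p) = s (MvPolynomial.aeval b p) := by
  have : ((MvPolynomial.aeval (R := k) fun i => s (b i)) : MvPolynomial ι k →+* A).comp
      (MvPolynomial.map σ) = s.comp (MvPolynomial.aeval (R := k) b : MvPolynomial ι k →+* A) := by
    ext i
    · simp [hs.map_algebraMap]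
    · simp
  exact DFunLike.congr_fun this p

/-- The image of a Hopf subalgebra under `s` generates a Hopf subalgebra. -/
lemma IsHopfShift.isHopfSubalgebra_adjoin (hs : IsHopfShift σ s) {ι : Type*} {a : ι → A}
    (ha : IsHopfSubalgebra (Algebra.adjoin k (Set.range a))) :
    IsHopfSubalgebra (Algebra.adjoin k (Set.range fun i => s (a i))) := by
  have hmem : ∀ x ∈ Algebra.adjoin k (Set.range a),
      s x ∈ Algebra.adjoin k (Set.range fun i => s (a i)) := by
    have : Algebra.adjoin k (Set.range a) ≤
        hs.comap (Algebra.adjoin k (Set.range fun i => s (a i))) :=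
      Algebra.adjoin_le (by rintro _ ⟨i, rfl⟩; exact Algebra.subset_adjoin ⟨i, rfl⟩)
    exact this
  refine AffineGroup.isHopfSubalgebra_adjoin ?_ ?_
  · rintro _ ⟨i, rfl⟩
    obtain ⟨n, x, y, -, hxy⟩ := ha.exists_comul_eq (Algebra.subset_adjoin ⟨i, rfl⟩)
    rw [hs.comul_eq hxy]
    exact Subalgebra.sum_mem _ fun j _ =>
      tmul_mem_range_map (hmem _ (x j).2) (hmem _ (y j).2)
  · rintro _ ⟨i, rfl⟩
    rw [hs.antipode_eq]
    exact hmem _ (ha.antipode_mem _ (Algebra.subset_adjoin ⟨i, rfl⟩))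

variable {I : Ideal A} [I.IsHopfIdeal k]

/-- The image of a Hopf subalgebra in a quotient Hopf algebra. -/
lemma IsHopfSubalgebra.map_mk {B : Subalgebra k A} (hB : IsHopfSubalgebra B) :
    IsHopfSubalgebra (B.map (Ideal.Quotient.mkₐ k I)) where
  comul_mem := by
    rintro _ ⟨b, hb, rfl⟩
    obtain ⟨n, x, y, -, hxy⟩ := hB.exists_comul_eq hb
    have h1 : comul (R := k) (Ideal.Quotient.mk I b) =
        ∑ i, Ideal.Quotient.mk I (x i : A) ⊗ₜ[k] Ideal.Quotient.mk I (y i : A) := by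
      have h2 : comul (R := k) (Ideal.Quotient.mk I b) =
          TensorProduct.map (Ideal.Quotient.mkₐ k I).toLinearMap
            (Ideal.Quotient.mkₐ k I).toLinearMap (comul b) := rfl
      rw [h2, hxy, map_sum]
      rfl
    change comul (R := k) (Ideal.Quotient.mk I b) ∈ _
    rw [h1]
    exact Subalgebra.sum_mem _ fun i _ =>
      tmul_mem_range_map ⟨_, (x i).2, rfl⟩ ⟨_, (y i).2, rfl⟩
  antipode_mem := by
    rintro _ ⟨b, hb, rfl⟩
    exact ⟨antipode k b, hB.antipode_mem b hb, rfl⟩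

/-- The comultiplication maps `I ∩ B` to `(I ∩ B) ⊗ B + B ⊗ (I ∩ B)`. -/
lemma IsHopfSubalgebra.exists_comul_eq_of_mem {B : Subalgebra k A} (hB : IsHopfSubalgebra B)
    {f : A} (hfB : f ∈ B) (hfI : f ∈ I) :
    ∃ (ι : Type) (_ : Fintype ι) (x y : ι → A), comul (R := k) f = ∑ i, x i ⊗ₜ[k] y i ∧
      (∀ i, x i ∈ B) ∧ (∀ i, y i ∈ B) ∧ ∀ i, x i ∈ I ∨ y i ∈ I := by
  let I' : Submodule k A := I.restrictScalars k
  let J : Submodule k B := I'.comap B.val.toLinearMap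
  let j : (B ⧸ J) →ₗ[k] A ⧸ I' := J.mapQ I' B.val.toLinearMap le_rfl
  have hj : Function.Injective j := by
    rw [← LinearMap.ker_eq_bot, Submodule.ker_mapQ]
    exact J.mkQ_map_self
  obtain ⟨w, hw⟩ := hB.comul_mem f hfB
  have hw' : TensorProduct.map B.val.toLinearMap B.val.toLinearMap w = comul f := hw
  have hw0 : TensorProduct.map J.mkQ J.mkQ w = 0 := by
    have h1 := Submodule.IsCoideal.map_mkQ_comul_eq_zero (I := I') hfI
    have h2 : TensorProduct.map j j (TensorProduct.map J.mkQ J.mkQ w) = 0 := by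
      rw [← h1, ← hw', ← LinearMap.comp_apply, ← LinearMap.comp_apply, ← TensorProduct.map_comp,
        ← TensorProduct.map_comp]
      rfl
    exact (map_eq_zero_iff _ (TensorProduct.map_injective_of_flat_flat j j hj hj)).1 h2
  have hw1 : w ∈ LinearMap.ker (TensorProduct.map J.mkQ J.mkQ) := hw0
  have hex := LinearMap.exact_subtype_mkQ J
  rw [TensorProduct.map_ker hex J.mkQ_surjective hex J.mkQ_surjective] at hw1
  obtain ⟨_, ⟨v₁, rfl⟩, _, ⟨v₂, rfl⟩, rfl⟩ := Submodule.mem_sup.1 hw1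
  obtain ⟨n₁, x₁, y₁, -, rfl⟩ := exists_sum_tmul_linearIndependent v₁
  obtain ⟨n₂, x₂, y₂, -, rfl⟩ := exists_sum_tmul_linearIndependent v₂
  refine ⟨Fin n₁ ⊕ Fin n₂, inferInstance,
    Sum.elim (fun i => (x₁ i : A)) (fun i => ((x₂ i : B) : A)),
    Sum.elim (fun i => ((y₁ i : B) : A)) (fun i => (y₂ i : A)), ?_, ?_, ?_, ?_⟩
  · rw [← hw', Fintype.sum_sum_type]
    simp
  · rintro (i | i)
    · exact (x₁ i).2
    · exact (x₂ i : B).2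
  · rintro (i | i)
    · exact (y₁ i : B).2
    · exact (y₂ i).2
  · rintro (i | i)
    · exact .inr (y₁ i).2
    · exact .inl (x₂ i).2

/-- Amalgamation of a Hopf algebra with an arbitrary algebra over a Hopf subalgebra. -/
lemma IsHopfSubalgebra.exists_amalgam {D : Subalgebra k A} (hD : IsHopfSubalgebra D) {X : Type u}
    [CommRing X] [Algebra k X] (f : D →ₐ[k] X) :
    ∃ (R : Type u) (_ : CommRing R) (_ : Algebra k R) (φ : A →ₐ[k] R) (ψ : X →ₐ[k] R),
      (∀ d : D, φ d = ψ (f d)) ∧ Function.Injective ψ := by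
  let _ : Algebra D X := f.toAlgebra
  have : IsScalarTower k D X := IsScalarTower.of_algebraMap_eq fun c => (f.commutes c).symm
  refine ⟨X ⊗[D] A, inferInstance, inferInstance,
    (Algebra.TensorProduct.includeRight : A →ₐ[D] X ⊗[D] A).restrictScalars k,
    Algebra.TensorProduct.includeLeft, fun d => ?_, ?_⟩
  · exact (Algebra.TensorProduct.tmul_one_eq_one_tmul d).symm
  · rw [injective_iff_map_eq_zero]
    intro x hx
    exact eq_zero_of_tmul_one_eq_zero hD hx

/-- Comparison of a Hopf ideal `I` with an ideal `J` containing `I ∩ B`: an element of `I ∩ C`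
lies in `J` if it vanishes at all points that are trivial on `B` and on `s (I ∩ B)`. The point
that matters is `n⁻¹ * n'`, where `n` and `n'` are the canonical points of `A ⧸ I` and `A ⧸ J`
over an amalgam of these rings over the image of `B`. -/
theorem IsHopfShift.mem_of_forall_point (hs : IsHopfShift σ s) (hI : ∀ f ∈ I, s f ∈ I)
    {B C : Subalgebra k A} (hB : IsHopfSubalgebra B) (hC : IsHopfSubalgebra C) {J : Ideal A}
    (hJ : ∀ f ∈ J, s f ∈ J) (hIJ : ∀ f ∈ I, f ∈ B → f ∈ J)
    (h : ∀ (R : Type u) [CommRing R] [Algebra k R] (u : Pt k A R), (∀ f ∈ augIdeal B, u f = 0) →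
      (∀ f ∈ I, f ∈ B → u (s f) = 0) → ∀ f ∈ I, f ∈ C → u f = 0) :
    ∀ f ∈ I, f ∈ C → f ∈ J := by
  let q : B →ₐ[k] B.map (Ideal.Quotient.mkₐ k I) :=
    ((Ideal.Quotient.mkₐ k I).comp B.val).codRestrict _ fun b => ⟨b, b.2, rfl⟩
  have hq : Function.Surjective q := by
    rintro ⟨_, b, hb, rfl⟩
    exact ⟨⟨b, hb⟩, rfl⟩
  have hker : RingHom.ker q ≤ RingHom.ker ((Ideal.Quotient.mkₐ k J).comp B.val) := by
    intro b hb
    have h1 : Ideal.Quotient.mk I (b : A) = 0 := congrArg Subtype.val hb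
    exact Ideal.Quotient.eq_zero_iff_mem.2
      (hIJ _ (Ideal.Quotient.eq_zero_iff_mem.1 h1) b.2)
  obtain ⟨f', hf'⟩ : ∃ f' : B.map (Ideal.Quotient.mkₐ k I) →ₐ[k] A ⧸ J,
      ∀ b : B, f' (q b) = Ideal.Quotient.mk J b :=
    ⟨AlgHom.liftOfSurjective q hq _ hker, fun b => AlgHom.liftOfSurjective_apply ..⟩
  -- the canonical map from `B` to `A ⧸ J` factors through the image of `B` in `A ⧸ I`
  obtain ⟨R, _, _, φ, ψ, hφψ, hψ⟩ := (hB.map_mk (I := I)).exists_amalgam f'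
  let n : Pt k A R := Pt.map φ (Pt.quot I)
  let n' : Pt k A R := Pt.map ψ (Pt.quot J)
  have hn : n ∈ closedSubgroup I R := map_mem_closedSubgroup (fun f hf => Pt.quot_eq_zero hf) φ
  have hn' : ∀ f ∈ J, n' f = 0 := fun f hf => by
    rw [Pt.map_apply, Pt.quot_eq_zero hf, map_zero]
  have hnn' : ∀ b ∈ B, n b = n' b := fun b hb => by
    have := hφψ (q ⟨b, hb⟩)
    rw [hf'] at this
    exact this
  -- `n⁻¹ * n'` is trivial on `B` because `n` and `n'` agree there, and it kills `s (I ∩ B)` because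
  -- both kill it
  have hu := h R (n⁻¹ * n') (forall_augIdeal_iff.2 fun b hb => hB.inv_mul_apply hnn' hb) (by
    intro f hfI hfB
    obtain ⟨ι, _, x, y, hxy, hx, hy, hxyI⟩ := hB.exists_comul_eq_of_mem hfB hfI
    rw [Pt.mul_apply_sum _ _ (hs.comul_eq hxy)]
    refine Finset.sum_eq_zero fun i _ => ?_
    rcases hxyI i with hi | hi
    · rw [Subgroup.inv_mem _ hn _ (hI _ hi), zero_mul]
    · rw [hn' _ (hJ _ (hIJ _ hi (hy i))), mul_zero])
  intro f hfI hfC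
  have h1 : n' f = 0 := by
    rw [← mul_inv_cancel_left n n']
    obtain ⟨ι, _, x, y, hxy, hx, hy, hxyI⟩ := hC.exists_comul_eq_of_mem hfC hfI
    rw [Pt.mul_apply_sum _ _ hxy]
    refine Finset.sum_eq_zero fun i _ => ?_
    rcases hxyI i with hi | hi
    · rw [hn _ hi, zero_mul]
    · rw [hu _ hi (hy i), mul_zero]
  exact Ideal.Quotient.eq_zero_iff_mem.1 ((injective_iff_map_eq_zero _).1 hψ _ h1)

end Shift

end AffineGroup

/-! ### Finite generation of stable Hopf ideals and of their invariants -/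

namespace AffineGroup

section Finiteness

variable {k A : Type u} [Field k] [CommRing A] [HopfAlgebra k A]
variable {σ : k →+* k} {s : A →+* A}

/-- The subalgebra generated by the `s`-transforms of order at most `i` of a family `a`. -/
def stage (k : Type u) [Field k] [HopfAlgebra k A] (s : A →+* A) {ι : Type u} (a : ι → A) (i : ℕ) :
    Subalgebra k A :=
  ⨆ j : Set.Iic i, Algebra.adjoin k (Set.range fun l => s^[j] (a l))

section Stage

variable {ι : Type u} {a : ι → A}

lemma adjoin_le_stage {i j : ℕ} (h : j ≤ i) :
    Algebra.adjoin k (Set.range fun l => s^[j] (a l)) ≤ stage k s a i :=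
  le_iSup (fun j : Set.Iic i => Algebra.adjoin k (Set.range fun l => s^[j] (a l))) ⟨j, h⟩

lemma iterate_mem_stage (i : ℕ) (l : ι) : s^[i] (a l) ∈ stage k s a i :=
  adjoin_le_stage le_rfl (Algebra.subset_adjoin ⟨l, rfl⟩)

lemma stage_mono : Monotone (stage k s a) := fun _ _ h =>
  iSup_le fun j => adjoin_le_stage (le_trans j.2 h)

lemma stage_succ_le {i : ℕ} {C : Subalgebra k A} (h1 : stage k s a i ≤ C)
    (h2 : ∀ l, s^[i + 1] (a l) ∈ C) : stage k s a (i + 1) ≤ C := by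
  refine iSup_le fun ⟨j, hj⟩ => ?_
  rcases Nat.lt_or_ge j (i + 1) with h | h
  · exact (adjoin_le_stage (Nat.lt_succ_iff.1 h)).trans h1
  · obtain rfl : j = i + 1 := le_antisymm hj h
    exact Algebra.adjoin_le (by rintro _ ⟨l, rfl⟩; exact h2 l)

lemma IsHopfShift.map_mem_stage (hs : IsHopfShift σ s) {i : ℕ} {f : A}
    (hf : f ∈ stage k s a i) : s f ∈ stage k s a (i + 1) := by
  have : stage k s a i ≤ hs.comap (stage k s a (i + 1)) := by
    refine iSup_le fun j => Algebra.adjoin_le ?_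
    rintro _ ⟨l, rfl⟩
    change s (s^[j] (a l)) ∈ stage k s a (i + 1)
    rw [← Function.iterate_succ_apply' s]
    exact adjoin_le_stage (Nat.succ_le_succ j.2) (Algebra.subset_adjoin ⟨l, rfl⟩)
  exact this hf

lemma IsHopfShift.isHopfSubalgebra_stage (hs : IsHopfShift σ s)
    (ha : IsHopfSubalgebra (Algebra.adjoin k (Set.range a))) (i : ℕ) :
    IsHopfSubalgebra (stage k s a i) := by
  have h : ∀ j, IsHopfSubalgebra (Algebra.adjoin k (Set.range fun l => s^[j] (a l))) := by
    intro j
    induction j with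
    | zero => exact ha
    | succ j ih =>
      simp only [Function.iterate_succ_apply']
      exact hs.isHopfSubalgebra_adjoin ih
  exact IsHopfSubalgebra.iSup fun j => h j

lemma stage_fg [Finite ι] (i : ℕ) : (stage k s a i).FG := by
  refine Subalgebra.fg_def.2 ⟨⋃ j : Set.Iic i, Set.range fun l => s^[j] (a l),
    Set.finite_iUnion fun j => Set.finite_range _, ?_⟩
  exact Algebra.adjoin_iUnion _

/-- The union of all stages is the smallest `s`-stable subalgebra containing the family `a`. -/
lemma IsHopfShift.exists_mem_stage (hs : IsHopfShift σ s)
    (ha : ∀ C : Subalgebra k A, Set.range a ⊆ C → (∀ b ∈ C, s b ∈ C) → C = ⊤) (f : A) :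
    ∃ i, f ∈ stage k s a i := by
  have hdir : Directed (· ≤ ·) (stage k s a) := stage_mono.directed_le
  have h := ha (⨆ i, stage k s a i) (by
    rintro _ ⟨l, rfl⟩
    exact le_iSup (stage k s a) 0 (iterate_mem_stage 0 l)) (by
    intro b hb
    rw [← SetLike.mem_coe, Subalgebra.coe_iSup_of_directed hdir, Set.mem_iUnion] at hb
    obtain ⟨i, hi⟩ := hb
    exact le_iSup (stage k s a) (i + 1) (hs.map_mem_stage hi))
  have hf : f ∈ ⨆ i, stage k s a i := by rw [h]; exact Algebra.mem_top
  rwa [← SetLike.mem_coe, Subalgebra.coe_iSup_of_directed hdir, Set.mem_iUnion] at hf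

/-- Modulo the functions vanishing at the identity, elements of the next stage are polynomials in
the transforms of highest order. -/
lemma exists_aeval_sub_mem_augIdeal {i : ℕ} {f : A} (hf : f ∈ stage k s a (i + 1)) :
    ∃ p : MvPolynomial ι k,
      MvPolynomial.aeval (fun l => s^[i + 1] (a l)) p - f ∈ augIdeal (stage k s a i) := by
  let J := augIdeal (stage k s a i)
  let C : Subalgebra k A := (((Ideal.Quotient.mkₐ k J).comp
    (MvPolynomial.aeval fun l => s^[i + 1] (a l))).range).comap (Ideal.Quotient.mkₐ k J)
  have hC : stage k s a (i + 1) ≤ C := by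
    refine stage_succ_le (fun b hb => ?_) fun l => ?_
    · refine ⟨MvPolynomial.C (counit b), ?_⟩
      have := Ideal.Quotient.eq.2 (sub_algebraMap_mem_augIdeal hb)
      simpa using this.symm
    · exact ⟨MvPolynomial.X l, by simp⟩
  obtain ⟨p, hp⟩ := hC hf
  exact ⟨p, Ideal.Quotient.eq.1 hp⟩

/-- The polynomials that describe, up to functions vanishing at the identity of the previous
stage, the elements of an ideal in the transforms of highest order. -/
def symbolIdeal (k : Type u) [Field k] [HopfAlgebra k A] (s : A →+* A) (a : ι → A) (I : Ideal A)
    (i : ℕ) : Ideal (MvPolynomial ι k) where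
  carrier := {p | ∃ f ∈ I, f ∈ stage k s a (i + 1) ∧
    MvPolynomial.aeval (fun l => s^[i + 1] (a l)) p - f ∈ augIdeal (stage k s a i)}
  zero_mem' := ⟨0, I.zero_mem, Subalgebra.zero_mem _, by simp⟩
  add_mem' := by
    rintro p q ⟨f, hf, hf', hpf⟩ ⟨g, hg, hg', hqg⟩
    refine ⟨f + g, I.add_mem hf hg, Subalgebra.add_mem _ hf' hg', ?_⟩
    rw [map_add, add_sub_add_comm]
    exact Ideal.add_mem _ hpf hqg
  smul_mem' := by
    rintro c p ⟨f, hf, hf', hpf⟩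
    refine ⟨MvPolynomial.aeval (fun l => s^[i + 1] (a l)) c * f, I.mul_mem_left _ hf,
      Subalgebra.mul_mem _ ?_ hf', ?_⟩
    · have : (MvPolynomial.aeval (R := k) fun l => s^[i + 1] (a l)).range ≤
          stage k s a (i + 1) := by
        rw [← Algebra.adjoin_range_eq_range_aeval]
        exact adjoin_le_stage le_rfl
      exact this ⟨c, rfl⟩
    · rw [smul_eq_mul, map_mul, ← mul_sub]
      exact Ideal.mul_mem_left _ _ hpf

lemma IsHopfShift.map_symbolIdeal_le (hs : IsHopfShift σ s) {I : Ideal A} (hI : ∀ f ∈ I, s f ∈ I)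
    (i : ℕ) :
    (symbolIdeal k s a I i).map (MvPolynomial.map σ) ≤ symbolIdeal k s a I (i + 1) := by
  rw [Ideal.map_le_iff_le_comap]
  rintro p ⟨f, hf, hf', hpf⟩
  refine ⟨s f, hI f hf, hs.map_mem_stage hf', ?_⟩
  simp only [Function.iterate_succ_apply' s (i + 1), hs.aeval_map, ← map_sub]
  exact hs.map_mem_augIdeal (fun b hb => hs.map_mem_stage hb) hpf

end Stage

/-- In a Hopf algebra that is finitely generated as an algebra with endomorphism `s`, every
`s`-stable Hopf ideal is finitely generated as an `s`-stable ideal. The symbol ideals are eventually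
transforms of each other; together with `IsHopfShift.mem_of_forall_point` this shows that an
`s`-stable ideal containing the elements of `I` of sufficiently large bounded order contains `I`. -/
theorem IsHopfShift.exists_finite_generators (hs : IsHopfShift σ s) {I : Ideal A} [I.IsHopfIdeal k]
    (hI : ∀ f ∈ I, s f ∈ I) {X : Set A} (hX : X.Finite)
    (hgen : ∀ C : Subalgebra k A, X ⊆ C → (∀ b ∈ C, s b ∈ C) → C = ⊤) :
    ∃ F : Set A, F.Finite ∧ F ⊆ I ∧ ∀ J : Ideal A, F ⊆ J → (∀ f ∈ J, s f ∈ J) → I ≤ J := by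
  -- enlarge the generators to generators of a Hopf subalgebra
  obtain ⟨A₀, -, ⟨T, hT⟩, hXA, hA₀⟩ :=
    (isHopfSubalgebra_top (k := k) (A := A)).exists_fg_of_finite hX (fun _ _ => Algebra.mem_top)
  let a : T → A := Subtype.val
  have hrange : Algebra.adjoin k (Set.range a) = A₀ := by
    rw [Subtype.range_coe]; exact hT
  have ha : IsHopfSubalgebra (Algebra.adjoin k (Set.range a)) := by rwa [hrange]
  have hmem := hs.exists_mem_stage (a := a) fun C hC hsC => hgen C (fun x hx => by
    have h1 : A₀ ≤ C := by rw [← hrange]; exact Algebra.adjoin_le hC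
    exact h1 (hXA hx)) hsC
  -- from order `m + 1` on the symbol ideals are generated by transforms; the elements of `I` in
  -- this stage form a finitely generated ideal
  obtain ⟨m, hm⟩ := exists_map_eq_of_map_le σ (symbolIdeal k s a I) (hs.map_symbolIdeal_le hI)
  have hft : Algebra.FiniteType k (stage k s a (m + 1)) :=
    (stage k s a (m + 1)).fg_iff_finiteType.1 (stage_fg _)
  have hnoeth : IsNoetherianRing (stage k s a (m + 1)) :=
    Algebra.FiniteType.isNoetherianRing k _
  obtain ⟨G, hG⟩ := (I.comap (stage k s a (m + 1)).val).fg_of_isNoetherianRing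
  refine ⟨(stage k s a (m + 1)).val '' G, G.finite_toSet.image _, ?_, fun J hFJ hJ => ?_⟩
  · rintro _ ⟨b, hb, rfl⟩
    have : b ∈ I.comap (stage k s a (m + 1)).val := by
      rw [← hG]; exact Ideal.subset_span hb
    exact this
  have key : ∀ i ≥ m, ∀ f ∈ I, f ∈ stage k s a (i + 1) → f ∈ J := by
    intro i hi
    induction i, hi using Nat.le_induction with
    | base =>
      intro f hfI hf
      have h1 : I.comap (stage k s a (m + 1)).val ≤ J.comap (stage k s a (m + 1)).val := by
        rw [← hG]
        exact Ideal.span_le.2 fun b hb => hFJ ⟨b, hb, rfl⟩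
      exact h1 (show (⟨f, hf⟩ : stage k s a (m + 1)) ∈ _ from hfI)
    | succ i hi ih =>
      refine hs.mem_of_forall_point hI (hs.isHopfSubalgebra_stage ha (i + 1))
        (hs.isHopfSubalgebra_stage ha (i + 1 + 1)) hJ ih fun R _ _ u hu1 hu2 f hfI hf => ?_
      -- the symbol of `f` is a combination of transforms of symbols of lower order
      obtain ⟨p, hp⟩ := exists_aeval_sub_mem_augIdeal hf
      have hpI : p ∈ symbolIdeal k s a I (i + 1) := ⟨f, hfI, hf, hp⟩
      rw [hm i hi] at hpI
      -- `u` vanishes on the values of the generators of the symbol ideal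
      have hker : (symbolIdeal k s a I i).map (MvPolynomial.map σ) ≤ RingHom.ker
          (u.hom.comp (MvPolynomial.aeval (R := k) fun l => s^[i + 1 + 1] (a l))) := by
        rw [Ideal.map_le_iff_le_comap]
        rintro q ⟨g, hgI, hg, hqg⟩
        change u (MvPolynomial.aeval (fun l => s^[i + 1 + 1] (a l)) (MvPolynomial.map σ q)) = 0
        simp only [Function.iterate_succ_apply' s (i + 1), hs.aeval_map]
        have h1 := hu1 _ (hs.map_mem_augIdeal (C := stage k s a (i + 1))
          (fun b hb => hs.map_mem_stage hb) hqg)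
        rwa [map_sub, map_sub, hu2 g hgI hg, sub_zero] at h1
      have h2 : u (MvPolynomial.aeval (fun l => s^[i + 1 + 1] (a l)) p) = 0 := hker hpI
      have h3 := hu1 _ hp
      rwa [map_sub, h2, zero_sub, neg_eq_zero] at h3
  intro f hf
  obtain ⟨i, hi⟩ := hmem f
  exact key (max m i) (le_max_left _ _) f hf
    (stage_mono ((le_max_right m i).trans (Nat.le_succ _)) hi)

variable {I : Ideal A} [I.IsHopfIdeal k]

/-- `f` is invariant if and only if `Δ f - f ⊗ 1` lies in `A ⊗ I`. In this form invariance is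
visibly preserved by a compatible endomorphism. -/
lemma mem_invariants_iff_comul {f : A} : f ∈ invariants k I ↔
    ∃ (n : ℕ) (x y : Fin n → A), (∀ i, y i ∈ I) ∧
      comul (R := k) f = f ⊗ₜ[k] 1 + ∑ i, x i ⊗ₜ[k] y i := by
  constructor
  · intro hf
    let π : A →ₗ[k] A ⧸ I := (Ideal.Quotient.mkₐ k I).toLinearMap
    have hπ : Function.Exact (I.restrictScalars k).subtype π := fun x => by
      change Ideal.Quotient.mk I x = 0 ↔ _
      rw [Ideal.Quotient.eq_zero_iff_mem]
      exact ⟨fun h => ⟨⟨x, h⟩, rfl⟩, by rintro ⟨y, rfl⟩; exact y.2⟩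
    have h1 := hf (A ⊗[k] (A ⧸ I)) (Pt.inl k A _)
      (Pt.map Algebra.TensorProduct.includeRight (Pt.quot I))
      (map_mem_closedSubgroup (fun f hf => Pt.quot_eq_zero hf) _)
    have h2 : ∀ z : A ⊗[k] A, Algebra.TensorProduct.lift (Pt.inl k A (A ⧸ I)).hom
        (Pt.map Algebra.TensorProduct.includeRight (Pt.quot I)).hom (fun _ _ => .all ..) z =
        π.lTensor A z := by
      intro z
      induction z with
      | zero => simp
      | add z w hz hw => simp only [map_add, hz, hw]
      | tmul z w =>
        rw [Algebra.TensorProduct.lift_tmul]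
        change (z ⊗ₜ 1) * (1 ⊗ₜ Ideal.Quotient.mk I w) = z ⊗ₜ[k] Ideal.Quotient.mk I w
        simp
    rw [Pt.mul_apply, h2] at h1
    have h3 : π.lTensor A (comul f - f ⊗ₜ[k] 1) = 0 := by
      rw [map_sub, h1, sub_eq_zero]
      rfl
    obtain ⟨w, hw⟩ := (lTensor_exact A hπ Ideal.Quotient.mk_surjective _).1 h3
    obtain ⟨n, x, y, -, rfl⟩ := exists_sum_tmul_linearIndependent w
    refine ⟨n, x, fun i => y i, fun i => (y i).2, ?_⟩
    rw [← sub_eq_iff_eq_add', ← hw, map_sum]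
    rfl
  · rintro ⟨n, x, y, hy, hxy⟩ R _ _ g m hm
    rw [Pt.mul_apply, hxy, map_add, map_sum, Algebra.TensorProduct.lift_tmul]
    simp [hm _ (hy _)]

lemma IsHopfShift.map_mem_invariants (hs : IsHopfShift σ s) (hI : ∀ f ∈ I, s f ∈ I) {f : A}
    (hf : f ∈ invariants k I) : s f ∈ invariants k I := by
  obtain ⟨n, x, y, hy, hxy⟩ := mem_invariants_iff_comul.1 hf
  refine mem_invariants_iff_comul.2 ⟨n, fun i => s (x i), fun i => s (y i),
    fun i => hI _ (hy i), ?_⟩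
  have := hs.comul_eq (ι := Option (Fin n)) (f := f) (x := fun o => o.elim f x)
    (y := fun o => o.elim 1 y) (by simp [hxy])
  simpa using this

/-- The invariants of an `s`-stable normal Hopf ideal are finitely generated as an algebra with
endomorphism: finitely many invariants suffice to generate the ideal, and a Hopf subalgebra is
determined by the ideal it generates. -/
theorem IsHopfShift.exists_finite_generators_invariants (hs : IsHopfShift σ s)
    (hI : ∀ f ∈ I, s f ∈ I) (hIn : IsNormalIdeal k I) {X : Set A} (hX : X.Finite)
    (hgen : ∀ C : Subalgebra k A, X ⊆ C → (∀ b ∈ C, s b ∈ C) → C = ⊤) :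
    ∃ Y : Set A, Y.Finite ∧ Y ⊆ invariants k I ∧
      ∀ C : Subalgebra k A, Y ⊆ C → (∀ b ∈ C, s b ∈ C) → invariants k I ≤ C := by
  obtain ⟨F, hF, hFI, hFJ⟩ := hs.exists_finite_generators hI hX hgen
  have hspan : F ⊆ Ideal.span {b | b ∈ invariants k I ∧ counit (R := k) b = 0} :=
    hFI.trans hIn.le_augIdeal_invariants
  obtain ⟨E, hE, hFE⟩ := Submodule.subset_span_finite_of_subset_span
    (t := hF.toFinset) (by rwa [Set.Finite.coe_toFinset])
  have hB := isHopfSubalgebra_invariants hIn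
  obtain ⟨B₀, hB₀, ⟨T, hT⟩, hEB₀, hB₀h⟩ := hB.exists_fg_of_finite E.finite_toSet
    fun b hb => (hE hb).1
  let a : T → A := Subtype.val
  have hrange : Algebra.adjoin k (Set.range a) = B₀ := by
    rw [Subtype.range_coe]; exact hT
  refine ⟨T, T.finite_toSet, fun t ht => hB₀ (hT ▸ Algebra.subset_adjoin ht),
    fun C hTC hC f hf => ?_⟩
  -- the `s`-stable subalgebra generated by `T` is a Hopf subalgebra that generates the ideal `I`
  have hB' : IsHopfSubalgebra (⨆ i, stage k s a i) :=
    IsHopfSubalgebra.iSup fun i => hs.isHopfSubalgebra_stage (by rwa [hrange]) i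
  have hsB' : ∀ b ∈ ⨆ i, stage k s a i, s b ∈ ⨆ i, stage k s a i := by
    have : ⨆ i, stage k s a i ≤ hs.comap (⨆ i, stage k s a i) :=
      iSup_le fun i b hb => le_iSup (stage k s a) (i + 1) (hs.map_mem_stage hb)
    exact this
  have hB'C : ⨆ i, stage k s a i ≤ C := by
    refine iSup_le fun i => iSup_le fun j => Algebra.adjoin_le ?_
    rintro _ ⟨l, rfl⟩
    induction (j : ℕ) with
    | zero => exact hTC l.2
    | succ j ih =>
      change s^[j + 1] (a l) ∈ C
      rw [Function.iterate_succ_apply']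
      exact hC _ ih
  have hI' : I ≤ augIdeal (⨆ i, stage k s a i) := by
    refine hFJ _ (fun x hx => ?_) fun f hf => hs.map_mem_augIdeal hsB' hf
    have hx' : x ∈ Ideal.span (E : Set A) := hFE (by rwa [Set.Finite.coe_toFinset])
    refine (Ideal.span_mono fun e he => ?_ : Ideal.span (E : Set A) ≤ augIdeal _) hx'
    refine ⟨?_, (hE he).2⟩
    have h1 : B₀ ≤ stage k s a 0 := by
      rw [← hrange]
      exact adjoin_le_stage (s := s) (a := a) (i := 0) (j := 0) le_rfl
    exact le_iSup (stage k s a) 0 (h1 (hEB₀ he))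
  exact hB'C (hB'.mem_of_invariant fun R _ _ g x hx =>
    hf R g x fun b hb => forall_augIdeal_iff.2 hx b (hI' hb))

end Finiteness

end AffineGroup

/-! ### Constructions with difference algebras -/

namespace DiffAlg

variable {k : Type u} [Field k] {σ : k →+* k}

lemma hom_ext {A B : DiffAlg k σ} {f g : A ⟶ B} (h : ∀ a, f.toAlgHom a = g.toAlgHom a) : f = g :=
  Hom.ext (AlgHom.ext h)

@[simp] lemma comp_toAlgHom {A B C : DiffAlg k σ} (f : A ⟶ B) (g : B ⟶ C) :
    (f ≫ g).toAlgHom = g.toAlgHom.comp f.toAlgHom := rfl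

lemma shift_smul (A : DiffAlg k σ) (c : k) (a : A) : A.shift (c • a) = σ c • A.shift a := by
  rw [Algebra.smul_def, map_mul, A.shift_algebraMap, ← Algebra.smul_def]

/-- The endomorphism of a `k`-`σ`-algebra as a semilinear map. -/
def shiftₛₗ (A : DiffAlg k σ) : A →ₛₗ[σ] A where
  toFun := A.shift
  map_add' := map_add _
  map_smul' := A.shift_smul

/-- The base field as a `k`-`σ`-algebra. -/
def base (σ : k →+* k) : DiffAlg k σ where
  carrier := k
  shift := σ
  shift_algebraMap _ := rfl

/-- The tensor product of `k`-`σ`-algebras. -/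
noncomputable def tensor (A B : DiffAlg k σ) : DiffAlg k σ where
  carrier := A ⊗[k] B
  shift :=
    { toFun := TensorProduct.map A.shiftₛₗ B.shiftₛₗ
      map_zero' := map_zero _
      map_add' := map_add _
      map_one' := by
        change (A.shift 1) ⊗ₜ[k] (B.shift 1) = 1
        rw [map_one, map_one]; rfl
      map_mul' := fun x y => by
        induction x with
        | zero => simp
        | add x x' hx hx' => rw [add_mul, map_add, map_add, add_mul, hx, hx']
        | tmul a b =>
          induction y with
          | zero => simp
          | add y y' hy hy' => rw [mul_add, map_add, map_add, mul_add, hy, hy']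
          | tmul a' b' =>
            rw [Algebra.TensorProduct.tmul_mul_tmul]
            change (A.shift (a * a')) ⊗ₜ[k] (B.shift (b * b')) =
              (A.shift a ⊗ₜ B.shift b) * (A.shift a' ⊗ₜ B.shift b')
            rw [map_mul, map_mul, Algebra.TensorProduct.tmul_mul_tmul] }
  shift_algebraMap c := by
    change A.shift (algebraMap k A c) ⊗ₜ[k] B.shift 1 = (algebraMap k A (σ c)) ⊗ₜ 1
    rw [A.shift_algebraMap, map_one]

lemma tensor_shift_tmul (A B : DiffAlg k σ) (a : A) (b : B) :
    (tensor A B).shift (a ⊗ₜ[k] b) = A.shift a ⊗ₜ[k] B.shift b := rfl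

/-- The first coprojection of the tensor product. -/
noncomputable def inl (A B : DiffAlg k σ) : A ⟶ tensor A B where
  toAlgHom := (Algebra.TensorProduct.includeLeft : A →ₐ[k] A ⊗[k] B)
  map_shift a := by
    change A.shift a ⊗ₜ[k] (1 : B) = A.shift a ⊗ₜ[k] B.shift 1
    rw [map_one]

/-- The second coprojection of the tensor product. -/
noncomputable def inr (A B : DiffAlg k σ) : B ⟶ tensor A B where
  toAlgHom := (Algebra.TensorProduct.includeRight : B →ₐ[k] A ⊗[k] B)
  map_shift b := by
    change (1 : A) ⊗ₜ[k] B.shift b = A.shift 1 ⊗ₜ[k] B.shift b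
    rw [map_one]

/-- The universal property of the tensor product as a coproduct. -/
noncomputable def lift {A B C : DiffAlg k σ} (f : A ⟶ C) (g : B ⟶ C) : tensor A B ⟶ C where
  toAlgHom := (Algebra.TensorProduct.lift f.toAlgHom g.toAlgHom (fun _ _ => .all ..) :
    A ⊗[k] B →ₐ[k] C)
  map_shift z := by
    let F : A ⊗[k] B →ₐ[k] C :=
      Algebra.TensorProduct.lift f.toAlgHom g.toAlgHom (fun _ _ => .all ..)
    refine TensorProduct.induction_on (motive := fun z : A ⊗[k] B =>
      F ((tensor A B).shift z) = C.shift (F z)) z ?_ (fun a b => ?_) (fun z w hz hw => ?_)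
    · have h0 : (tensor A B).shift 0 = 0 := map_zero (tensor A B).shift
      rw [map_zero, map_zero]
      exact (congrArg F h0).trans (map_zero F)
    · rw [tensor_shift_tmul, Algebra.TensorProduct.lift_tmul, Algebra.TensorProduct.lift_tmul,
        f.map_shift, g.map_shift, map_mul]
    · have h1 : (tensor A B).shift (z + w) = (tensor A B).shift z + (tensor A B).shift w :=
        map_add (tensor A B).shift z w
      rw [map_add, map_add, ← hz, ← hw, h1]
      exact map_add F _ _

lemma inl_lift {A B C : DiffAlg k σ} (f : A ⟶ C) (g : B ⟶ C) : inl A B ≫ lift f g = f :=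
  hom_ext fun a => by
    change Algebra.TensorProduct.lift f.toAlgHom g.toAlgHom (fun _ _ => .all ..)
      (a ⊗ₜ[k] (1 : B)) = _
    rw [Algebra.TensorProduct.lift_tmul, map_one, mul_one]

lemma inr_lift {A B C : DiffAlg k σ} (f : A ⟶ C) (g : B ⟶ C) : inr A B ≫ lift f g = g :=
  hom_ext fun b => by
    change Algebra.TensorProduct.lift f.toAlgHom g.toAlgHom (fun _ _ => .all ..)
      ((1 : A) ⊗ₜ[k] b) = _
    rw [Algebra.TensorProduct.lift_tmul, map_one, one_mul]

/-- The quotient of a `k`-`σ`-algebra by a `σ`-stable ideal. -/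
def quotient (A : DiffAlg k σ) (I : Ideal A) (hI : ∀ f ∈ I, A.shift f ∈ I) : DiffAlg k σ where
  carrier := A ⧸ I
  shift := Ideal.quotientMap I A.shift hI
  shift_algebraMap c := congrArg (Ideal.Quotient.mk I) (A.shift_algebraMap c)

/-- The projection to the quotient by a `σ`-stable ideal. -/
def quotientHom (A : DiffAlg k σ) (I : Ideal A) (hI : ∀ f ∈ I, A.shift f ∈ I) :
    A ⟶ A.quotient I hI where
  toAlgHom := Ideal.Quotient.mkₐ k I
  map_shift _ := rfl

/-- A `σ`-stable subalgebra. -/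
def ofSubalgebra (A : DiffAlg k σ) (B : Subalgebra k A) (hB : ∀ b ∈ B, A.shift b ∈ B) :
    DiffAlg k σ where
  carrier := B
  shift := A.shift.restrict B B hB
  shift_algebraMap c := Subtype.ext (A.shift_algebraMap c)

lemma subset_adjoin (A : DiffAlg k σ) (S : Set A) : S ⊆ A.adjoin S := fun _ hs =>
  Algebra.mem_sInf.2 fun _ hB => hB.1 hs

lemma shift_mem_adjoin (A : DiffAlg k σ) {S : Set A} {a : A} (ha : a ∈ A.adjoin S) :
    A.shift a ∈ A.adjoin S :=
  Algebra.mem_sInf.2 fun _ hB => hB.2 _ (Algebra.mem_sInf.1 ha _ hB)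

lemma adjoin_le (A : DiffAlg k σ) {S : Set A} {B : Subalgebra k A} (hS : S ⊆ B)
    (hB : ∀ b ∈ B, A.shift b ∈ B) : A.adjoin S ≤ B := sInf_le ⟨hS, hB⟩

end DiffAlg

namespace DiffAlgGroup

variable {k : Type u} [Field k] {σ : k →+* k} (G : DiffAlgGroup k σ)

/-- The point of `G(R)` corresponding to a morphism `k{G} ⟶ R`. -/
def ofHom {R : DiffAlg k σ} (f : G.coordRing ⟶ R) : G.points R := G.corep.homEquiv f

@[simp] lemma pointHom_ofHom {R : DiffAlg k σ} (f : G.coordRing ⟶ R) :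
    G.pointHom (G.ofHom f) = f := G.corep.homEquiv.symm_apply_apply f

@[simp] lemma ofHom_pointHom {R : DiffAlg k σ} (g : G.points R) :
    G.ofHom (G.pointHom g) = g := G.corep.homEquiv.apply_symm_apply g

lemma pointHom_injective {R : DiffAlg k σ} :
    Function.Injective (G.pointHom : G.points R → (G.coordRing ⟶ R)) :=
  G.corep.homEquiv.symm.injective

lemma pointHom_map {R S : DiffAlg k σ} (φ : R ⟶ S) (g : G.points R) :
    G.pointHom ((G.functor.map φ).hom g) = G.pointHom g ≫ φ :=
  (G.corep.homEquiv_symm_comp g φ).symm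

lemma map_ofHom {R S : DiffAlg k σ} (φ : R ⟶ S) (f : G.coordRing ⟶ R) :
    (G.functor.map φ).hom (G.ofHom f) = G.ofHom (f ≫ φ) :=
  G.pointHom_injective (by rw [pointHom_map, pointHom_ofHom, pointHom_ofHom])

/-- The comultiplication of `k{G}`: the product of the two universal points over the tensor
product. -/
noncomputable def comulHom : G.coordRing ⟶ DiffAlg.tensor G.coordRing G.coordRing :=
  G.pointHom (G.ofHom (DiffAlg.inl _ _) * G.ofHom (DiffAlg.inr _ _))

/-- The counit of `k{G}`: the identity element of `G(k)`. -/
noncomputable def counitHom : G.coordRing ⟶ DiffAlg.base σ := G.pointHom 1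

/-- The antipode of `k{G}`: the inverse of the universal point. -/
noncomputable def antipodeHom : G.coordRing ⟶ G.coordRing := G.pointHom (G.ofHom (𝟙 _))⁻¹

lemma comulHom_lift {R : DiffAlg k σ} (g h : G.points R) :
    G.comulHom ≫ DiffAlg.lift (G.pointHom g) (G.pointHom h) = G.pointHom (g * h) := by
  rw [comulHom, ← pointHom_map, map_mul, map_ofHom, map_ofHom, DiffAlg.inl_lift,
    DiffAlg.inr_lift, ofHom_pointHom, ofHom_pointHom]

lemma antipodeHom_comp {R : DiffAlg k σ} (g : G.points R) :
    G.antipodeHom ≫ G.pointHom g = G.pointHom g⁻¹ := by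
  rw [antipodeHom, ← pointHom_map, map_inv, map_ofHom, Category.id_comp, ofHom_pointHom]

lemma pointHom_one_apply (R : DiffAlg k σ) (f : G.coordRing) :
    (G.pointHom (1 : G.points R)).toAlgHom f =
      algebraMap k R (G.counitHom.toAlgHom f : k) := by
  let ι : DiffAlg.base σ ⟶ R :=
    { toAlgHom := (Algebra.ofId k R : k →ₐ[k] R)
      map_shift := fun a => (R.shift_algebraMap a).symm }
  have h : G.counitHom ≫ ι = G.pointHom 1 := by
    rw [counitHom, ← pointHom_map, map_one]
  rw [← h]
  rfl

lemma pointHom_mul_apply {R : DiffAlg k σ} (g h : G.points R) (f : G.coordRing) :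
    (G.pointHom (g * h)).toAlgHom f = Algebra.TensorProduct.lift (G.pointHom g).toAlgHom
      (G.pointHom h).toAlgHom (fun _ _ => .all ..) (G.comulHom.toAlgHom f) := by
  rw [← comulHom_lift]
  rfl

end DiffAlgGroup

/-! ### The Hopf algebra structure on the coordinate ring -/

namespace DiffAlgGroup

open AffineGroup

variable {k : Type u} [Field k] {σ : k →+* k} (G : DiffAlgGroup k σ)

/-- The comultiplication as a map to the plain tensor product, which is the carrier of
`DiffAlg.tensor` only up to unfolding. -/
noncomputable def comulₐ : G.coordRing →ₐ[k] G.coordRing ⊗[k] G.coordRing := G.comulHom.toAlgHom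

/-- The counit as a map to the plain base field, which is the carrier of `DiffAlg.base` only up to
unfolding. -/
noncomputable def counitₐ : G.coordRing →ₐ[k] k := G.counitHom.toAlgHom

lemma pointHom_mul_apply_of_tmul {R : DiffAlg k σ} {g h : G.points R}
    {F : G.coordRing ⊗[k] G.coordRing →ₐ[k] R}
    (hF : ∀ a b, F (a ⊗ₜ b) = (G.pointHom g).toAlgHom a * (G.pointHom h).toAlgHom b)
    (f : G.coordRing) : (G.pointHom (g * h)).toAlgHom f = F (G.comulₐ f) := by
  have h1 : F = Algebra.TensorProduct.lift (G.pointHom g).toAlgHom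
      (G.pointHom h).toAlgHom (fun _ _ => .all ..) :=
    AlgHom.toLinearMap_injective (TensorProduct.ext' fun a b => by simp [hF])
  rw [h1]
  exact G.pointHom_mul_apply g h f

lemma comulₐ_coassoc (f : G.coordRing) :
    Algebra.TensorProduct.assoc k k k G.coordRing G.coordRing G.coordRing
      (Algebra.TensorProduct.map G.comulₐ (.id k G.coordRing) (G.comulₐ f)) =
        Algebra.TensorProduct.map (.id k G.coordRing) G.comulₐ (G.comulₐ f) := by
  let A := G.coordRing
  -- associativity of the product of the three universal points
  let i₁ := DiffAlg.inl A (DiffAlg.tensor A A)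
  let i₂ := DiffAlg.inl A A ≫ DiffAlg.inr A (DiffAlg.tensor A A)
  let i₃ := DiffAlg.inr A A ≫ DiffAlg.inr A (DiffAlg.tensor A A)
  have h12 : G.pointHom (G.ofHom i₁ * G.ofHom i₂) = G.comulHom ≫ DiffAlg.lift i₁ i₂ := by
    rw [← pointHom_ofHom G i₁, ← pointHom_ofHom G i₂, comulHom_lift, pointHom_ofHom,
      pointHom_ofHom]
  have h23 : G.pointHom (G.ofHom i₂ * G.ofHom i₃) =
      G.comulHom ≫ DiffAlg.inr A (DiffAlg.tensor A A) := by
    rw [comulHom, ← pointHom_map, map_mul, map_ofHom, map_ofHom]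
  let L : A ⊗[k] A →ₐ[k] A ⊗[k] (A ⊗[k] A) :=
    (Algebra.TensorProduct.assoc k k k A A A).toAlgHom.comp
      (Algebra.TensorProduct.map G.comulₐ (.id k A))
  have hL := G.pointHom_mul_apply_of_tmul (R := DiffAlg.tensor A (DiffAlg.tensor A A))
    (g := G.ofHom i₁ * G.ofHom i₂) (h := G.ofHom i₃) (F := L) (fun a b => by
      rw [h12, pointHom_ofHom]
      have h1 : ∀ w : A ⊗[k] A, Algebra.TensorProduct.assoc k k k A A A (w ⊗ₜ b) =
          (Algebra.TensorProduct.lift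
            (Algebra.TensorProduct.includeLeft : A →ₐ[k] A ⊗[k] (A ⊗[k] A))
            ((Algebra.TensorProduct.includeRight : A ⊗[k] A →ₐ[k] A ⊗[k] (A ⊗[k] A)).comp
              Algebra.TensorProduct.includeLeft) (fun _ _ => .all ..) w) *
            ((1 : A) ⊗ₜ[k] ((1 : A) ⊗ₜ[k] b)) := by
        intro w
        induction w with
        | zero => simp
        | add z w hz hw => simp only [map_add, add_mul, add_tmul, hz, hw]
        | tmul x y => simp
      exact h1 (G.comulₐ a)) f
  have hR := G.pointHom_mul_apply_of_tmul (R := DiffAlg.tensor A (DiffAlg.tensor A A))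
    (g := G.ofHom i₁) (h := G.ofHom i₂ * G.ofHom i₃)
    (F := (Algebra.TensorProduct.map (.id k A) G.comulₐ : A ⊗[k] A →ₐ[k] A ⊗[k] (A ⊗[k] A)))
    (fun a b => by
      rw [h23, pointHom_ofHom]
      have h1 : a ⊗ₜ[k] G.comulₐ b = (a ⊗ₜ[k] (1 : A ⊗[k] A)) * ((1 : A) ⊗ₜ[k] G.comulₐ b) := by
        simp
      exact h1) f
  rw [← mul_assoc] at hR
  exact hL.symm.trans hR

lemma map_counitₐ_left (f : G.coordRing) :
    Algebra.TensorProduct.map G.counitₐ (.id k G.coordRing) (G.comulₐ f) = 1 ⊗ₜ f := by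
  have h := G.pointHom_mul_apply_of_tmul (R := DiffAlg.tensor (DiffAlg.base σ) G.coordRing)
    (g := 1) (h := G.ofHom (DiffAlg.inr (DiffAlg.base σ) G.coordRing))
    (F := (Algebra.TensorProduct.map G.counitₐ (.id k G.coordRing) :
      G.coordRing ⊗[k] G.coordRing →ₐ[k] k ⊗[k] G.coordRing)) (fun a b => by
      rw [pointHom_one_apply, pointHom_ofHom]
      have h1 : G.counitₐ a ⊗ₜ[k] b =
          (G.counitₐ a ⊗ₜ[k] (1 : G.coordRing)) * ((1 : k) ⊗ₜ[k] b) := by simp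
      exact h1) f
  rw [one_mul, pointHom_ofHom] at h
  exact h.symm

lemma map_counitₐ_right (f : G.coordRing) :
    Algebra.TensorProduct.map (.id k G.coordRing) G.counitₐ (G.comulₐ f) = f ⊗ₜ 1 := by
  have h := G.pointHom_mul_apply_of_tmul (R := DiffAlg.tensor G.coordRing (DiffAlg.base σ))
    (g := G.ofHom (DiffAlg.inl G.coordRing (DiffAlg.base σ))) (h := 1)
    (F := (Algebra.TensorProduct.map (.id k G.coordRing) G.counitₐ :
      G.coordRing ⊗[k] G.coordRing →ₐ[k] G.coordRing ⊗[k] k)) (fun a b => by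
      rw [pointHom_one_apply, pointHom_ofHom]
      have h1 : a ⊗ₜ[k] G.counitₐ b =
          (a ⊗ₜ[k] (1 : k)) * (algebraMap k (G.coordRing ⊗[k] k) (G.counitₐ b)) := by
        rw [← Algebra.commutes, ← Algebra.smul_def, ← tmul_smul, smul_eq_mul, mul_one]
      exact h1) f
  rw [mul_one, pointHom_ofHom] at h
  exact h.symm

/-- The bialgebra structure on the coordinate ring. -/
noncomputable instance : Bialgebra k G.coordRing :=
  Bialgebra.ofAlgHom G.comulₐ G.counitₐ (AlgHom.ext G.comulₐ_coassoc)
    (AlgHom.ext G.map_counitₐ_left) (AlgHom.ext G.map_counitₐ_right)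

/-- The Hopf algebra structure on the coordinate ring. -/
noncomputable instance : HopfAlgebra k G.coordRing :=
  HopfAlgebra.ofAlgHom G.antipodeHom.toAlgHom
    (AlgHom.ext fun f => by
      have h := G.pointHom_mul_apply (G.ofHom (𝟙 _))⁻¹ (G.ofHom (𝟙 G.coordRing)) f
      rw [inv_mul_cancel, pointHom_one_apply, pointHom_ofHom] at h
      exact h.symm)
    (AlgHom.ext fun f => by
      have h := G.pointHom_mul_apply (G.ofHom (𝟙 G.coordRing)) (G.ofHom (𝟙 _))⁻¹ f
      rw [mul_inv_cancel, pointHom_one_apply, pointHom_ofHom] at h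
      exact h.symm)

/-- The point of the affine group scheme underlying `G` that is defined by a point of `G`: the
endomorphisms of `k{G}` and `R` are forgotten. -/
noncomputable def toPt {R : DiffAlg k σ} : G.points R →* Pt k G.coordRing R where
  toFun g := Pt.mk (G.pointHom g).toAlgHom
  map_one' := Pt.ext' fun f => G.pointHom_one_apply R f
  map_mul' g h := Pt.ext' fun f => by
    rw [Pt.mul_apply]
    exact G.pointHom_mul_apply g h f

lemma toPt_apply {R : DiffAlg k σ} (g : G.points R) (f : G.coordRing) :
    G.toPt g f = G.eval f g := rfl

lemma eval_injective {R : DiffAlg k σ} {g h : G.points R}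
    (H : ∀ f, G.eval f g = G.eval f h) : g = h :=
  G.pointHom_injective (DiffAlg.hom_ext H)

lemma eval_ofHom {R : DiffAlg k σ} (φ : G.coordRing ⟶ R) (f : G.coordRing) :
    G.eval f (G.ofHom φ) = φ.toAlgHom f := by
  rw [eval, pointHom_ofHom]

lemma isHopfShift : IsHopfShift σ G.coordRing.shift where
  map_algebraMap := G.coordRing.shift_algebraMap
  comul_eq {ι _ f x y} h := by
    refine (G.comulHom.map_shift f).trans ?_
    change TensorProduct.map G.coordRing.shiftₛₗ G.coordRing.shiftₛₗ (comul f) = _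
    rw [h, map_sum]
    rfl
  counit_eq f := G.counitHom.map_shift f
  antipode_eq f := G.antipodeHom.map_shift f

end DiffAlgGroup

/-! ### The vanishing ideal of a closed subgroup -/

namespace DiffAlgGroup

open AffineGroup

variable {k : Type u} [Field k] {σ : k →+* k} {G : DiffAlgGroup k σ}

lemma eval_map {R S : DiffAlg k σ} (φ : R ⟶ S) (g : G.points R) (f : G.coordRing) :
    G.eval f ((G.functor.map φ).hom g) = φ.toAlgHom (G.eval f g) := by
  rw [eval, pointHom_map]
  rfl

namespace ClosedSubgroup

variable (N : G.ClosedSubgroup)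

lemma map_mem {R S : DiffAlg k σ} (φ : R ⟶ S) {g : G.points R} (hg : g ∈ N.subgroup R) :
    (G.functor.map φ).hom g ∈ N.subgroup S := by
  obtain ⟨F, hF⟩ := N.isClosed
  refine (hF S _).2 fun f hf => ?_
  rw [eval_map, (hF R g).1 hg f hf, map_zero]

/-- The ideal of all functions vanishing on a closed subgroup. -/
def vanishingIdeal : Ideal G.coordRing where
  carrier := {f | ∀ (R : DiffAlg k σ) (g : G.points R), g ∈ N.subgroup R → G.eval f g = 0}
  zero_mem' R g _ := map_zero (G.pointHom g).toAlgHom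
  add_mem' {a b} ha hb R g hg := by
    rw [eval, map_add]
    exact (congrArg₂ (· + ·) (ha R g hg) (hb R g hg)).trans (add_zero 0)
  smul_mem' c a ha R g hg := by
    rw [eval, smul_eq_mul, map_mul]
    exact (congrArg (_ * ·) (ha R g hg)).trans (mul_zero _)

variable {N}

lemma mem_subgroup_iff {R : DiffAlg k σ} {g : G.points R} :
    g ∈ N.subgroup R ↔ ∀ f ∈ N.vanishingIdeal, G.eval f g = 0 := by
  refine ⟨fun hg f hf => hf R g hg, fun h => ?_⟩
  obtain ⟨F, hF⟩ := N.isClosed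
  exact (hF R g).2 fun f hf => h f fun S g' hg' => (hF S g').1 hg' f hf

lemma shift_mem_vanishingIdeal {f : G.coordRing} (hf : f ∈ N.vanishingIdeal) :
    G.coordRing.shift f ∈ N.vanishingIdeal := fun R g hg => by
  rw [eval, (G.pointHom g).map_shift]
  exact (congrArg R.shift (hf R g hg)).trans (map_zero _)

/-- A `σ`-stable ideal whose points are the points of `N` consists of all functions vanishing
on `N`. -/
lemma eq_vanishingIdeal {J : Ideal G.coordRing} (hJ : ∀ f ∈ J, G.coordRing.shift f ∈ J)
    (h : ∀ (R : DiffAlg k σ) (g : G.points R), g ∈ N.subgroup R ↔ ∀ f ∈ J, G.eval f g = 0) :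
    J = N.vanishingIdeal := by
  refine le_antisymm (fun f hf R g hg => (h R g).1 hg f hf) fun f hf => ?_
  have h1 : ∀ f, G.eval f (G.ofHom (G.coordRing.quotientHom J hJ)) = Ideal.Quotient.mk J f :=
    fun f => G.eval_ofHom _ f
  have h2 := hf _ (G.ofHom (G.coordRing.quotientHom J hJ)) ((h _ _).2 fun f hf =>
    (h1 f).trans (Ideal.Quotient.eq_zero_iff_mem.2 hf))
  exact Ideal.Quotient.eq_zero_iff_mem.1 ((h1 f).symm.trans h2)

variable (N) in
/-- The coordinate ring of a closed subgroup. -/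
def coordRing : DiffAlg k σ :=
  G.coordRing.quotient N.vanishingIdeal fun _ => shift_mem_vanishingIdeal

variable (N) in
/-- The universal point of a closed subgroup. -/
def univ : G.points N.coordRing :=
  G.ofHom (G.coordRing.quotientHom N.vanishingIdeal fun _ => shift_mem_vanishingIdeal)

variable (N) in
/-- The restriction of functions from `G` to a closed subgroup. -/
def restrictHom : G.coordRing ⟶ N.coordRing :=
  G.coordRing.quotientHom N.vanishingIdeal fun _ => shift_mem_vanishingIdeal

lemma pointHom_univ : G.pointHom N.univ = N.restrictHom := G.pointHom_ofHom _

lemma eval_univ (f : G.coordRing) :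
    G.eval f N.univ = Ideal.Quotient.mk N.vanishingIdeal f := G.eval_ofHom _ f

lemma univ_mem : N.univ ∈ N.subgroup N.coordRing :=
  mem_subgroup_iff.2 fun f hf => (eval_univ f).trans (Ideal.Quotient.eq_zero_iff_mem.2 hf)

/-- The universal point of `N` and the subgroup property over `N.coordRing` and its tensor square
show that the vanishing ideal is a Hopf ideal. -/
instance : N.vanishingIdeal.IsHopfIdeal k where
  antipode_mem f hf := by
    have h := hf _ _ ((N.subgroup _).inv_mem univ_mem)
    rw [eval, ← antipodeHom_comp] at h
    refine Ideal.Quotient.eq_zero_iff_mem.1 ((eval_univ _).symm.trans h)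
  counit_eq_zero f hf := by
    have h := hf (DiffAlg.base σ) 1 (N.subgroup _).one_mem
    exact h
  map_mkQ_comul_eq_zero f hf := by
    have h := hf (DiffAlg.tensor N.coordRing N.coordRing)
      ((G.functor.map (DiffAlg.inl _ _)).hom N.univ * (G.functor.map (DiffAlg.inr _ _)).hom N.univ)
      ((N.subgroup _).mul_mem (N.map_mem _ univ_mem) (N.map_mem _ univ_mem))
    let F : G.coordRing ⊗[k] G.coordRing →ₐ[k]
        (G.coordRing ⧸ N.vanishingIdeal) ⊗[k] (G.coordRing ⧸ N.vanishingIdeal) :=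
      Algebra.TensorProduct.map (Ideal.Quotient.mkₐ k _) (Ideal.Quotient.mkₐ k _)
    have h1 := G.pointHom_mul_apply_of_tmul
      (R := DiffAlg.tensor N.coordRing N.coordRing)
      (g := (G.functor.map (DiffAlg.inl _ _)).hom N.univ)
      (h := (G.functor.map (DiffAlg.inr _ _)).hom N.univ) (F := F) (fun a b => by
        rw [pointHom_map, pointHom_map, pointHom_univ]
        have h2 : (Ideal.Quotient.mk N.vanishingIdeal a) ⊗ₜ[k]
            (Ideal.Quotient.mk N.vanishingIdeal b) =
            (Ideal.Quotient.mk N.vanishingIdeal a ⊗ₜ[k] 1) *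
              (1 ⊗ₜ[k] Ideal.Quotient.mk N.vanishingIdeal b) := by simp
        exact h2) f
    exact h1.symm.trans h

variable (N) in
/-- The ring over which the universal pair of a point of `G` and a point of `N` is defined. -/
noncomputable def pairRing : DiffAlg k σ := DiffAlg.tensor G.coordRing N.coordRing

variable (N) in
/-- The first member of the universal pair. -/
noncomputable def pairFst : G.points N.pairRing := G.ofHom (DiffAlg.inl _ _)

variable (N) in
/-- The second member of the universal pair. -/
noncomputable def pairSnd : G.points N.pairRing := (G.functor.map (DiffAlg.inr _ _)).hom N.univ

lemma pairSnd_mem : N.pairSnd ∈ N.subgroup N.pairRing := N.map_mem _ univ_mem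

/-- Every pair of points of the underlying group schemes, over a ring without endomorphism, is a
specialization of the universal pair. -/
lemma exists_eq_map_pair {R : Type u} [CommRing R] [Algebra k R] (g n : Pt k G.coordRing R)
    (hn : n ∈ closedSubgroup N.vanishingIdeal R) :
    ∃ φ : N.pairRing →ₐ[k] R, g = Pt.map φ (G.toPt N.pairFst) ∧
      n = Pt.map φ (G.toPt N.pairSnd) := by
  obtain ⟨ψ, rfl⟩ := Pt.exists_map_quot hn
  let φ : G.coordRing ⊗[k] (G.coordRing ⧸ N.vanishingIdeal) →ₐ[k] R :=
    Algebra.TensorProduct.lift g.hom ψ (fun _ _ => .all ..)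
  have h1 : ∀ f, G.toPt N.pairFst f = f ⊗ₜ[k] (1 : G.coordRing ⧸ N.vanishingIdeal) :=
    fun f => G.eval_ofHom _ f
  have h2 : ∀ f, G.toPt N.pairSnd f =
      (1 : G.coordRing) ⊗ₜ[k] Ideal.Quotient.mk N.vanishingIdeal f := fun f => by
    exact (eval_map (DiffAlg.inr _ _) N.univ f).trans (congrArg _ (eval_univ f))
  refine ⟨φ, Pt.ext' fun f => ?_, Pt.ext' fun f => ?_⟩
  · have h3 : φ (f ⊗ₜ[k] 1) = g f := by simp [φ]
    exact h3.symm.trans (congrArg φ (h1 f)).symm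
  · have h3 : φ (1 ⊗ₜ[k] Ideal.Quotient.mk N.vanishingIdeal f) =
      ψ (Ideal.Quotient.mk N.vanishingIdeal f) := by simp [φ]
    exact h3.symm.trans (congrArg φ (h2 f)).symm

/-- A normal closed subgroup has a normal vanishing ideal: by the universal pair, normality over
`k`-`σ`-algebras implies normality over all `k`-algebras. -/
theorem IsNormal.isNormalIdeal (hN : N.IsNormal) : IsNormalIdeal k N.vanishingIdeal := by
  refine fun R _ _ => ⟨fun n hn g f hf => ?_⟩
  obtain ⟨φ, rfl, rfl⟩ := exists_eq_map_pair g n hn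
  rw [← map_mul, ← map_inv, ← map_mul, ← map_mul, ← map_inv, ← map_mul, Pt.map_apply, toPt_apply,
    mem_subgroup_iff.1 ((hN _).conj_mem _ pairSnd_mem N.pairFst) f hf, map_zero]

end ClosedSubgroup

end DiffAlgGroup

/-! ### The group of a Hopf subalgebra -/

namespace AffineGroup

section SubHopf

variable {k A : Type u} [Field k] [CommRing A] [HopfAlgebra k A] {B : Subalgebra k A}

lemma IsHopfSubalgebra.comulHom_eq_sum (hB : IsHopfSubalgebra B) {ι : Type*} [Fintype ι] {b : B}
    {x y : ι → B} (h : comul (R := k) (b : A) = ∑ i, (x i : A) ⊗ₜ[k] (y i : A)) :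
    hB.comulHom b = ∑ i, x i ⊗ₜ[k] y i := by
  apply map_val_injective
  rw [hB.map_comulHom, h, map_sum]
  rfl

lemma IsHopfSubalgebra.comulHom_coassoc (hB : IsHopfSubalgebra B) (b : B) :
    Algebra.TensorProduct.assoc k k k B B B
      (Algebra.TensorProduct.map hB.comulHom (.id k B) (hB.comulHom b)) =
        Algebra.TensorProduct.map (.id k B) hB.comulHom (hB.comulHom b) := by
  let j := Algebra.TensorProduct.map B.val B.val
  let j₃ := Algebra.TensorProduct.map B.val j
  have hj₃ : Function.Injective j₃ :=
    TensorProduct.map_injective_of_flat_flat B.val.toLinearMap j.toLinearMap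
      Subtype.val_injective (map_val_injective B)
  have h0 : ∀ (z : B ⊗[k] B) (y : B), j₃ (Algebra.TensorProduct.assoc k k k B B B (z ⊗ₜ y)) =
      Algebra.TensorProduct.assoc k k k A A A (j z ⊗ₜ (y : A)) := by
    intro z y
    induction z with
    | zero => simp
    | add z w hz hw => simp only [map_add, add_tmul, hz, hw]
    | tmul a b => rfl
  have h1 : ∀ z : B ⊗[k] B, j₃ (Algebra.TensorProduct.assoc k k k B B B
      (Algebra.TensorProduct.map hB.comulHom (.id k B) z)) =
        TensorProduct.assoc k A A A (comul.rTensor A (j z)) := by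
    intro z
    induction z with
    | zero => simp
    | add z w hz hw => simp only [map_add, hz, hw]
    | tmul x y =>
      refine (h0 (hB.comulHom x) y).trans ?_
      rw [show j (hB.comulHom x) = _ from hB.map_comulHom x]
      rfl
  have h2 : ∀ z : B ⊗[k] B, j₃ (Algebra.TensorProduct.map (.id k B) hB.comulHom z) =
      comul.lTensor A (j z) := by
    intro z
    induction z with
    | zero => simp
    | add z w hz hw => simp only [map_add, hz, hw]
    | tmul x y =>
      change (x : A) ⊗ₜ[k] j (hB.comulHom y) = _
      rw [show j (hB.comulHom y) = _ from hB.map_comulHom y]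
      rfl
  apply hj₃
  rw [h1, h2, show j (hB.comulHom b) = _ from hB.map_comulHom b]
  exact coassoc_apply (R := k) (b : A)

/-- The antipode of a Hopf subalgebra. -/
noncomputable def IsHopfSubalgebra.antipodeHom (hB : IsHopfSubalgebra B) : B →ₐ[k] B :=
  ((antipodeAlgHom k A).comp B.val).codRestrict B fun b => hB.antipode_mem b b.2

/-- The bialgebra structure of a Hopf subalgebra. -/
noncomputable abbrev IsHopfSubalgebra.bialgebra (hB : IsHopfSubalgebra B) : Bialgebra k B :=
  Bialgebra.ofAlgHom hB.comulHom ((counitAlgHom k A).comp B.val)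
    (AlgHom.ext hB.comulHom_coassoc)
    (AlgHom.ext fun b => by
      obtain ⟨n, x, y, -, hxy⟩ := hB.exists_comul_eq b.2
      change Algebra.TensorProduct.map _ _ (hB.comulHom b) = 1 ⊗ₜ[k] b
      have h := sum_counit_smul_of_comul_eq hxy
      rw [hB.comulHom_eq_sum hxy, map_sum,
        show b = ∑ i, counit (R := k) (x i : A) • y i from Subtype.ext (by simp [h]), tmul_sum]
      refine Finset.sum_congr rfl fun i _ => ?_
      change counit (R := k) (x i : A) ⊗ₜ[k] y i = _
      rw [tmul_smul, smul_tmul', smul_eq_mul, mul_one])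
    (AlgHom.ext fun b => by
      obtain ⟨n, x, y, -, hxy⟩ := hB.exists_comul_eq b.2
      change Algebra.TensorProduct.map _ _ (hB.comulHom b) = b ⊗ₜ[k] 1
      have h := sum_smul_counit_of_comul_eq hxy
      rw [hB.comulHom_eq_sum hxy, map_sum,
        show b = ∑ i, counit (R := k) (y i : A) • x i from Subtype.ext (by simp [h]), sum_tmul]
      refine Finset.sum_congr rfl fun i _ => ?_
      change x i ⊗ₜ[k] counit (R := k) (y i : A) = _
      rw [← smul_tmul', ← tmul_smul, smul_eq_mul, mul_one])

/-- The Hopf algebra structure of a Hopf subalgebra. -/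
noncomputable abbrev IsHopfSubalgebra.hopfAlgebra (hB : IsHopfSubalgebra B) : HopfAlgebra k B :=
  let _ := hB.bialgebra
  HopfAlgebra.ofAlgHom hB.antipodeHom
    (AlgHom.ext fun b => by
      obtain ⟨n, x, y, -, hxy⟩ := hB.exists_comul_eq b.2
      change Algebra.TensorProduct.lift hB.antipodeHom (.id k B) (fun _ _ => .all ..)
        (hB.comulHom b) =
        algebraMap k B (counit (R := k) (b : A))
      rw [hB.comulHom_eq_sum hxy, map_sum]
      refine Subtype.ext ?_
      refine Eq.trans ?_ (sum_antipode_mul_of_comul_eq hxy)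
      simp only [Algebra.TensorProduct.lift_tmul, AddSubmonoidClass.coe_finsetSum]
      rfl)
    (AlgHom.ext fun b => by
      obtain ⟨n, x, y, -, hxy⟩ := hB.exists_comul_eq b.2
      change Algebra.TensorProduct.lift (.id k B) hB.antipodeHom (fun _ _ => .all ..)
        (hB.comulHom b) =
        algebraMap k B (counit (R := k) (b : A))
      rw [hB.comulHom_eq_sum hxy, map_sum]
      refine Subtype.ext ?_
      refine Eq.trans ?_ (sum_mul_antipode_of_comul_eq hxy)
      simp only [Algebra.TensorProduct.lift_tmul, AddSubmonoidClass.coe_finsetSum]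
      rfl)

variable {σ : k →+* k} {s : A →+* A}

lemma IsHopfShift.restrict (hs : IsHopfShift σ s) (hB : IsHopfSubalgebra B)
    (hsB : ∀ b ∈ B, s b ∈ B) :
    let _ := hB.hopfAlgebra
    IsHopfShift σ (s.restrict B B hsB) :=
  let _ := hB.hopfAlgebra
  { map_algebraMap := fun c => Subtype.ext (hs.map_algebraMap c)
    comul_eq := fun {ι _ f x y} h => by
      refine hB.comulHom_eq_sum (hs.comul_eq ?_)
      change comul (R := k) (f : A) = ∑ i, (x i : A) ⊗ₜ[k] (y i : A)
      rw [← hB.map_comulHom, show hB.comulHom f = _ from h, map_sum]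
      rfl
    counit_eq := fun f => hs.counit_eq f
    antipode_eq := fun f => Subtype.ext (hs.antipode_eq f) }

/-- Restriction of points to a Hopf subalgebra. -/
noncomputable def Pt.restrict (hB : IsHopfSubalgebra B) (R : Type u) [CommRing R] [Algebra k R] :
    let _ := hB.hopfAlgebra
    Pt k A R →* Pt k B R :=
  let _ := hB.hopfAlgebra
  { toFun := fun g => Pt.mk (g.hom.comp B.val)
    map_one' := Pt.ext' fun f => rfl
    map_mul' := fun g h => Pt.ext' fun f => by
      obtain ⟨n, x, y, -, hxy⟩ := hB.exists_comul_eq f.2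
      refine (Pt.mul_apply_sum g h hxy).trans ?_
      exact (Pt.mul_apply_sum (Pt.mk (g.hom.comp B.val)) (Pt.mk (h.hom.comp B.val))
        (hB.comulHom_eq_sum hxy)).symm }

end SubHopf

end AffineGroup

namespace DiffAlgGroup

open AffineGroup

section OfHopf

variable {k B : Type u} [Field k] {σ : k →+* k} [CommRing B] [HopfAlgebra k B] {s : B →+* B}

/-- The `k`-`σ`-algebra underlying a Hopf algebra with a compatible endomorphism. -/
def hopfDiffAlg (hs : IsHopfShift σ s) : DiffAlg k σ where
  carrier := B
  shift := s
  shift_algebraMap := hs.map_algebraMap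

/-- The points of a Hopf algebra with endomorphism that are compatible with the endomorphisms. -/
def shiftPoints (hs : IsHopfShift σ s) (R : DiffAlg k σ) : Subgroup (Pt k B R) where
  carrier := {g | ∀ b, g (s b) = R.shift (g b)}
  one_mem' b := by
    rw [Pt.one_apply, Pt.one_apply, hs.counit_eq, R.shift_algebraMap]
  mul_mem' {g h} hg hh b := by
    obtain ⟨n, x, y, -, hxy⟩ := exists_sum_tmul_linearIndependent (comul b : B ⊗[k] B)
    rw [Pt.mul_apply_sum _ _ hxy, Pt.mul_apply_sum _ _ (hs.comul_eq hxy), map_sum]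
    refine Finset.sum_congr rfl fun i _ => ?_
    rw [hg, hh, map_mul]
  inv_mem' {g} hg b := by
    rw [Pt.inv_apply, Pt.inv_apply, hs.antipode_eq, hg]

/-- The group functor of a Hopf algebra with endomorphism. -/
noncomputable def shiftPointsFunctor (hs : IsHopfShift σ s) : DiffAlg k σ ⥤ GrpCat.{u} where
  obj R := GrpCat.of (shiftPoints hs R)
  map {R S} φ := GrpCat.ofHom (((Pt.map φ.toAlgHom).comp (shiftPoints hs R).subtype).codRestrict
    (shiftPoints hs S) fun g b => by
      change φ.toAlgHom (g.1 (s b)) = S.shift (φ.toAlgHom (g.1 b))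
      rw [g.2, φ.map_shift])

/-- The `σ`-algebraic group of a finitely `σ`-generated Hopf algebra with endomorphism. -/
noncomputable def ofHopf (hs : IsHopfShift σ s) (hfg : (hopfDiffAlg hs).FinitelyGenerated) :
    DiffAlgGroup k σ where
  functor := shiftPointsFunctor hs
  coordRing := hopfDiffAlg hs
  finitelyGenerated := hfg
  corep :=
    { homEquiv := fun {R} =>
        { toFun := fun f => (⟨Pt.mk f.toAlgHom, f.map_shift⟩ : shiftPoints hs R)
          invFun := fun g =>
            ⟨(show shiftPoints hs R from g).1.hom, (show shiftPoints hs R from g).2⟩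
          left_inv := fun _ => rfl
          right_inv := fun _ => rfl }
      homEquiv_comp := fun _ _ => rfl }

end OfHopf

variable {k : Type u} [Field k] {σ : k →+* k} (G : DiffAlgGroup k σ)

lemma toPt_shift {R : DiffAlg k σ} (g : G.points R) (f : G.coordRing) :
    G.toPt g (G.coordRing.shift f) = R.shift (G.toPt g f) := (G.pointHom g).map_shift f

variable {B : Subalgebra k G.coordRing} (hB : IsHopfSubalgebra B)
  (hsB : ∀ b ∈ B, G.coordRing.shift b ∈ B)

/-- The `σ`-algebraic group whose coordinate ring is a finitely `σ`-generated `σ`-stable Hopf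
subalgebra of `k{G}`. -/
noncomputable def ofSubalgebra
    (hfg : (G.coordRing.ofSubalgebra B hsB).FinitelyGenerated) : DiffAlgGroup k σ :=
  let _ := hB.hopfAlgebra
  ofHopf (G.isHopfShift.restrict hB hsB) hfg

/-- The morphism from `G` dual to the inclusion of a Hopf subalgebra. -/
noncomputable def toOfSubalgebra (hfg : (G.coordRing.ofSubalgebra B hsB).FinitelyGenerated) :
    G.Hom (G.ofSubalgebra hB hsB hfg) :=
  let _ := hB.hopfAlgebra
  { app := fun R => GrpCat.ofHom (((Pt.restrict hB R).comp G.toPt).codRestrict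
      (shiftPoints (G.isHopfShift.restrict hB hsB) R) fun g b => G.toPt_shift g b)
    naturality := fun R S φ => by
      ext g
      refine Subtype.ext (Pt.ext' fun b => ?_)
      exact G.eval_map φ g b }

lemma eval_toOfSubalgebra (hfg : (G.coordRing.ofSubalgebra B hsB).FinitelyGenerated)
    {R : DiffAlg k σ} (g : G.points R) (b : B) :
    (G.ofSubalgebra hB hsB hfg).eval b (((G.toOfSubalgebra hB hsB hfg).app R).hom g) =
      G.eval (b : G.coordRing) g := rfl

end DiffAlgGroup

/-! ### Morphisms, duals and quotients -/

namespace DiffAlgGroup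

open AffineGroup

variable {k : Type u} [Field k] {σ : k →+* k} {G H Q : DiffAlgGroup k σ}

namespace Hom

lemma pointHom_app (φ : G.Hom H) {R : DiffAlg k σ} (g : G.points R) :
    H.pointHom ((φ.app R).hom g) = φ.dual ≫ G.pointHom g := by
  have h : (φ.app R).hom ((G.functor.map (G.pointHom g)).hom (G.ofHom (𝟙 _))) =
      (H.functor.map (G.pointHom g)).hom ((φ.app _).hom (G.ofHom (𝟙 _))) :=
    congrArg (fun f => f.hom (G.ofHom (𝟙 _))) (φ.naturality (G.pointHom g))
  rw [map_ofHom, Category.id_comp, ofHom_pointHom] at h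
  rw [h, pointHom_map]
  rfl

lemma eval_app (φ : G.Hom H) {R : DiffAlg k σ} (g : G.points R) (f : H.coordRing) :
    H.eval f ((φ.app R).hom g) = G.eval (φ.dual.toAlgHom f) g := by
  rw [eval, pointHom_app]
  rfl

lemma dual_comp (φ : G.Hom H) (ψ : H.Hom Q) :
    Hom.dual (G := G) (H := Q) (φ ≫ ψ) = ψ.dual ≫ φ.dual :=
  pointHom_app ψ ((φ.app G.coordRing).hom (G.corep.homEquiv (𝟙 G.coordRing)))

lemma dual_injective : Function.Injective (Hom.dual : G.Hom H → (H.coordRing ⟶ G.coordRing)) := by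
  intro φ ψ h
  ext R g
  exact H.pointHom_injective (by rw [pointHom_app, pointHom_app, h])

lemma comul_dual (φ : G.Hom H) (f : H.coordRing) :
    comul (R := k) (φ.dual.toAlgHom f) =
      Algebra.TensorProduct.map φ.dual.toAlgHom φ.dual.toAlgHom (comul f) := by
  let g := G.ofHom (DiffAlg.inl G.coordRing G.coordRing)
  let h := G.ofHom (DiffAlg.inr G.coordRing G.coordRing)
  have h1 : H.pointHom ((φ.app _).hom (g * h)) = φ.dual ≫ G.comulHom := pointHom_app φ _
  have h2 := H.pointHom_mul_apply_of_tmul (g := (φ.app _).hom g) (h := (φ.app _).hom h)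
    (F := Algebra.TensorProduct.map φ.dual.toAlgHom φ.dual.toAlgHom) (fun a b => by
      rw [pointHom_app, pointHom_app, pointHom_ofHom, pointHom_ofHom]
      have h3 : φ.dual.toAlgHom a ⊗ₜ[k] φ.dual.toAlgHom b =
        (φ.dual.toAlgHom a ⊗ₜ[k] 1) * (1 ⊗ₜ[k] φ.dual.toAlgHom b) := by simp
      exact h3) f
  rw [← map_mul, h1] at h2
  exact h2

lemma antipode_dual (φ : G.Hom H) (f : H.coordRing) :
    antipode k (φ.dual.toAlgHom f) = φ.dual.toAlgHom (antipode k f) := by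
  have h1 : H.pointHom ((φ.app _).hom (G.ofHom (𝟙 _))⁻¹) = φ.dual ≫ G.antipodeHom :=
    pointHom_app φ _
  rw [map_inv, ← antipodeHom_comp, pointHom_app, pointHom_ofHom, Category.comp_id] at h1
  exact congrArg (fun p => p.toAlgHom f) h1.symm

lemma counit_dual (φ : G.Hom H) (f : H.coordRing) :
    counit (R := k) (φ.dual.toAlgHom f) = counit (R := k) f := by
  have h1 : H.pointHom ((φ.app (DiffAlg.base σ)).hom 1) = φ.dual ≫ G.counitHom :=
    pointHom_app φ _
  rw [map_one] at h1
  exact congrArg (fun p => p.toAlgHom f) h1.symm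

lemma isHopfSubalgebra_range_dual (φ : G.Hom H) : IsHopfSubalgebra φ.dual.toAlgHom.range where
  comul_mem := by
    rintro _ ⟨f, rfl⟩
    change comul (φ.dual.toAlgHom f) ∈ _
    rw [comul_dual]
    induction (comul f : H.coordRing ⊗[k] H.coordRing) with
    | zero => rw [map_zero]; exact Subalgebra.zero_mem _
    | tmul x y => exact tmul_mem_range_map ⟨x, rfl⟩ ⟨y, rfl⟩
    | add x y hx hy => rw [map_add]; exact Subalgebra.add_mem _ hx hy
  antipode_mem := by
    rintro _ ⟨f, rfl⟩
    exact ⟨antipode k f, (antipode_dual φ f).symm⟩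

lemma shift_mem_range_dual (φ : G.Hom H) :
    ∀ f ∈ φ.dual.toAlgHom.range, G.coordRing.shift f ∈ φ.dual.toAlgHom.range := by
  rintro _ ⟨f, rfl⟩
  exact ⟨H.coordRing.shift f, φ.dual.map_shift f⟩

/-- The kernel of `φ` is the closed subgroup cut out by the functions in the image of the dual that
vanish at the identity. -/
lemma mem_ker_iff (φ : G.Hom H) {R : DiffAlg k σ} {g : G.points R} :
    g ∈ φ.ker R ↔ ∀ f ∈ augIdeal φ.dual.toAlgHom.range, G.eval f g = 0 := by
  refine Iff.trans ?_ (forall_augIdeal_iff (x := G.toPt g)).symm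
  have h1 : ∀ f, H.eval f (1 : H.points R) = algebraMap k R (counit (R := k) f) :=
    H.pointHom_one_apply R
  constructor
  · rintro hg _ ⟨f, rfl⟩
    have hg' : (φ.app R).hom g = 1 := hg
    refine (eval_app φ g f).symm.trans ?_
    rw [hg', h1]
    exact congrArg _ (counit_dual φ f).symm
  · intro h
    refine H.eval_injective fun f => ?_
    rw [h1, eval_app, ← counit_dual φ]
    exact h _ ⟨f, rfl⟩

/-- The morphism of groups defined by a morphism of coordinate rings that is compatible with the
comultiplications. -/
noncomputable def ofDual (ψ : H.coordRing ⟶ G.coordRing)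
    (hψ : ∀ f, comul (R := k) (ψ.toAlgHom f) =
      Algebra.TensorProduct.map ψ.toAlgHom ψ.toAlgHom (comul f)) : G.Hom H where
  app R := GrpCat.ofHom (MonoidHom.mk' (fun g : G.points R => H.ofHom (ψ ≫ G.pointHom g))
    fun g h => H.eval_injective fun f => by
      rw [eval_ofHom]
      refine (G.pointHom_mul_apply g h _).trans ?_
      have h1 := H.pointHom_mul_apply_of_tmul (g := H.ofHom (ψ ≫ G.pointHom g))
        (h := H.ofHom (ψ ≫ G.pointHom h))
        (F := (Algebra.TensorProduct.lift (G.pointHom g).toAlgHom (G.pointHom h).toAlgHom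
          (fun _ _ => .all ..)).comp (Algebra.TensorProduct.map ψ.toAlgHom ψ.toAlgHom))
        (fun a b => by rw [pointHom_ofHom, pointHom_ofHom]; simp) f
      refine Eq.trans ?_ h1.symm
      exact congrArg (Algebra.TensorProduct.lift (G.pointHom g).toAlgHom (G.pointHom h).toAlgHom
          (fun _ _ => .all ..)) (hψ f))
  naturality R S p := by
    ext g
    change H.ofHom (ψ ≫ G.pointHom ((G.functor.map p).hom g)) =
      (H.functor.map p).hom (H.ofHom (ψ ≫ G.pointHom g))
    rw [map_ofHom, pointHom_map, Category.assoc]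

@[simp] lemma dual_ofDual (ψ : H.coordRing ⟶ G.coordRing)
    (hψ : ∀ f, comul (R := k) (ψ.toAlgHom f) =
      Algebra.TensorProduct.map ψ.toAlgHom ψ.toAlgHom (comul f)) : (ofDual ψ hψ).dual = ψ := by
  change H.pointHom (H.ofHom (ψ ≫ G.pointHom (G.ofHom (𝟙 _)))) = ψ
  rw [pointHom_ofHom, pointHom_ofHom, Category.comp_id]

/-- A morphism factors through `π` if its dual takes values in the image of the dual of `π`. -/
lemma exists_comp_eq {π : G.Hom Q} (hπ : Function.Injective π.dual.toAlgHom) {φ : G.Hom H}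
    (h : ∀ f, φ.dual.toAlgHom f ∈ π.dual.toAlgHom.range) : ∃ φ' : Q.Hom H, π ≫ φ' = φ := by
  -- the dual of the factorization; its compatibility with the structure of `k{G}` can be checked
  -- after composition with the injective dual of `π`
  let e := AlgEquiv.ofInjective π.dual.toAlgHom hπ
  let ψ₀ : H.coordRing →ₐ[k] Q.coordRing :=
    (e.symm : _ →ₐ[k] Q.coordRing).comp (φ.dual.toAlgHom.codRestrict _ h)
  have hψ₀ : ∀ f, π.dual.toAlgHom (ψ₀ f) = φ.dual.toAlgHom f := fun f =>
    congrArg Subtype.val (e.apply_symm_apply (φ.dual.toAlgHom.codRestrict _ h f))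
  let ψ : H.coordRing ⟶ Q.coordRing :=
    { toAlgHom := ψ₀
      map_shift := fun f => hπ (by
        rw [hψ₀, φ.dual.map_shift, π.dual.map_shift, hψ₀]) }
  have hinj : Function.Injective
      (Algebra.TensorProduct.map π.dual.toAlgHom π.dual.toAlgHom) :=
    TensorProduct.map_injective_of_flat_flat π.dual.toAlgHom.toLinearMap
      π.dual.toAlgHom.toLinearMap hπ hπ
  have hcomp : π.dual.toAlgHom.comp ψ₀ = φ.dual.toAlgHom := AlgHom.ext hψ₀
  refine ⟨ofDual ψ fun f => hinj ?_, dual_injective ?_⟩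
  · rw [← comul_dual, ← AlgHom.comp_apply (Algebra.TensorProduct.map π.dual.toAlgHom _),
      ← Algebra.TensorProduct.map_comp, show π.dual.toAlgHom.comp ψ.toAlgHom = _ from hcomp,
      ← comul_dual]
    exact congrArg _ (hψ₀ f)
  · rw [dual_comp, dual_ofDual]
    exact DiffAlg.hom_ext hψ₀

end Hom

open DiffAlgGroup.ClosedSubgroup

variable {N : G.ClosedSubgroup}

/-- A morphism with kernel `N` and injective dual is a quotient mod `N`: a function on `G` that is
invariant under `N` lies in the image of the dual. -/
theorem isQuotient_of_ker_eq {π : G.Hom Q} (hker : ∀ R, π.ker R = N.subgroup R)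
    (hinj : Function.Injective π.dual.toAlgHom) : IsQuotient N π := by
  have hI : augIdeal π.dual.toAlgHom.range = N.vanishingIdeal :=
    eq_vanishingIdeal
      (fun f hf => G.isHopfShift.map_mem_augIdeal π.shift_mem_range_dual hf)
      fun R g => by rw [← hker, Hom.mem_ker_iff]
  refine ⟨fun R => (hker R).ge, fun H φ hφ => ?_⟩
  obtain ⟨φ', h'⟩ := Hom.exists_comp_eq (φ := φ) hinj fun f =>
    π.isHopfSubalgebra_range_dual.mem_of_invariant fun R _ _ g x hx => by
      have hx' : x ∈ closedSubgroup N.vanishingIdeal R := by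
        intro f hf
        rw [← hI] at hf
        exact forall_augIdeal_iff.2 hx f hf
      -- points over rings without endomorphism are specializations of the universal pair
      obtain ⟨ρ, rfl, rfl⟩ := exists_eq_map_pair g x hx'
      have h1 : (φ.app _).hom (N.pairFst * N.pairSnd) = (φ.app _).hom N.pairFst := by
        rw [map_mul, show (φ.app _).hom N.pairSnd = 1 from hφ _ pairSnd_mem, mul_one]
      rw [← map_mul, ← map_mul, Pt.map_apply, Pt.map_apply, toPt_apply, toPt_apply,
        ← Hom.eval_app, ← Hom.eval_app, h1]
  refine ⟨φ', h', fun φ'' h'' => Hom.dual_injective (DiffAlg.hom_ext fun f => hinj ?_)⟩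
  have h2 : φ''.dual ≫ π.dual = φ'.dual ≫ π.dual := by
    rw [← Hom.dual_comp, ← Hom.dual_comp]
    exact congrArg Hom.dual (h''.trans h'.symm)
  exact congrArg (fun p => p.toAlgHom f) h2

/-- The invariants under `N` form the coordinate ring of a `σ`-algebraic group, and the
corresponding morphism has kernel `N`. -/
theorem exists_ker_eq (hN : N.IsNormal) : ∃ (Q : DiffAlgGroup k σ) (π : G.Hom Q),
    (∀ R, π.ker R = N.subgroup R) ∧ Function.Injective π.dual.toAlgHom := by
  have hIn := hN.isNormalIdeal
  have hI : ∀ f ∈ N.vanishingIdeal, G.coordRing.shift f ∈ N.vanishingIdeal :=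
    fun f hf => shift_mem_vanishingIdeal hf
  obtain ⟨X, hX, hXtop⟩ := G.finitelyGenerated
  obtain ⟨Y, hY, hYB, hYC⟩ := G.isHopfShift.exists_finite_generators_invariants hI hIn hX
    fun C hC hsC => top_le_iff.1 (hXtop ▸ G.coordRing.adjoin_le hC hsC)
  have hB := isHopfSubalgebra_invariants hIn
  have hsB : ∀ b ∈ invariants k N.vanishingIdeal,
      G.coordRing.shift b ∈ invariants k N.vanishingIdeal :=
    fun b hb => G.isHopfShift.map_mem_invariants hI hb
  have hfg : (G.coordRing.ofSubalgebra _ hsB).FinitelyGenerated := by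
    let B' := G.coordRing.ofSubalgebra _ hsB
    let S : Set B' := {b | (b : invariants k N.vanishingIdeal).1 ∈ Y}
    refine ⟨S, hY.preimage Subtype.val_injective.injOn, top_le_iff.1 fun b _ => ?_⟩
    obtain ⟨c, hc, hcb⟩ := hYC ((B'.adjoin S).map (invariants k N.vanishingIdeal).val)
      (fun y hy => ⟨⟨y, hYB hy⟩, B'.subset_adjoin S hy, rfl⟩)
      (by
        rintro _ ⟨c, hc, rfl⟩
        exact ⟨B'.shift c, B'.shift_mem_adjoin hc, rfl⟩) b.2
    exact (Subtype.ext hcb : c = b) ▸ hc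
  let π := G.toOfSubalgebra hB hsB hfg
  have hπ : ∀ b : invariants k N.vanishingIdeal, π.dual.toAlgHom b = (b : G.coordRing) :=
    fun b => (G.eval_toOfSubalgebra hB hsB hfg (G.ofHom (𝟙 _)) b).trans (G.eval_ofHom _ _)
  have hrange : π.dual.toAlgHom.range = invariants k N.vanishingIdeal := by
    ext f
    exact ⟨fun ⟨b, hb⟩ => hb ▸ (hπ b).symm ▸ Subtype.prop (p := (· ∈ invariants k _)) b,
      fun hf => ⟨(⟨f, hf⟩ : invariants k N.vanishingIdeal), hπ ⟨f, hf⟩⟩⟩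
  refine ⟨_, π, fun R => ?_, fun a b hab => ?_⟩
  · ext g
    rw [Hom.mem_ker_iff, hrange, hIn.augIdeal_invariants, mem_subgroup_iff]
  · exact Subtype.ext ((hπ a).symm.trans (hab.trans (hπ b)))

/-- All quotients mod `N` have the same kernel, and injectivity of the dual passes from one
quotient to any other. -/
lemma IsQuotient.ker_eq_and_injective {Q' : DiffAlgGroup k σ} {π : G.Hom Q} {π' : G.Hom Q'}
    (hπ : IsQuotient N π) (hπ' : IsQuotient N π') :
    (∀ R, π.ker R = π'.ker R) ∧
      (Function.Injective π'.dual.toAlgHom → Function.Injective π.dual.toAlgHom) := by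
  obtain ⟨α, hα, -⟩ := hπ.2 Q' π' hπ'.1
  obtain ⟨β, hβ, -⟩ := hπ'.2 Q π hπ.1
  obtain ⟨γ, -, hγ⟩ := hπ.2 Q π hπ.1
  have hαβ : α ≫ β = 𝟙 Q.functor :=
    (hγ _ (by
      change π ≫ α ≫ β = π
      rw [← Category.assoc, hα, hβ])).trans (hγ _ (Category.comp_id _)).symm
  have hle : ∀ {Q Q' : DiffAlgGroup k σ} {π : G.Hom Q} {π' : G.Hom Q'} {α : Q.Hom Q'},
      π ≫ α = π' → ∀ R, π.ker R ≤ π'.ker R := by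
    rintro Q Q' π _ α rfl R g hg
    change (α.app R).hom ((π.app R).hom g) = 1
    rw [show (π.app R).hom g = 1 from hg, map_one]
  refine ⟨fun R => le_antisymm (hle hα R) (hle hβ R), fun hinj => ?_⟩
  have h1 : β.dual ≫ α.dual = 𝟙 Q.coordRing := by
    rw [← Hom.dual_comp, hαβ]
    exact Q.pointHom_ofHom _
  have h2 : π.dual = β.dual ≫ π'.dual := by rw [← Hom.dual_comp, hβ]
  rw [h2]
  refine hinj.comp (Function.LeftInverse.injective (g := α.dual.toAlgHom) fun a => ?_)
  exact congrArg (fun p => p.toAlgHom a) h1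

end DiffAlgGroup

theorem mainTheorem8 {k : Type u} [Field k] (σ : k →+* k) (G : DiffAlgGroup k σ)
    (N : G.ClosedSubgroup) (hN : N.IsNormal) :
    (∃ (Q : DiffAlgGroup k σ) (π : G.Hom Q), DiffAlgGroup.IsQuotient N π) ∧
      ∀ (Q : DiffAlgGroup k σ) (π : G.Hom Q),
        DiffAlgGroup.IsQuotient N π ↔
          (∀ R : DiffAlg k σ, π.ker R = N.subgroup R) ∧
            Function.Injective π.dual.toAlgHom := by
  obtain ⟨Q₀, π₀, hker, hinj⟩ := DiffAlgGroup.exists_ker_eq hN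
  have hπ₀ := DiffAlgGroup.isQuotient_of_ker_eq hker hinj
  refine ⟨⟨Q₀, π₀, hπ₀⟩, fun Q π => ⟨fun hπ => ?_, fun h =>
    DiffAlgGroup.isQuotient_of_ker_eq h.1 h.2⟩⟩
  obtain ⟨h1, h2⟩ := hπ.ker_eq_and_injective hπ₀
  exact ⟨fun R => (h1 R).trans (hker R), h2 hinj⟩
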